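/- Let $M$ be a connected, simply connected smooth finite-dimensional manifold, $G$ a connected finite-dimensional Lie group with Lie algebra $\mathfrak g$, and $P\to M$ a smooth principal $G$-bundle with a connection $A$. Let $n\ge 1$, let $B$ be a smooth $\mathfrak g$-valued $(n+1)$-form on $M$ transforming in the adjoint representation (an $\mathrm{Ad}P$-valued form), and let $x_0\in M$ with a fixed frame $p_0\in P_{x_0}$. Let $\Omega^n(M,x_0)$ be the space of $n$-loops, i.e. smooth maps $N:[0,2\pi]^n\to M$, $\sigma\mapsto x(\sigma)$, sending the boundary to $x_0$. A tangent (deformation) vector at $N$ is a smooth vector field $T$ along $N$, $T(\sigma)\in T_{x(\sigma)}M$, not necessarily tangential to $N$, vanishing on the boundary of the cube. For each $N$ and $\sigma$ choose a $C^1$ path $\gamma_\sigma$ from $x_0$ to $x(\sigma)$, and let $B^W(x(\sigma))=W_{\gamma_\sigma}^{-1}B(x(\sigma))W_{\gamma_\sigma}$ be $B$ parallel transported by $A$ to $x_0$ along $\gamma_\sigma$ (a $\mathfrak g$-valued form by means of $p_0$). Write $$\iota_{T(\sigma)}B^W(x(\sigma)) = B^W(x(\sigma))\Bigl(T(\sigma),\tfrac{\partial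 x}{\partial\sigma^1},\dots,\tfrac{\partial x}{\partial\sigma^n}\Bigr)\in\mathfrak g,\qquad \mathcal A(T)=\int_N\iota_TB^W=\int_{[0,2\pi]^n}\iota_{T(\sigma)}B^W(x(\sigma))\,d\sigma .$$ Here $\mathcal A$ is regarded as a connection ($\mathfrak g$-valued $1$-form) on $\Omega^n(M,x_0)$. A smooth loop in $\Omega^n(M,x_0)$ is a smooth map $\Gamma:[0,2\pi]^n\times[0,2\pi]\to M$ with $\Gamma(\cdot,\tau)\in\Omega^n(M,x_0)$ for all $\tau$ and $\Gamma(\cdot,0)=\Gamma(\cdot,2\pi)$; its holonomy is $\mathrm{hol}(\Gamma)=U(2\pi)$, where $U:[0,2\pi]\to G$ solves $\frac{dU}{d\tau}+\mathcal A(\partial_\tau\Gamma)\,U=0$, $U(0)=1$. The connection $\mathcal A$ is called r-flat if $\mathrm{hol}(\Gamma\circ h)=\mathrm{hol}(\Gamma)$ for every such $\Gamma$ and every diffeomorphism $h$ of $[0,2\pi]^{n+1}$ that is the identity on the boundary and is connected to the identity through such diffeomorphisms by a smooth isotopy. **Theorem.** Suppose $A$ is flat. Then $\mathcal A$ is r-flat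 if and only if $$\Bigl[\iota_{T(\sigma)}B^W(x(\sigma)),\ \int_N\iota_TB^W\Bigr]=0$$ for every $N\in\Omega^n(M,x_0)$, every deformation vector field $T$ along $N$, and every $\sigma\in[0,2\pi]^n$. -/

import Mathlib

open Set MeasureTheory
open scoped Manifold ContDiff

noncomputable section

namespace LoopSpaceConnection

/-! ## The Lie algebra of the structure group

All manifolds are modelled on finite-dimensional real vector spaces. The Lie algebra of `G` is
`GroupLieAlgebra 𝓘(ℝ, EG) G`, the tangent space of `G` at `1`; as a vector space this is the
model space `EG` of `G`, which is the codomain used below for Lie-algebra-valued functions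
(so that they can be differentiated and integrated). -/

section LieAlgebra

variable {EG : Type*} [NormedAddCommGroup EG] [NormedSpace ℝ EG]
  (G : Type*) [TopologicalSpace G] [ChartedSpace EG G] [Group G]

/-- The Lie bracket of the Lie algebra `T_1 G = EG` of the Lie group `G`. -/
def bracket (u v : EG) : EG :=
  (⁅(show GroupLieAlgebra 𝓘(ℝ, EG) G from u), (show GroupLieAlgebra 𝓘(ℝ, EG) G from v)⁆ :
    GroupLieAlgebra 𝓘(ℝ, EG) G)

variable {G}

/-- The adjoint action of `g` on the Lie algebra: the derivative at `1` of `h ↦ g h g⁻¹`. -/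
def Ad (g : G) (u : EG) : EG :=
  mfderiv 𝓘(ℝ, EG) 𝓘(ℝ, EG) (fun h : G => g * h * g⁻¹) 1 u

/-- The vector `u g ∈ T_g G`: the image of `u ∈ T_1 G` under right translation by `g`. -/
def rightTranslate (u : EG) (g : G) : TangentSpace 𝓘(ℝ, EG) g :=
  (show EG from mfderiv 𝓘(ℝ, EG) 𝓘(ℝ, EG) (fun h : G => h * g) 1 u)

/-- `U : [0, 2π] → G` solves the parallel transport equation `dU/dτ + a(τ) U = 0`, `U(0) = 1`. -/
structure SolvesTransport (a : ℝ → EG) (U : ℝ → G) : Prop where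
  init : U 0 = 1
  diff : ∀ τ ∈ Icc (0 : ℝ) (2 * Real.pi),
    MDifferentiableWithinAt 𝓘(ℝ, ℝ) 𝓘(ℝ, EG) U (Icc 0 (2 * Real.pi)) τ
  eqn : ∀ τ ∈ Icc (0 : ℝ) (2 * Real.pi),
    mfderivWithin 𝓘(ℝ, ℝ) 𝓘(ℝ, EG) U (Icc 0 (2 * Real.pi)) τ (1 : ℝ)
      + rightTranslate (a τ) (U τ) = 0

open Classical in
/-- The value at `2π` of the solution of `dU/dτ + a(τ) U = 0`, `U(0) = 1`. -/
def transportHolonomy (G : Type*) [TopologicalSpace G] [ChartedSpace EG G] [Group G]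
    (a : ℝ → EG) : G :=
  if h : ∃ U : ℝ → G, SolvesTransport a U then h.choose (2 * Real.pi) else 1

end LieAlgebra

/-! ## Principal bundles, connections, curvature, forms of adjoint type -/

section Bundles

variable (E : Type*) [NormedAddCommGroup E] [NormedSpace ℝ E]
  (EG : Type*) [NormedAddCommGroup EG] [NormedSpace ℝ EG]
  (EP : Type*) [NormedAddCommGroup EP] [NormedSpace ℝ EP]
  (M : Type*) [TopologicalSpace M] [ChartedSpace E M]
  (G : Type*) [TopologicalSpace G] [ChartedSpace EG G] [Group G]
  (P : Type*) [TopologicalSpace P] [ChartedSpace EP P]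

/-- A smooth principal `G`-bundle `proj : P → M`, with right action `act p g = p g`. The last
field is local triviality: over an open neighbourhood `U` of any point there is a smooth section
`s` such that `(y, g) ↦ s(y) g` is a diffeomorphism `U × G → proj⁻¹ U` (with inverse
`p ↦ (proj p, k p)`). -/
structure PrincipalBundle where
  proj : P → M
  act : P → G → P
  act_one : ∀ p, act p 1 = p
  act_mul : ∀ p g h, act p (g * h) = act (act p g) h
  proj_act : ∀ p g, proj (act p g) = proj p
  smooth_proj : ContMDiff 𝓘(ℝ, EP) 𝓘(ℝ, E) ∞ proj
  smooth_act : ContMDiff (𝓘(ℝ, EP).prod 𝓘(ℝ, EG)) 𝓘(ℝ, EP) ∞ (fun z : P × G => act z.1 z.2)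
  locally_trivial : ∀ x : M, ∃ U : Set M, IsOpen U ∧ x ∈ U ∧ ∃ (s : M → P) (k : P → G),
    ContMDiffOn 𝓘(ℝ, E) 𝓘(ℝ, EP) ∞ s U ∧
    ContMDiffOn 𝓘(ℝ, EP) 𝓘(ℝ, EG) ∞ k (proj ⁻¹' U) ∧
    (∀ y ∈ U, proj (s y) = y) ∧
    (∀ p ∈ proj ⁻¹' U, act (s (proj p)) (k p) = p) ∧
    (∀ y ∈ U, ∀ g : G, k (act (s y) g) = g)

variable {E EG EP M G P}

/-- The coordinate expression, in the preferred chart at `p₀`, of a `1`-form on `P`. -/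
def oneFormInChart (θ : ∀ p : P, TangentSpace 𝓘(ℝ, EP) p →L[ℝ] EG) (p₀ : P) (z : EP) :
    EP →L[ℝ] EG :=
  (θ ((extChartAt 𝓘(ℝ, EP) p₀).symm z)).comp
    (mfderiv 𝓘(ℝ, EP) 𝓘(ℝ, EP) (extChartAt 𝓘(ℝ, EP) p₀).symm z)

/-- The exterior derivative at `p` of a Lie-algebra-valued `1`-form on `P`, computed in the
preferred chart at `p`: `(dθ)(u, v) = (∂_u θ)(v) - (∂_v θ)(u)`. -/
def extDerivOne (θ : ∀ p : P, TangentSpace 𝓘(ℝ, EP) p →L[ℝ] EG) (p : P)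
    (u v : TangentSpace 𝓘(ℝ, EP) p) : EG :=
  let φ := extChartAt 𝓘(ℝ, EP) p
  let D := fderiv ℝ (oneFormInChart θ p) (φ p)
  let u' : EP := mfderiv 𝓘(ℝ, EP) 𝓘(ℝ, EP) φ p u
  let v' : EP := mfderiv 𝓘(ℝ, EP) 𝓘(ℝ, EP) φ p v
  D u' v' - D v' u'

/-- A principal connection: a smooth Lie-algebra-valued `1`-form `θ` on `P` which reproduces the
generators of the vertical vector fields and is equivariant, `R_g^* θ = Ad(g⁻¹) θ`. -/
structure PrincipalConnection (π : PrincipalBundle E EG EP M G P) where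
  form : ∀ p : P, TangentSpace 𝓘(ℝ, EP) p →L[ℝ] EG
  smooth : ∀ p₀ : P,
    ContDiffOn ℝ ∞ (oneFormInChart form p₀) (extChartAt 𝓘(ℝ, EP) p₀).target
  vertical : ∀ (p : P) (u : EG),
    form p (show EP from mfderiv 𝓘(ℝ, EG) 𝓘(ℝ, EP) (fun g : G => π.act p g) 1 u) = u
  equivariant : ∀ (p : P) (g : G) (v : TangentSpace 𝓘(ℝ, EP) p),
    form (π.act p g) (mfderiv 𝓘(ℝ, EP) 𝓘(ℝ, EP) (fun q : P => π.act q g) p v)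
      = Ad g⁻¹ (form p v)

/-- The connection is flat: its curvature `F = dθ + ½ [θ ∧ θ]`, i.e.
`F(u, v) = (dθ)(u, v) + [θ(u), θ(v)]`, vanishes. -/
def PrincipalConnection.IsFlat {π : PrincipalBundle E EG EP M G P}
    (A : PrincipalConnection π) : Prop :=
  ∀ (p : P) (u v : TangentSpace 𝓘(ℝ, EP) p),
    extDerivOne A.form p u v + bracket G (A.form p u) (A.form p v) = 0

/-- A smooth Lie-algebra-valued `k`-form `B` on `M` that transforms via the adjoint
representation: `form p` is the expression of `B` at the point `proj p` in the frame `p` of the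
bundle, and changing the frame from `p` to `p g` replaces it by `Ad(g⁻¹) ∘ form p`. Smoothness is
smoothness, in the charts of `P`, of the form `p ↦ form p ∘ (d proj)_p` on `P`. -/
structure AdjointForm (π : PrincipalBundle E EG EP M G P) (k : ℕ) where
  form : ∀ p : P, (TangentSpace 𝓘(ℝ, E) (π.proj p)) [⋀^Fin k]→L[ℝ] EG
  equivariant : ∀ (p : P) (g : G) (v : Fin k → E),
    form (π.act p g) v = Ad g⁻¹ (form p v)
  smooth : ∀ p₀ : P, ContDiffOn ℝ ∞
    (fun z : EP =>
      (form ((extChartAt 𝓘(ℝ, EP) p₀).symm z)).compContinuousLinearMap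
        ((mfderiv 𝓘(ℝ, EP) 𝓘(ℝ, E) π.proj ((extChartAt 𝓘(ℝ, EP) p₀).symm z)).comp
          (mfderiv 𝓘(ℝ, EP) 𝓘(ℝ, EP) (extChartAt 𝓘(ℝ, EP) p₀).symm z) :
            EP →L[ℝ] TangentSpace 𝓘(ℝ, E) (π.proj ((extChartAt 𝓘(ℝ, EP) p₀).symm z))))
    (extChartAt 𝓘(ℝ, EP) p₀).target

/-- `c : [0, 1] → P` is a horizontal lift, starting at `p₀`, of the path `γ : [0, 1] → M`. -/
structure IsHorizontalLift {π : PrincipalBundle E EG EP M G P} (A : PrincipalConnection π)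
    (p₀ : P) (γ : ℝ → M) (c : ℝ → P) : Prop where
  init : c 0 = p₀
  lifts : ∀ t ∈ Icc (0 : ℝ) 1, π.proj (c t) = γ t
  diff : ∀ t ∈ Icc (0 : ℝ) 1, MDifferentiableWithinAt 𝓘(ℝ, ℝ) 𝓘(ℝ, EP) c (Icc 0 1) t
  horizontal : ∀ t ∈ Icc (0 : ℝ) 1,
    A.form (c t) (mfderivWithin 𝓘(ℝ, ℝ) 𝓘(ℝ, EP) c (Icc 0 1) t (1 : ℝ)) = 0

open Classical in
/-- Parallel transport of the frame `p₀` along `γ : [0, 1] → M`, by the connection `A`: the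
endpoint of the horizontal lift of `γ` starting at `p₀`. In a local gauge `s` it is
`s(γ(1)) W(1)`, where `dW/dt + A(γ') W = 0`. -/
def parallelTransport {π : PrincipalBundle E EG EP M G P} (A : PrincipalConnection π)
    (p₀ : P) (γ : ℝ → M) : P :=
  if h : ∃ c : ℝ → P, IsHorizontalLift A p₀ γ c then h.choose 1 else p₀

end Bundles

/-! ## Higher loop spaces -/

section Loops

/-- The cube `[0, 2π]ⁿ`. -/
def cube (n : ℕ) : Set (Fin n → ℝ) := Icc 0 (fun _ => 2 * Real.pi)

/-- The boundary of `[0, 2π]ⁿ`. -/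
def cubeBoundary (n : ℕ) : Set (Fin n → ℝ) :=
  {σ | σ ∈ cube n ∧ ∃ i, σ i = 0 ∨ σ i = 2 * Real.pi}

/-- The cube `[0, 2π]ⁿ × [0, 2π] = [0, 2π]ⁿ⁺¹`, with coordinates `(σ, τ)`. -/
def box (n : ℕ) : Set ((Fin n → ℝ) × ℝ) := cube n ×ˢ Icc 0 (2 * Real.pi)

/-- The boundary of `[0, 2π]ⁿ × [0, 2π]`. -/
def boxBoundary (n : ℕ) : Set ((Fin n → ℝ) × ℝ) :=
  {z | z ∈ box n ∧ (z.1 ∈ cubeBoundary n ∨ z.2 = 0 ∨ z.2 = 2 * Real.pi)}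

/-- `h` restricts to a diffeomorphism of `[0, 2π]ⁿ × [0, 2π]` that is the identity on the
boundary. -/
structure IsBoxDiffeo (n : ℕ) (h : (Fin n → ℝ) × ℝ → (Fin n → ℝ) × ℝ) : Prop where
  mapsTo : MapsTo h (box n) (box n)
  smooth : ContDiffOn ℝ ∞ h (box n)
  inverse : ∃ k : (Fin n → ℝ) × ℝ → (Fin n → ℝ) × ℝ, MapsTo k (box n) (box n) ∧
    ContDiffOn ℝ ∞ k (box n) ∧ LeftInvOn k h (box n) ∧ RightInvOn k h (box n)
  boundary : EqOn h id (boxBoundary n)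

/-- `h` is a diffeomorphism of `[0, 2π]ⁿ × [0, 2π]`, equal to the identity on the boundary, and
connected to the identity by a smooth family of such diffeomorphisms. -/
def IsReparametrization (n : ℕ) (h : (Fin n → ℝ) × ℝ → (Fin n → ℝ) × ℝ) : Prop :=
  ∃ H : ℝ → (Fin n → ℝ) × ℝ → (Fin n → ℝ) × ℝ,
    ContDiffOn ℝ ∞ (fun w : ℝ × ((Fin n → ℝ) × ℝ) => H w.1 w.2) (Icc 0 1 ×ˢ box n) ∧
    (∀ s ∈ Icc (0 : ℝ) 1, IsBoxDiffeo n (H s)) ∧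
    EqOn (H 0) id (box n) ∧ EqOn (H 1) h (box n)

variable {E : Type*} [NormedAddCommGroup E] [NormedSpace ℝ E]
  {EG : Type*} [NormedAddCommGroup EG] [NormedSpace ℝ EG]
  {EP : Type*} [NormedAddCommGroup EP] [NormedSpace ℝ EP]
  {M : Type*} [TopologicalSpace M] [ChartedSpace E M]
  {G : Type*} [TopologicalSpace G] [ChartedSpace EG G] [Group G]
  {P : Type*} [TopologicalSpace P] [ChartedSpace EP P]
  {n : ℕ}

/-- `N ∈ Ωⁿ(M, x₀)`: a smooth map `[0, 2π]ⁿ → M` sending the boundary to `x₀`. (Only the values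
of `N` on the cube matter.) -/
structure IsNLoop (x₀ : M) (N : (Fin n → ℝ) → M) : Prop where
  smooth : ContMDiffOn 𝓘(ℝ, Fin n → ℝ) 𝓘(ℝ, E) ∞ N (cube n)
  boundary : ∀ σ ∈ cubeBoundary n, N σ = x₀

/-- A tangent vector to `Ωⁿ(M, x₀)` at `N`: a smooth vector field along `N` (not necessarily
tangential to `N`) vanishing on the boundary of the cube, where the base point is kept fixed. -/
structure IsDeformation [IsManifold 𝓘(ℝ, E) ∞ M] (N : (Fin n → ℝ) → M)
    (T : ∀ σ : Fin n → ℝ, TangentSpace 𝓘(ℝ, E) (N σ)) : Prop where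
  smooth : ContMDiffOn 𝓘(ℝ, Fin n → ℝ) 𝓘(ℝ, E).tangent ∞
    (fun σ => (⟨N σ, T σ⟩ : TangentBundle 𝓘(ℝ, E) M)) (cube n)
  boundary : ∀ σ ∈ cubeBoundary n, T σ = 0

/-- A choice, for every `n`-loop `N` and every `σ` in the cube, of a `C¹` path
`γ N σ : [0, 1] → M` from `x₀` to `N σ`. -/
structure IsPathChoice (x₀ : M) (γ : ((Fin n → ℝ) → M) → (Fin n → ℝ) → ℝ → M) : Prop where
  contDiff : ∀ N, IsNLoop (E := E) x₀ N → ∀ σ ∈ cube n,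
    ContMDiffOn 𝓘(ℝ, ℝ) 𝓘(ℝ, E) 1 (γ N σ) (Icc 0 1)
  source : ∀ N, IsNLoop (E := E) x₀ N → ∀ σ ∈ cube n, γ N σ 0 = x₀
  target : ∀ N, IsNLoop (E := E) x₀ N → ∀ σ ∈ cube n, γ N σ 1 = N σ

/-- A smooth loop `τ ↦ Γ(·, τ)`, `τ ∈ [0, 2π]`, in the loop space `Ωⁿ(M, x₀)` (its base point is
the `n`-loop `Γ(·, 0) = Γ(·, 2π)`). -/
structure IsLoopOfNLoops (x₀ : M) (Γ : (Fin n → ℝ) × ℝ → M) : Prop where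
  smooth : ContMDiffOn 𝓘(ℝ, (Fin n → ℝ) × ℝ) 𝓘(ℝ, E) ∞ Γ (box n)
  boundary : ∀ σ ∈ cubeBoundary n, ∀ τ ∈ Icc (0 : ℝ) (2 * Real.pi), Γ (σ, τ) = x₀
  closed : ∀ σ ∈ cube n, Γ (σ, 2 * Real.pi) = Γ (σ, 0)

variable {π : PrincipalBundle E EG EP M G P}

/-- `ι_T B^W (N σ)`, as the coefficient of `dσ¹ ∧ ⋯ ∧ dσⁿ`: the value
`B^W(T(σ), ∂N/∂σ¹, …, ∂N/∂σⁿ)`, where `B^W = W⁻¹ B W` is `B` at `N σ` parallel transported back to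
the base point along the chosen path `γ N σ`, i.e. `B` expressed in the parallel transport of the
frame `p₀`. -/
def contraction (A : PrincipalConnection π) (B : AdjointForm π (n + 1)) (p₀ : P)
    (γ : ((Fin n → ℝ) → M) → (Fin n → ℝ) → ℝ → M) (N : (Fin n → ℝ) → M)
    (T : ∀ σ : Fin n → ℝ, TangentSpace 𝓘(ℝ, E) (N σ)) (σ : Fin n → ℝ) : EG :=
  let v : Fin (n + 1) → E := Fin.cons (show E from T σ) (fun i =>
    (show E from mfderivWithin 𝓘(ℝ, Fin n → ℝ) 𝓘(ℝ, E) N (cube n) σ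
      (Pi.single i (1 : ℝ) : Fin n → ℝ)))
  B.form (parallelTransport A p₀ (γ N σ)) v

/-- The connection `𝒜` on `Ωⁿ(M, x₀)`, `𝒜(T) = ∫_N ι_T B^W`, as a `1`-form with values in the Lie
algebra (by means of the frame `p₀` at `x₀`). -/
def loopConnection (A : PrincipalConnection π) (B : AdjointForm π (n + 1)) (p₀ : P)
    (γ : ((Fin n → ℝ) → M) → (Fin n → ℝ) → ℝ → M) (N : (Fin n → ℝ) → M)
    (T : ∀ σ : Fin n → ℝ, TangentSpace 𝓘(ℝ, E) (N σ)) : EG :=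
  ∫ σ in cube n, contraction A B p₀ γ N T σ

/-- The holonomy of `𝒜` along the loop `τ ↦ Γ(·, τ)` in `Ωⁿ(M, x₀)`: the value at `2π` of the
solution of `dU/dτ + 𝒜(∂Γ/∂τ) U = 0`, `U(0) = 1`. -/
def hol (A : PrincipalConnection π) (B : AdjointForm π (n + 1)) (p₀ : P)
    (γ : ((Fin n → ℝ) → M) → (Fin n → ℝ) → ℝ → M) (Γ : (Fin n → ℝ) × ℝ → M) : G :=
  transportHolonomy G (fun τ => loopConnection A B p₀ γ (fun σ => Γ (σ, τ))
    (fun σ => mfderivWithin 𝓘(ℝ, (Fin n → ℝ) × ℝ) 𝓘(ℝ, E) Γ (box n) (σ, τ)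
      ((0, 1) : (Fin n → ℝ) × ℝ)))

/-- `𝒜` is r-flat (reparametrization flat): the holonomy along any loop in `Ωⁿ(M, x₀)`, viewed as
a map `Γ` from `[0, 2π]ⁿ⁺¹` to `M`, does not change under reparametrization of `Γ`. -/
def IsRFlat (A : PrincipalConnection π) (B : AdjointForm π (n + 1)) (x₀ : M) (p₀ : P)
    (γ : ((Fin n → ℝ) → M) → (Fin n → ℝ) → ℝ → M) : Prop :=
  ∀ Γ : (Fin n → ℝ) × ℝ → M, IsLoopOfNLoops (E := E) x₀ Γ →
    ∀ h, IsReparametrization n h →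
      hol A B p₀ γ (fun z => Γ (h z)) = hol A B p₀ γ Γ

end Loops

end LoopSpaceConnection

end

open Set MeasureTheory Filter
open scoped Manifold ContDiff Topology

noncomputable section

namespace LoopSpaceConnection

set_option linter.unusedSectionVars false

/-! Flatness of `A` and simple connectedness of `M` produce a global horizontal section `s` through
`p₀`: the leaves of the horizontal distribution cover `M`, and the identity of `M` lifts to this
covering. Parallel transport of `p₀` along any path ends at `s` of the endpoint, so `B^W` is just
`B` read in the frame `s`, and the choice of paths is immaterial. For a loop `Γ` of `n`-loops let
`b(σ, τ)` be the value of this form on `(∂_τ Γ, ∂_1 Γ, …, ∂_n Γ)` (`AdjointForm.density`). The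
holonomy equation of `Γ` has the coefficient `∫ b(σ, τ) dσ`.

Commutation implies r-flatness. Apply the condition to graphs `σ ↦ Γ(σ, f σ)` with the deformation
`c(σ) ∂_τ Γ`. By alternation the slope of `f` does not contribute, and the contraction is `c(σ) b(σ,
f σ)`. Since `f` and `c` are free, all values of `b` commute with one another
(`IsFlatFrame.bracket_density_eq_zero`, then `IsFlatFrame.bracket_density_eq_zero_box`). For
commuting coefficients the solution at the final time depends only on the integral of the
coefficient (`IsTransport.eq_of_integral_eq`). A reparametrization multiplies `b` by its Jacobian
determinant, which is positive along an isotopy from the identity, so the total integral over the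
box is unchanged.

r-flatness implies commutation. Run along `Γ` out and back by an amount of order `ε`, and let a
reparametrization by Möbius maps in `τ` shift the timing on one region of the cube relative to
another. Both loops have the same holonomy, and their coefficients have total integral zero.
Comparing terms of order `ε²` (`integral_lieQ_eq_of_transport_eq`) leaves a nonzero area times `[X,
Y]`, where `X` and `Y` are integrals of `b(·, π)` against bumps on the two regions
(`IsFlatFrame.bracket_integral_eq_zero`). Shrinking the bumps gives `[b(σ₁, π), b(σ₂, π)] = 0`.
Finally, given `N` and `T`, the constant loop at `N` is perturbed near two points so that its
velocity there is `T(σ₁)` and `T(σ₂)`; hence the contractions commute pointwise, and integrating one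
of them gives the claim. -/

/-- The derivative of a map between manifolds modelled on normed spaces, as a map between the
model spaces. -/
def mder {E E' : Type*} [NormedAddCommGroup E] [NormedSpace ℝ E] [NormedAddCommGroup E']
    [NormedSpace ℝ E'] {M M' : Type*} [TopologicalSpace M] [ChartedSpace E M]
    [TopologicalSpace M'] [ChartedSpace E' M'] (f : M → M') (x : M) : E →L[ℝ] E' :=
  mfderiv 𝓘(ℝ, E) 𝓘(ℝ, E') f x

theorem mder_comp {E E' E'' : Type*} [NormedAddCommGroup E] [NormedSpace ℝ E]
    [NormedAddCommGroup E'] [NormedSpace ℝ E'] [NormedAddCommGroup E''] [NormedSpace ℝ E'']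
    {M M' M'' : Type*} [TopologicalSpace M] [ChartedSpace E M] [TopologicalSpace M']
    [ChartedSpace E' M'] [TopologicalSpace M''] [ChartedSpace E'' M'']
    {f : M → M'} {g : M' → M''} {x : M} {y : M'}
    (hg : MDifferentiableAt 𝓘(ℝ, E') 𝓘(ℝ, E'') g y) (hf : MDifferentiableAt 𝓘(ℝ, E) 𝓘(ℝ, E') f x)
    (h : f x = y) : (mder (g ∘ f) x : E →L[ℝ] E'') = (mder g y : E' →L[ℝ] E'').comp (mder f x) := by
  subst h
  exact mfderiv_comp x hg hf

/-! ### Calculus of group-valued maps: right logarithmic derivatives. -/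

section LieGroupCalculus

variable {EG : Type*} [NormedAddCommGroup EG] [NormedSpace ℝ EG]
  {G : Type*} [TopologicalSpace G] [ChartedSpace EG G] [Group G]
  {X : Type*} [NormedAddCommGroup X] [NormedSpace ℝ X]

/-- The preferred chart of a Lie group at the identity. -/
def lchart (G : Type*) [TopologicalSpace G] [ChartedSpace EG G] [Group G] : PartialEquiv G EG :=
  extChartAt 𝓘(ℝ, EG) (1 : G)

/-- The coordinate of the identity of the group. -/
def lone (G : Type*) [TopologicalSpace G] [ChartedSpace EG G] [Group G] : EG :=
  lchart (EG := EG) G 1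

/-- The multiplication of the group in the preferred chart at the identity. -/
def lmul (G : Type*) [TopologicalSpace G] [ChartedSpace EG G] [Group G] (z : EG × EG) : EG :=
  lchart (EG := EG) G ((lchart (EG := EG) G).symm z.1 * (lchart (EG := EG) G).symm z.2)

/-- The derivative of `x ↦ x y` at the identity, in the chart. -/
def rightTrivialization (G : Type*) [TopologicalSpace G] [ChartedSpace EG G] [Group G] (y : EG) :
    EG →L[ℝ] EG :=
  (fderiv ℝ (lmul G) (lone G, y)).comp (ContinuousLinearMap.inl ℝ EG EG)

/-- The adjoint action as a continuous linear map. -/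
def AdL (g : G) : EG →L[ℝ] EG :=
  mder (fun h : G => g * h * g⁻¹) 1

/-- `f` has right logarithmic derivative `L` at `x` within `S`, that is `df = L f`. -/
def HasLogDeriv (f : X → G) (L : X →L[ℝ] EG) (S : Set X) (x : X) : Prop :=
  ContinuousWithinAt f S x ∧
    HasFDerivWithinAt (fun y => lchart (EG := EG) G (f y * (f x)⁻¹)) L S x

theorem mem_lchart_source : (1 : G) ∈ (lchart (EG := EG) G).source :=
  mem_extChartAt_source 1

theorem isOpen_lchart_source : IsOpen (lchart (EG := EG) G).source :=
  isOpen_extChartAt_source 1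

theorem isOpen_lchart_target : IsOpen (lchart (EG := EG) G).target :=
  isOpen_extChartAt_target 1

theorem lone_mem_target : lone (EG := EG) G ∈ (lchart (EG := EG) G).target :=
  (lchart (EG := EG) G).map_source mem_lchart_source

theorem lchart_symm_lone : (lchart (EG := EG) G).symm (lone G) = 1 :=
  (lchart (EG := EG) G).left_inv mem_lchart_source

theorem continuousAt_lchart {g : G} (hg : g ∈ (lchart (EG := EG) G).source) :
    ContinuousAt (lchart (EG := EG) G) g :=
  (continuousOn_extChartAt 1).continuousAt (isOpen_lchart_source.mem_nhds hg)

theorem continuousAt_lchart_symm {y : EG} (hy : y ∈ (lchart (EG := EG) G).target) :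
    ContinuousAt (lchart (EG := EG) G).symm y :=
  (continuousOn_extChartAt_symm 1).continuousAt (isOpen_lchart_target.mem_nhds hy)

variable [LieGroup 𝓘(ℝ, EG) ∞ G]

theorem contMDiffAt_lchart {g : G} (hg : g ∈ (lchart (EG := EG) G).source) :
    ContMDiffAt 𝓘(ℝ, EG) 𝓘(ℝ, EG) ∞ (lchart (EG := EG) G) g :=
  contMDiffAt_extChartAt' (by simpa [lchart] using hg)

theorem contMDiffAt_lchart_symm {y : EG} (hy : y ∈ (lchart (EG := EG) G).target) :
    ContMDiffAt 𝓘(ℝ, EG) 𝓘(ℝ, EG) ∞ (lchart (EG := EG) G).symm y :=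
  (contMDiffOn_extChartAt_symm (1 : G)).contMDiffAt (isOpen_lchart_target.mem_nhds hy)

theorem contDiffAt_lmul {z : EG × EG} (h1 : z.1 ∈ (lchart (EG := EG) G).target)
    (h2 : z.2 ∈ (lchart (EG := EG) G).target)
    (h : (lchart (EG := EG) G).symm z.1 * (lchart (EG := EG) G).symm z.2 ∈
      (lchart (EG := EG) G).source) : ContDiffAt ℝ ∞ (lmul (EG := EG) G) z := by
  rw [← contMDiffAt_iff_contDiffAt]
  have a1 : ContMDiffAt 𝓘(ℝ, EG × EG) 𝓘(ℝ, EG) ∞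
      (fun z : EG × EG => (lchart (EG := EG) G).symm z.1) z :=
    (contMDiffAt_lchart_symm h1).comp z contDiff_fst.contMDiff.contMDiffAt
  have a2 : ContMDiffAt 𝓘(ℝ, EG × EG) 𝓘(ℝ, EG) ∞
      (fun z : EG × EG => (lchart (EG := EG) G).symm z.2) z :=
    (contMDiffAt_lchart_symm h2).comp z contDiff_snd.contMDiff.contMDiffAt
  exact (contMDiffAt_lchart h).comp z (a1.mul a2)

theorem contDiffAt_lmul_lone_left {y : EG} (hy : y ∈ (lchart (EG := EG) G).target) :
    ContDiffAt ℝ ∞ (lmul (EG := EG) G) (lone G, y) :=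
  contDiffAt_lmul lone_mem_target hy
    (by simpa [lchart_symm_lone] using (lchart (EG := EG) G).map_target hy)

theorem contDiffAt_lmul_lone_right {y : EG} (hy : y ∈ (lchart (EG := EG) G).target) :
    ContDiffAt ℝ ∞ (lmul (EG := EG) G) (y, lone G) :=
  contDiffAt_lmul hy lone_mem_target
    (by simpa [lchart_symm_lone] using (lchart (EG := EG) G).map_target hy)

theorem lmul_lone_left {y : EG} (hy : y ∈ (lchart (EG := EG) G).target) :
    lmul G (lone G, y) = y := by
  simp [lmul, lchart_symm_lone, (lchart (EG := EG) G).right_inv hy]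

theorem lmul_lone_right {y : EG} (hy : y ∈ (lchart (EG := EG) G).target) :
    lmul G (y, lone G) = y := by
  simp [lmul, lchart_symm_lone, (lchart (EG := EG) G).right_inv hy]

theorem hasFDerivAt_lmul_left {y : EG} (hy : y ∈ (lchart (EG := EG) G).target) :
    HasFDerivAt (fun x => lmul (EG := EG) G (x, y)) (rightTrivialization G y) (lone G) :=
  HasFDerivAt.comp (f := fun x => (x, y)) (lone G)
    ((contDiffAt_lmul_lone_left hy).differentiableAt (by simp)).hasFDerivAt
    (hasFDerivAt_prodMk_left _ _)

/-- On each of the two axes through the identity the multiplication is the identity map, and a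
linear map on a product is determined by its restrictions to the axes. -/
theorem fderiv_lmul_lone :
    fderiv ℝ (lmul (EG := EG) G) (lone G, lone G) =
      ContinuousLinearMap.fst ℝ EG EG + ContinuousLinearMap.snd ℝ EG EG := by
  have hd := ((contDiffAt_lmul_lone_left (G := G) (EG := EG) lone_mem_target).differentiableAt
    (by simp)).hasFDerivAt
  have h1 := HasFDerivAt.comp (f := fun x => (x, lone (EG := EG) G)) (lone G) hd
    (hasFDerivAt_prodMk_left (lone G) (lone G))
  have h2 := hd.comp (lone (EG := EG) G) (hasFDerivAt_prodMk_right (lone G) (lone G))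
  have e1 : HasFDerivAt (fun x => lmul (EG := EG) G (x, lone G)) (.id ℝ EG) (lone G) :=
    (hasFDerivAt_id _).congr_of_eventuallyEq <| by
      filter_upwards [isOpen_lchart_target.mem_nhds lone_mem_target] with y hy
      exact lmul_lone_right hy
  have e2 : HasFDerivAt (fun x => lmul (EG := EG) G (lone G, x)) (.id ℝ EG) (lone G) :=
    (hasFDerivAt_id _).congr_of_eventuallyEq <| by
      filter_upwards [isOpen_lchart_target.mem_nhds lone_mem_target] with y hy
      exact lmul_lone_left hy
  have f1 := h1.unique e1
  have f2 := h2.unique e2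
  ext v
  · simpa using DFunLike.congr_fun f1 v
  · simpa using DFunLike.congr_fun f2 v

theorem rightTrivialization_lone : rightTrivialization G (lone G) = .id ℝ EG := by
  rw [rightTrivialization, fderiv_lmul_lone]; ext v; simp

theorem contDiffAt_rightTrivialization {y : EG} (hy : y ∈ (lchart (EG := EG) G).target) :
    ContDiffAt ℝ ∞ (rightTrivialization (EG := EG) G) y := by
  have h := (contDiffAt_lmul_lone_left hy).fderiv_right (m := ∞) le_rfl
  have h' : ContDiffAt ℝ ∞ (fun y : EG => fderiv ℝ (lmul (EG := EG) G) (lone G, y)) y :=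
    h.comp y (contDiffAt_const.prodMk contDiffAt_id)
  exact h'.clm_comp contDiffAt_const

theorem AdL_one : AdL (1 : G) = .id ℝ EG := by
  have : (fun h : G => 1 * h * 1⁻¹) = id := by ext; simp
  rw [AdL, this]; exact mfderiv_id

theorem contMDiff_conj (g : G) :
    ContMDiff 𝓘(ℝ, EG) 𝓘(ℝ, EG) ∞ (fun h : G => g * h * g⁻¹) :=
  (contMDiff_const.mul contMDiff_id).mul contMDiff_const

theorem AdL_mul (g h : G) : AdL (g * h) = (AdL g : EG →L[ℝ] EG).comp (AdL h) := by
  have : (fun k : G => (g * h) * k * (g * h)⁻¹) =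
      (fun k : G => g * k * g⁻¹) ∘ (fun k : G => h * k * h⁻¹) := by ext; simp [mul_assoc]
  have e : h * 1 * h⁻¹ = 1 := by simp
  rw [AdL, this]
  exact mder_comp ((contMDiff_conj g).mdifferentiable (by simp) _)
    ((contMDiff_conj h).mdifferentiable (by simp) _) e

theorem AdL_inv_comp (g : G) : (AdL g⁻¹ : EG →L[ℝ] EG).comp (AdL g) = .id ℝ EG := by
  rw [← AdL_mul (EG := EG) g⁻¹ g, inv_mul_cancel]; exact AdL_one

theorem AdL_inv_apply (g : G) (v : EG) : AdL g⁻¹ (AdL g v) = v :=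
  DFunLike.congr_fun (AdL_inv_comp (EG := EG) g) v

theorem AdL_apply_inv (g : G) (v : EG) : AdL g (AdL g⁻¹ v) = v := by
  simpa using AdL_inv_apply g⁻¹ v

/-- The derivative at the identity of a map fixing the identity, in the chart. -/
theorem hasFDerivAt_lchart_comp {F : G → G} (hF : MDifferentiableAt 𝓘(ℝ, EG) 𝓘(ℝ, EG) F 1)
    (h1 : F 1 = 1) :
    HasFDerivAt (fun y : EG => lchart (EG := EG) G (F ((lchart (EG := EG) G).symm y)))
      (mder F 1) (lone G) := by
  have := hF.hasMFDerivAt.2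
  simp only [writtenInExtChartAt, h1] at this
  rw [← hasFDerivWithinAt_univ]
  rw [ModelWithCorners.Boundaryless.range_eq_univ] at this
  exact this

theorem hasFDerivAt_lchart_conj (g : G) :
    HasFDerivAt (fun y : EG => lchart (EG := EG) G (g * (lchart (EG := EG) G).symm y * g⁻¹))
      (AdL g) (lone G) :=
  hasFDerivAt_lchart_comp ((contMDiff_conj (EG := EG) g).mdifferentiable (by simp) _) (by simp)

namespace HasLogDeriv

variable {f g : X → G} {L L' : X →L[ℝ] EG} {S T : Set X} {x : X}

theorem mono_of_mem (h : HasLogDeriv f L S x) (hT : S ∈ 𝓝[T] x) : HasLogDeriv f L T x :=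
  ⟨h.1.mono_of_mem_nhdsWithin hT, h.2.mono_of_mem_nhdsWithin hT⟩

theorem union (h : HasLogDeriv f L S x) (h' : HasLogDeriv f L T x) :
    HasLogDeriv f L (S ∪ T) x :=
  ⟨h.1.union h'.1, h.2.union h'.2⟩

theorem congr (h : HasLogDeriv f L S x) (hf : ∀ y ∈ S, g y = f y) (hx : g x = f x) :
    HasLogDeriv g L S x := by
  refine ⟨h.1.congr hf hx, h.2.congr (fun y hy => ?_) ?_⟩
  · rw [hf y hy, hx]
  · rw [hx]

theorem congr_deriv (h : HasLogDeriv f L S x) (hL : L = L') : HasLogDeriv f L' S x := hL ▸ h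

theorem const (c : G) : HasLogDeriv (fun _ : X => c) (0 : X →L[ℝ] EG) S x :=
  ⟨continuousWithinAt_const, by simpa using hasFDerivWithinAt_const _ _ _⟩

theorem tendsto_div (h : HasLogDeriv f L S x) :
    Tendsto (fun y => f y * (f x)⁻¹) (𝓝[S] x) (𝓝 1) := by
  have := topologicalGroup_of_lieGroup 𝓘(ℝ, EG) ∞ (G := G)
  have := Tendsto.mul h.1 (tendsto_const_nhds (x := (f x)⁻¹))
  rwa [mul_inv_cancel] at this

theorem eventually_mem (h : HasLogDeriv f L S x) :
    ∀ᶠ y in 𝓝[S] x, f y * (f x)⁻¹ ∈ (lchart (EG := EG) G).source :=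
  h.tendsto_div (isOpen_lchart_source.mem_nhds mem_lchart_source)

theorem mul_const (h : HasLogDeriv f L S x) (c : G) :
    HasLogDeriv (fun y => f y * c) L S x := by
  have := topologicalGroup_of_lieGroup 𝓘(ℝ, EG) ∞ (G := G)
  refine ⟨h.1.mul continuousWithinAt_const, ?_⟩
  simpa using h.2

/-- Write `f(y)g(y)(f(x)g(x))⁻¹` as the product of `f(y)f(x)⁻¹` and the conjugate by `f(x)` of
`g(y)g(x)⁻¹`. Both factors are near the identity, where the derivative of the multiplication is the
sum. -/
theorem mul (hf : HasLogDeriv f L S x) (hg : HasLogDeriv g L' S x) :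
    HasLogDeriv (fun y => f y * g y) (L + (AdL (f x)).comp L') S x := by
  have := topologicalGroup_of_lieGroup 𝓘(ℝ, EG) ∞ (G := G)
  refine ⟨hf.1.mul hg.1, ?_⟩
  have e1 : lchart (EG := EG) G (f x * (f x)⁻¹) = lone G := by simp [lone]
  have e2 : lchart (EG := EG) G (g x * (g x)⁻¹) = lone G := by simp [lone]
  have hc := hasFDerivAt_lchart_conj (EG := EG) (f x)
  rw [← e2] at hc
  have h2 := hc.comp_hasFDerivWithinAt x hg.2
  have hm := ((contDiffAt_lmul_lone_left (G := G) (EG := EG) lone_mem_target).differentiableAt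
    (by simp)).hasFDerivAt
  rw [fderiv_lmul_lone] at hm
  have h3 := HasFDerivAt.comp_hasFDerivWithinAt (g := lmul (EG := EG) G)
    (f := fun y => (lchart (EG := EG) G (f y * (f x)⁻¹),
      lchart (EG := EG) G (f x * (lchart (EG := EG) G).symm
        (lchart (EG := EG) G (g y * (g x)⁻¹)) * (f x)⁻¹))) x
    (by simpa [lone, lchart_symm_lone, (lchart (EG := EG) G).left_inv mem_lchart_source]
      using hm) (hf.2.prodMk h2)
  have hev : ∀ᶠ y in 𝓝[S] x, f x * (g y * (g x)⁻¹) * (f x)⁻¹ ∈ (lchart (EG := EG) G).source := by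
    have : Tendsto (fun y => f x * (g y * (g x)⁻¹) * (f x)⁻¹) (𝓝[S] x) (𝓝 1) := by
      have := (tendsto_const_nhds (x := f x)).mul hg.tendsto_div |>.mul
        (tendsto_const_nhds (x := (f x)⁻¹))
      simpa using this
    exact this (isOpen_lchart_source.mem_nhds mem_lchart_source)
  refine (h3.congr_of_eventuallyEq ?_ ?_).congr_fderiv ?_
  · filter_upwards [hf.eventually_mem, hg.eventually_mem, hev] with y h1 h2 h3
    simp only [lmul, Function.comp_apply]
    rw [(lchart (EG := EG) G).left_inv h1, (lchart (EG := EG) G).left_inv h2,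
      (lchart (EG := EG) G).left_inv h3]
    congr 1
    group
  · simp [lmul, (lchart (EG := EG) G).left_inv mem_lchart_source]
  · ext v; simp

theorem const_mul (hg : HasLogDeriv g L' S x) (c : G) :
    HasLogDeriv (fun y => c * g y) ((AdL c).comp L') S x := by
  simpa using (HasLogDeriv.const (X := X) (EG := EG) c).mul hg

end HasLogDeriv

theorem contMDiff_inv_group : ContMDiff 𝓘(ℝ, EG) 𝓘(ℝ, EG) ∞ (fun h : G => h⁻¹) :=
  contMDiff_inv _ _

/-- Differentiate `h h⁻¹ = 1` in the chart, using that multiplication is addition to first order. -/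
theorem mder_inv_one : mder (fun h : G => h⁻¹) 1 = -ContinuousLinearMap.id ℝ EG := by
  have := topologicalGroup_of_lieGroup 𝓘(ℝ, EG) ∞ (G := G)
  have hi := hasFDerivAt_lchart_comp (F := fun h : G => h⁻¹) (EG := EG)
    (contMDiff_inv_group.mdifferentiable (by simp) _) (by simp)
  have hm := ((contDiffAt_lmul_lone_left (G := G) (EG := EG) lone_mem_target).differentiableAt
    (by simp)).hasFDerivAt
  rw [fderiv_lmul_lone] at hm
  have h3 := HasFDerivAt.comp (g := lmul (EG := EG) G)
    (f := fun y : EG => (y, lchart (EG := EG) G ((lchart (EG := EG) G).symm y)⁻¹)) (lone G)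
    (by simpa [lone, lchart_symm_lone, (lchart (EG := EG) G).left_inv mem_lchart_source]
      using hm) ((hasFDerivAt_id _).prodMk hi)
  have h4 : HasFDerivAt (fun _ : EG => lone (EG := EG) G) (0 : EG →L[ℝ] EG) (lone (EG := EG) G) :=
    hasFDerivAt_const _ _
  have hev : ∀ᶠ y in 𝓝 (lone (EG := EG) G),
      ((lchart (EG := EG) G).symm y)⁻¹ ∈ (lchart (EG := EG) G).source := by
    have : Tendsto (fun y => ((lchart (EG := EG) G).symm y)⁻¹) (𝓝 (lone (EG := EG) G)) (𝓝 1) := by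
      have := Tendsto.inv (continuousAt_lchart_symm (EG := EG) (G := G) lone_mem_target)
      rwa [lchart_symm_lone, inv_one] at this
    exact this (isOpen_lchart_source.mem_nhds mem_lchart_source)
  have h5 := h3.unique (h4.congr_of_eventuallyEq (by
    filter_upwards [hev] with y hy
    simp [lmul, (lchart (EG := EG) G).left_inv hy, lone]))
  ext v
  have := DFunLike.congr_fun h5 v
  simp at this
  simpa using eq_neg_of_add_eq_zero_right this

namespace HasLogDeriv

variable {f g : X → G} {L L' : X →L[ℝ] EG} {S T : Set X} {x : X}

theorem comp_of_map_one (hf : HasLogDeriv f L S x) (hx : f x = 1) {F : G → G}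
    (hF : MDifferentiableAt 𝓘(ℝ, EG) 𝓘(ℝ, EG) F 1) (h1 : F 1 = 1) :
    HasLogDeriv (fun y => F (f y)) ((mder F 1 : EG →L[ℝ] EG).comp L) S x := by
  have hc := hasFDerivAt_lchart_comp (EG := EG) hF h1
  have h2 := hf.2
  have hm := hf.eventually_mem
  have hF' : ContinuousAt F (f x) := by rw [hx]; exact hF.continuousAt
  refine ⟨hF'.comp_continuousWithinAt hf.1, ?_⟩
  simp only [hx, inv_one, mul_one, h1] at h2 hm ⊢
  have e1 : lone G = lchart (EG := EG) G (f x) := by rw [hx]; rfl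
  rw [e1] at hc
  refine (hc.comp_hasFDerivWithinAt x h2).congr_of_eventuallyEq ?_ ?_
  · filter_upwards [hm] with y hy
    simp [(lchart (EG := EG) G).left_inv hy]
  · simp [hx, (lchart (EG := EG) G).left_inv mem_lchart_source]

/-- Follows from `f(y)⁻¹ = f(x)⁻¹ (f(y)f(x)⁻¹)⁻¹`: the inner inverse contributes `-L`, the left
translation contributes `Ad`. -/
theorem inv (hf : HasLogDeriv f L S x) :
    HasLogDeriv (fun y => (f y)⁻¹) (-(AdL (f x)⁻¹).comp L) S x := by
  have h1 := HasLogDeriv.comp_of_map_one (hf.mul_const (f x)⁻¹) (by simp)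
    (contMDiff_inv_group.mdifferentiable (by simp) _) (by simp)
  rw [mder_inv_one] at h1
  have h2 := h1.const_mul (f x)⁻¹
  refine (h2.congr (fun y _ => ?_) ?_).congr_deriv ?_
  · simp
  · simp
  · ext v; simp

end HasLogDeriv
end LieGroupCalculus

/-! ### Logarithmic derivatives in the chart and as manifold derivatives. -/

section LogDerivChart

variable {EG : Type*} [NormedAddCommGroup EG] [NormedSpace ℝ EG]
  {G : Type*} [TopologicalSpace G] [ChartedSpace EG G] [Group G] [LieGroup 𝓘(ℝ, EG) ∞ G]
  {X : Type*} [NormedAddCommGroup X] [NormedSpace ℝ X]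

namespace HasLogDeriv

variable {f g : X → G} {L L' : X →L[ℝ] EG} {S T : Set X} {x : X}

theorem hasFDerivWithinAt_lchart (hf : HasLogDeriv f L S x)
    (hx : f x ∈ (lchart (EG := EG) G).source) :
    HasFDerivWithinAt (fun y => lchart (EG := EG) G (f y))
      ((rightTrivialization G (lchart (EG := EG) G (f x))).comp L) S x := by
  have hm := hasFDerivAt_lmul_left ((lchart (EG := EG) G).map_source hx)
  have e1 : lone G = lchart (EG := EG) G (f x * (f x)⁻¹) := by simp [lone]
  rw [e1] at hm
  refine (hm.comp_hasFDerivWithinAt x hf.2).congr_of_eventuallyEq ?_ ?_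
  · filter_upwards [hf.eventually_mem] with y hy
    simp [lmul, (lchart (EG := EG) G).left_inv hy, (lchart (EG := EG) G).left_inv hx]
  · simp [lmul, (lchart (EG := EG) G).left_inv mem_lchart_source,
      (lchart (EG := EG) G).left_inv hx]

/-- Right translation by `c⁻¹`, read in the chart, undoes right translation by `c`. Its derivative
is therefore a left inverse of the right trivialization at `w x`, which cancels the factor in the
hypothesis. -/
theorem of_lchart {w : X → EG} (hx : w x ∈ (lchart (EG := EG) G).target)
    (hw : HasFDerivWithinAt w ((rightTrivialization G (w x)).comp L) S x) :
    HasLogDeriv (fun y => (lchart (EG := EG) G).symm (w y)) L S x := by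
  set c : G := (lchart (EG := EG) G).symm (w x) with hc
  refine ⟨(continuousAt_lchart_symm hx).comp_continuousWithinAt hw.continuousWithinAt, ?_⟩
  have hk : ContMDiffAt 𝓘(ℝ, EG) 𝓘(ℝ, EG) ∞
      (fun z : EG => lchart (EG := EG) G ((lchart (EG := EG) G).symm z * c⁻¹)) (w x) := by
    have h1 : ContMDiffAt 𝓘(ℝ, EG) 𝓘(ℝ, EG) ∞
      (fun z : EG => (lchart (EG := EG) G).symm z * c⁻¹) (w x) :=
      (contMDiffAt_lchart_symm hx).mul contMDiffAt_const
    refine ContMDiffAt.comp (w x) (contMDiffAt_lchart ?_) h1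
    simp [← hc, mem_lchart_source]
  have hk' := ((contMDiffAt_iff_contDiffAt.1 hk).differentiableAt (by simp)).hasFDerivAt
  have hm := hasFDerivAt_lmul_left hx
  have hcomp := HasFDerivAt.comp (f := fun y => lmul (EG := EG) G (y, w x)) (lone (EG := EG) G)
    (by simpa only [lmul_lone_left hx] using hk') hm
  have hev : ∀ᶠ y in 𝓝 (lone (EG := EG) G), (lchart (EG := EG) G).symm y * c ∈
      (lchart (EG := EG) G).source := by
    have := topologicalGroup_of_lieGroup 𝓘(ℝ, EG) ∞ (G := G)
    have : Tendsto (fun y => (lchart (EG := EG) G).symm y * c) (𝓝 (lone (EG := EG) G)) (𝓝 c) := by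
      have := Tendsto.mul (continuousAt_lchart_symm (EG := EG) (G := G) lone_mem_target)
        (tendsto_const_nhds (x := c))
      rwa [lchart_symm_lone, one_mul] at this
    exact this (isOpen_lchart_source.mem_nhds ((lchart (EG := EG) G).map_target hx))
  have hid : HasFDerivAt (fun y : EG => lchart (EG := EG) G ((lchart (EG := EG) G).symm
      (lmul (EG := EG) G (y, w x)) * c⁻¹)) (.id ℝ EG) (lone (EG := EG) G) := by
    refine (hasFDerivAt_id _).congr_of_eventuallyEq ?_
    filter_upwards [hev, isOpen_lchart_target.mem_nhds (lone_mem_target (G := G))] with y hy hy'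
    simp only [lmul, ← hc]
    rw [(lchart (EG := EG) G).left_inv hy]
    simp [(lchart (EG := EG) G).right_inv hy']
  have heq := hcomp.unique hid
  refine (hk'.comp_hasFDerivWithinAt x hw).congr_fderiv ?_
  rw [← ContinuousLinearMap.comp_assoc, heq]
  rfl

theorem of_lchart_one (hx : f x = 1) (hc : ContinuousWithinAt f S x)
    (hf : HasFDerivWithinAt (fun y => lchart (EG := EG) G (f y)) L S x) :
    HasLogDeriv f L S x :=
  ⟨hc, by simpa [hx] using hf⟩

/-- A map on a convex set whose derivative vanishes is constant. -/
theorem eq_of_zero (hS : Convex ℝ S) (hf : ∀ x ∈ S, HasLogDeriv f (0 : X →L[ℝ] EG) S x)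
    {x y : X} (hx : x ∈ S) (hy : y ∈ S) : f x = f y := by
  -- A convex set is preconnected, so local constancy is enough; locally the mean value inequality
  -- applies in the chart, on the convex set `S ∩ ball`.
  refine hS.isPreconnected.induction₂ (fun x y => f x = f y) (fun x hx => ?_)
    (fun x y z _ _ _ h h' => h.trans h') (fun x y _ _ h => h.symm) hx hy
  have hm := (hf x hx).eventually_mem
  obtain ⟨r, hr, hb⟩ := Metric.mem_nhdsWithin_iff.1 hm
  filter_upwards [inter_mem_nhdsWithin S (Metric.ball_mem_nhds x hr)] with y hy
  have hconv : Convex ℝ (S ∩ Metric.ball x r) := hS.inter (convex_ball x r)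
  have hd : ∀ z ∈ S ∩ Metric.ball x r,
      HasFDerivWithinAt (fun y => lchart (EG := EG) G (f y * (f x)⁻¹)) (0 : X →L[ℝ] EG)
        (S ∩ Metric.ball x r) z := by
    intro z hz
    have := (((hf z hz.1).mul_const (f x)⁻¹).hasFDerivWithinAt_lchart (hb ⟨hz.2, hz.1⟩)).mono
      (inter_subset_left (t := Metric.ball x r))
    simpa using this
  have h0 := hconv.norm_image_sub_le_of_norm_hasFDerivWithin_le (C := 0) hd (by simp)
    (⟨hx, Metric.mem_ball_self hr⟩ : x ∈ S ∩ Metric.ball x r) hy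
  have h1 : lchart (EG := EG) G (f y * (f x)⁻¹) = lchart (EG := EG) G 1 := by
    have : ‖lchart (EG := EG) G (f y * (f x)⁻¹) - lchart (EG := EG) G (f x * (f x)⁻¹)‖ = 0 :=
      le_antisymm (by simpa using h0) (norm_nonneg _)
    rw [norm_eq_zero, sub_eq_zero, mul_inv_cancel] at this
    exact this
  have h2 := (lchart (EG := EG) G).injOn (hb ⟨hy.2, hy.1⟩) mem_lchart_source h1
  exact (mul_inv_eq_one.1 h2).symm

theorem hasMFDerivWithinAt (hf : HasLogDeriv f L S x) :
    HasMFDerivWithinAt 𝓘(ℝ, X) 𝓘(ℝ, EG) f S x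
      ((mder (fun h : G => h * f x) 1 : EG →L[ℝ] EG).comp L) := by
  have hr : MDifferentiableAt 𝓘(ℝ, EG) 𝓘(ℝ, EG) (fun h : G => h * f x) 1 :=
    (contMDiff_mul_right (n := ∞) (I := 𝓘(ℝ, EG)) (a := f x)).mdifferentiable (by simp) _
  have h2 := hr.hasMFDerivAt.2
  simp only [writtenInExtChartAt, one_mul, ModelWithCorners.Boundaryless.range_eq_univ] at h2
  have h3 : HasFDerivAt (fun y : EG => extChartAt 𝓘(ℝ, EG) (f x)
      ((lchart (EG := EG) G).symm y * f x)) (mder (fun h : G => h * f x) 1 : EG →L[ℝ] EG)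
      (lchart (EG := EG) G (f x * (f x)⁻¹)) := by
    rw [mul_inv_cancel, ← hasFDerivWithinAt_univ]; exact h2
  refine ⟨hf.1, ?_⟩
  have h4 := h3.comp_hasFDerivWithinAt x hf.2
  have h5 : HasFDerivWithinAt (fun y => extChartAt 𝓘(ℝ, EG) (f x) (f y))
      ((mder (fun h : G => h * f x) 1 : EG →L[ℝ] EG).comp L) S x := by
    refine h4.congr_of_eventuallyEq ?_ ?_
    · filter_upwards [hf.eventually_mem] with y hy
      simp [(lchart (EG := EG) G).left_inv hy]
    · simp [(lchart (EG := EG) G).left_inv mem_lchart_source]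
  exact h5.mono (fun y hy => hy.1)

theorem exists_of_mdifferentiableWithinAt
    (hf : MDifferentiableWithinAt 𝓘(ℝ, X) 𝓘(ℝ, EG) f S x) :
    ∃ L : X →L[ℝ] EG, HasLogDeriv f L S x := by
  have h1 : MDifferentiableWithinAt 𝓘(ℝ, X) 𝓘(ℝ, EG) (fun y => f y * (f x)⁻¹) S x :=
    MDifferentiableAt.comp_mdifferentiableWithinAt (g := fun h : G => h * (f x)⁻¹) x
      ((contMDiff_mul_right (n := ∞) (I := 𝓘(ℝ, EG))).mdifferentiable (by simp) _) hf
  have h2 : MDifferentiableWithinAt 𝓘(ℝ, X) 𝓘(ℝ, EG)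
      (fun y => lchart (EG := EG) G (f y * (f x)⁻¹)) S x :=
    MDifferentiableAt.comp_mdifferentiableWithinAt (g := lchart (EG := EG) G) x
      ((contMDiffAt_lchart (by simp [mem_lchart_source])).mdifferentiableAt (by simp)) h1
  exact ⟨_, hf.continuousWithinAt, h2.differentiableWithinAt.hasFDerivWithinAt⟩

end HasLogDeriv

theorem mder_mul_right_injective (g : G) {u v : EG}
    (h : mder (fun h : G => h * g) 1 u = (mder (fun h : G => h * g) 1 v : EG)) : u = v := by
  have h1 : MDifferentiableAt 𝓘(ℝ, EG) 𝓘(ℝ, EG) (fun h : G => h * g) 1 :=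
    (contMDiff_mul_right (n := ∞) (I := 𝓘(ℝ, EG)) (a := g)).mdifferentiable (by simp) _
  have h2 : MDifferentiableAt 𝓘(ℝ, EG) 𝓘(ℝ, EG) (fun h : G => h * g⁻¹) g :=
    (contMDiff_mul_right (n := ∞) (I := 𝓘(ℝ, EG)) (a := g⁻¹)).mdifferentiable (by simp) _
  have hc : (mder (fun h : G => h * g⁻¹) g : EG →L[ℝ] EG).comp (mder (fun h : G => h * g) 1) =
      (mder (id : G → G) 1 : EG →L[ℝ] EG) := by
    have : (id : G → G) = (fun h : G => h * g⁻¹) ∘ (fun h : G => h * g) := by ext; simp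
    rw [this]
    exact (mder_comp h2 h1 (by simp)).symm
  have hi : mder (id : G → G) 1 = ContinuousLinearMap.id ℝ EG := mfderiv_id
  rw [hi] at hc
  have := congrArg (mder (fun h : G => h * g⁻¹) g : EG →L[ℝ] EG) h
  have e := fun w => DFunLike.congr_fun hc w
  simp only [ContinuousLinearMap.comp_apply, ContinuousLinearMap.id_apply] at e
  rwa [e, e] at this

end LogDerivChart

/-! ### The bracket as the antisymmetrized second-order part of the multiplication. -/

section AdjointBracket

variable {EG : Type*} [NormedAddCommGroup EG] [NormedSpace ℝ EG]
  {G : Type*} [TopologicalSpace G] [ChartedSpace EG G] [Group G] [LieGroup 𝓘(ℝ, EG) ∞ G]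
  {X : Type*} [NormedAddCommGroup X] [NormedSpace ℝ X]

/-- The derivative of `z ↦ y z` at the identity, in the chart. -/
def leftTrivialization (G : Type*) [TopologicalSpace G] [ChartedSpace EG G] [Group G] (y : EG) :
    EG →L[ℝ] EG :=
  (fderiv ℝ (lmul G) (y, lone G)).comp (ContinuousLinearMap.inr ℝ EG EG)

/-- The second order part of the multiplication at the identity. -/
def lieQ (G : Type*) [TopologicalSpace G] [ChartedSpace EG G] [Group G] : EG →L[ℝ] EG →L[ℝ] EG :=
  fderiv ℝ (rightTrivialization G) (lone G)

/-- The Lie bracket as a continuous bilinear map. -/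
def bracketL (G : Type*) [TopologicalSpace G] [ChartedSpace EG G] [Group G] :
    EG →L[ℝ] EG →L[ℝ] EG :=
  (lieQ G).flip - lieQ G

theorem hasFDerivAt_lmul_right {y : EG} (hy : y ∈ (lchart (EG := EG) G).target) :
    HasFDerivAt (fun x => lmul (EG := EG) G (y, x)) (leftTrivialization G y) (lone G) :=
  HasFDerivAt.comp (f := fun x => (y, x)) (lone G)
    ((contDiffAt_lmul_lone_right hy).differentiableAt (by simp)).hasFDerivAt
    (hasFDerivAt_prodMk_right _ _)

/-- Infinitesimal form of `y z = (y z y⁻¹) y`. -/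
theorem leftTrivialization_eq {y : EG} (hy : y ∈ (lchart (EG := EG) G).target) :
    leftTrivialization G y =
      (rightTrivialization G y).comp (AdL ((lchart (EG := EG) G).symm y)) := by
  set g : G := (lchart (EG := EG) G).symm y with hg
  have := topologicalGroup_of_lieGroup 𝓘(ℝ, EG) ∞ (G := G)
  have h1 := hasFDerivAt_lchart_conj (EG := EG) g
  have h2 := HasFDerivAt.comp (lone (EG := EG) G) (g := fun x => lmul (EG := EG) G (x, y))
    (by simpa [lchart_symm_lone, lone, (lchart (EG := EG) G).left_inv mem_lchart_source] using
      hasFDerivAt_lmul_left hy) h1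
  refine (hasFDerivAt_lmul_right hy).unique (h2.congr_of_eventuallyEq ?_)
  have hev : ∀ᶠ z in 𝓝 (lone (EG := EG) G), g * (lchart (EG := EG) G).symm z * g⁻¹ ∈
      (lchart (EG := EG) G).source := by
    have : Tendsto (fun z => g * (lchart (EG := EG) G).symm z * g⁻¹) (𝓝 (lone (EG := EG) G))
        (𝓝 1) := by
      have := Tendsto.mul (Tendsto.mul (tendsto_const_nhds (x := g))
        (continuousAt_lchart_symm (EG := EG) (G := G) lone_mem_target))
        (tendsto_const_nhds (x := g⁻¹))
      rwa [lchart_symm_lone, mul_one, mul_inv_cancel] at this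
    exact this (isOpen_lchart_source.mem_nhds mem_lchart_source)
  filter_upwards [hev] with z hz
  simp [lmul, (lchart (EG := EG) G).left_inv hz, ← hg]

theorem hasFDerivAt_rightTrivialization :
    HasFDerivAt (rightTrivialization (EG := EG) G) (lieQ G) (lone G) :=
  ((contDiffAt_rightTrivialization lone_mem_target).differentiableAt (by simp)).hasFDerivAt

/-- Both trivializations differentiate to the mixed second derivative of the multiplication at the
identity, with the roles of the two factors exchanged; symmetry of second derivatives gives the
flip. -/
theorem hasFDerivAt_leftTrivialization :
    HasFDerivAt (leftTrivialization (EG := EG) G) (lieQ G).flip (lone G) := by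
  have hc := contDiffAt_lmul_lone_left (G := G) (EG := EG) lone_mem_target
  have hD := ((hc.fderiv_right (m := ∞) le_rfl).differentiableAt (by simp)).hasFDerivAt
  have hsym : IsSymmSndFDerivAt ℝ (lmul (EG := EG) G) (lone G, lone G) :=
    hc.isSymmSndFDerivAt (by
      rw [minSmoothness_of_isRCLikeNormedField]; exact WithTop.coe_le_coe.2 (le_top : (2 : ℕ∞) ≤ ⊤))
  have hl := (HasFDerivAt.comp (f := fun y => (y, lone (EG := EG) G)) (lone (EG := EG) G) hD
    (hasFDerivAt_prodMk_left (lone G) (lone G))).clm_comp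
    (hasFDerivAt_const (ContinuousLinearMap.inr ℝ EG EG) (lone (EG := EG) G))
  have hr := (HasFDerivAt.comp (f := fun y => (lone (EG := EG) G, y)) (lone (EG := EG) G) hD
    (hasFDerivAt_prodMk_right (lone G) (lone G))).clm_comp
    (hasFDerivAt_const (ContinuousLinearMap.inl ℝ EG EG) (lone (EG := EG) G))
  have hq := hasFDerivAt_rightTrivialization.unique hr
  refine HasFDerivAt.congr_fderiv hl ?_
  rw [hq]
  ext u v
  simpa using hsym.eq (u, 0) (0, v)

/-- Near the identity `Ad` is the inverse of the right trivialization composed with the left one. At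
the identity both are the identity map, so the derivative is the difference of theirs. -/
theorem hasFDerivAt_AdL_lchart_symm [CompleteSpace EG] :
    HasFDerivAt (fun y => AdL ((lchart (EG := EG) G).symm y)) (bracketL (EG := EG) G)
      (lone G) := by
  have h1 := hasFDerivAt_rightTrivialization (EG := EG) (G := G)
  have hinv := hasFDerivAt_ringInverse (𝕜 := ℝ) (1 : (EG →L[ℝ] EG)ˣ)
  have h2 := HasFDerivAt.comp (lone (EG := EG) G) (g := Ring.inverse)
    (f := rightTrivialization (EG := EG) G)
    (by rw [rightTrivialization_lone]; exact hinv) h1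
  have h3 := h2.clm_comp (hasFDerivAt_leftTrivialization (EG := EG) (G := G))
  have hunit : ∀ᶠ y in 𝓝 (lone (EG := EG) G), IsUnit (rightTrivialization (EG := EG) G y) := by
    refine h1.continuousAt.eventually (Units.isOpen.mem_nhds ?_)
    rw [rightTrivialization_lone]
    exact isUnit_one
  refine HasFDerivAt.congr_fderiv (h3.congr_of_eventuallyEq ?_) ?_
  · filter_upwards [hunit, isOpen_lchart_target.mem_nhds (lone_mem_target (G := G))] with y hu hy
    rw [leftTrivialization_eq hy]
    change _ = Ring.inverse (rightTrivialization (EG := EG) G y) * (_ * _)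
    rw [← mul_assoc, Ring.inverse_mul_cancel _ hu, one_mul]
  · have hl : leftTrivialization (EG := EG) G (lone G) = .id ℝ EG := by
      rw [leftTrivialization_eq lone_mem_target, rightTrivialization_lone, lchart_symm_lone, AdL_one]
      rfl
    have hone : Ring.inverse (ContinuousLinearMap.id ℝ EG) = .id ℝ EG := Ring.inverse_one _
    ext u v
    simp [bracketL, hl, rightTrivialization_lone, hone]
    abel

end AdjointBracket

/-! ### Agreement with the bracket of left-invariant vector fields; derivative of `Ad`. -/

section BracketFormula

variable {EG : Type*} [NormedAddCommGroup EG] [NormedSpace ℝ EG] [CompleteSpace EG]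
  {G : Type*} [TopologicalSpace G] [ChartedSpace EG G] [Group G] [LieGroup 𝓘(ℝ, EG) ∞ G]
  {X : Type*} [NormedAddCommGroup X] [NormedSpace ℝ X]

/-- Left translation by `g`, conjugated by the chart, is `lmul (y, ·)`. Comparing derivatives at the
identity, where the chart has identity derivative, identifies the coordinate expression of a
left-invariant field. -/
theorem mpullbackWithin_mulInvariantVectorField_eventuallyEq (v : EG) :
    (VectorField.mpullbackWithin 𝓘(ℝ, EG) 𝓘(ℝ, EG) (extChartAt 𝓘(ℝ, EG) (1 : G)).symm
      (mulInvariantVectorField (I := 𝓘(ℝ, EG)) (G := G) v) (range 𝓘(ℝ, EG)) : EG → EG)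
      =ᶠ[𝓝 (lone (EG := EG) G)] fun y => leftTrivialization G y v := by
  filter_upwards [isOpen_lchart_target.mem_nhds (lone_mem_target (G := G))] with y hy
  set g : G := (lchart (EG := EG) G).symm y with hg
  have hsymm : ∀ z ∈ (lchart (EG := EG) G).target,
      MDifferentiableAt 𝓘(ℝ, EG) 𝓘(ℝ, EG) (lchart (EG := EG) G).symm z := fun z hz =>
    (contMDiffAt_lchart_symm hz).mdifferentiableAt (by simp)
  have hlone : (mder (lchart (EG := EG) G).symm (lone (EG := EG) G) : EG →L[ℝ] EG) = .id ℝ EG := by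
    have := mfderivWithin_range_extChartAt_symm (I := 𝓘(ℝ, EG)) (x := (1 : G))
    rw [ModelWithCorners.Boundaryless.range_eq_univ, mfderivWithin_univ] at this
    exact this
  have hL : MDifferentiableAt 𝓘(ℝ, EG) 𝓘(ℝ, EG) (fun x : G => g * x) 1 :=
    (contMDiff_mul_left (n := ∞) (I := 𝓘(ℝ, EG)) (a := g)).mdifferentiable (by simp) _
  have h1 := mder_comp (E := EG) (f := (lchart (EG := EG) G).symm) hL (hsymm _ lone_mem_target)
    lchart_symm_lone
  have hl := hasFDerivAt_lmul_right (G := G) hy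
  have h2 := mder_comp (E := EG) (f := fun x => lmul (EG := EG) G (y, x)) (x := lone (EG := EG) G)
    (hsymm y hy) hl.differentiableAt.mdifferentiableAt (lmul_lone_right hy)
  have heq : (lchart (EG := EG) G).symm ∘ (fun x => lmul (EG := EG) G (y, x))
      =ᶠ[𝓝 (lone (EG := EG) G)] (fun x : G => g * x) ∘ (lchart (EG := EG) G).symm := by
    have := topologicalGroup_of_lieGroup 𝓘(ℝ, EG) ∞ (G := G)
    have : Tendsto (fun z => g * (lchart (EG := EG) G).symm z) (𝓝 (lone (EG := EG) G)) (𝓝 g) := by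
      have := Tendsto.mul (tendsto_const_nhds (x := g))
        (continuousAt_lchart_symm (EG := EG) (G := G) lone_mem_target)
      rwa [lchart_symm_lone, mul_one] at this
    filter_upwards [this (isOpen_lchart_source.mem_nhds ((lchart (EG := EG) G).map_target hy))]
      with z hz
    simp only [Function.comp_apply, lmul]
    exact (lchart (EG := EG) G).left_inv hz
  have h3 : (mder (fun x : G => g * x) 1 : EG →L[ℝ] EG) =
      (mder (lchart (EG := EG) G).symm y : EG →L[ℝ] EG).comp (leftTrivialization G y) := by
    have h4 : (mder ((lchart (EG := EG) G).symm ∘ (fun x => lmul (EG := EG) G (y, x)))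
        (lone (EG := EG) G) : EG →L[ℝ] EG) = mder ((fun x : G => g * x) ∘
          (lchart (EG := EG) G).symm) (lone (EG := EG) G) :=
      heq.mfderiv_eq
    rw [h1, h2, hlone] at h4
    rw [← hl.fderiv]
    have h5 : (mder (fun x => lmul (EG := EG) G (y, x)) (lone (EG := EG) G) : EG →L[ℝ] EG) =
      fderiv ℝ (fun x => lmul (EG := EG) G (y, x)) (lone (EG := EG) G) := mfderiv_eq_fderiv
    rw [h5] at h4
    rw [h4]
    rfl
  have hinv := isInvertible_mfderivWithin_extChartAt_symm (I := 𝓘(ℝ, EG)) (x := (1 : G)) hy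
  rw [VectorField.mpullbackWithin_apply]
  have h6 : mulInvariantVectorField (I := 𝓘(ℝ, EG)) (G := G) v
      ((extChartAt 𝓘(ℝ, EG) (1 : G)).symm y) = mfderivWithin 𝓘(ℝ, EG) 𝓘(ℝ, EG)
        (extChartAt 𝓘(ℝ, EG) (1 : G)).symm (range 𝓘(ℝ, EG)) y (leftTrivialization G y v) := by
    rw [ModelWithCorners.Boundaryless.range_eq_univ, mfderivWithin_univ]
    exact DFunLike.congr_fun h3 v
  rw [h6]
  exact hinv.inverse_apply_eq.2 rfl

theorem lieBracketWithin_eq_of_eventuallyEq_leftTrivialization {u v : EG} {V W : EG → EG}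
    (hV : V =ᶠ[𝓝 (lone (EG := EG) G)] fun y => leftTrivialization G y u)
    (hW : W =ᶠ[𝓝 (lone (EG := EG) G)] fun y => leftTrivialization G y v)
    {s : Set EG} (hs : s = univ) :
    VectorField.lieBracketWithin ℝ V W s (lone (EG := EG) G) = bracketL G u v := by
  have hl := hasFDerivAt_leftTrivialization (EG := EG) (G := G)
  have hl1 : leftTrivialization (EG := EG) G (lone G) = .id ℝ EG := by
    rw [leftTrivialization_eq lone_mem_target, rightTrivialization_lone, lchart_symm_lone, AdL_one]
    rfl
  have hd : ∀ w : EG, fderiv ℝ (fun y => leftTrivialization (EG := EG) G y w) (lone G) =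
      (lieQ (EG := EG) G) w := fun w => by
    have h := (hl.clm_apply (hasFDerivAt_const w (lone (EG := EG) G))).fderiv
    rw [h]; ext z; simp
  rw [hs, VectorField.lieBracketWithin_univ, hV.lieBracket_vectorField_eq hW,
    VectorField.lieBracket_eq]
  simp only [hd, hl1]
  simp [bracketL]

/-- The bracket of the Lie algebra is the value at `1` of a bracket of left-invariant fields
computed in the chart. There the fields are columns of the left trivialization, whose derivative is
the flip of `lieQ`. -/
theorem bracket_eq (u v : EG) : bracket G u v = bracketL G u v := by
  have hself : (mder (extChartAt 𝓘(ℝ, EG) (1 : G)) (1 : G) : EG →L[ℝ] EG) = .id ℝ EG :=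
    mfderiv_extChartAt_self (I := 𝓘(ℝ, EG)) (x := (1 : G))
  have hfin : ∀ Z : EG, (mder (extChartAt 𝓘(ℝ, EG) (1 : G)) (1 : G) : EG →L[ℝ] EG).inverse Z = Z :=
    fun Z => by rw [hself, ContinuousLinearMap.inverse_id]; rfl
  exact (hfin _).trans (lieBracketWithin_eq_of_eventuallyEq_leftTrivialization
    (mpullbackWithin_mulInvariantVectorField_eventuallyEq (G := G) u)
    (mpullbackWithin_mulInvariantVectorField_eventuallyEq (G := G) v)
    (by rw [ModelWithCorners.Boundaryless.range_eq_univ, preimage_univ, univ_inter]))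

theorem bracketL_self (u : EG) : bracketL G u u = 0 := by simp [bracketL]

theorem bracketL_antisymm (u v : EG) : bracketL G u v = -bracketL G v u := by
  simp [bracketL]

/-- By `Ad(f y) = Ad(f(y)f(x)⁻¹) Ad(f x)` only the derivative of `Ad` at the identity is needed. -/
theorem HasLogDeriv.hasFDerivWithinAt_AdL {f : X → G} {L : X →L[ℝ] EG} {S : Set X} {x : X}
    (hf : HasLogDeriv f L S x) :
    HasFDerivWithinAt (fun y => AdL (f y))
      (((ContinuousLinearMap.compL ℝ EG EG EG).flip (AdL (f x))).comp ((bracketL G).comp L)) S x := by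
  have h1 := hasFDerivAt_AdL_lchart_symm (EG := EG) (G := G)
  have e1 : lone G = lchart (EG := EG) G (f x * (f x)⁻¹) := by simp [lone]
  rw [e1] at h1
  have h2 := (h1.comp_hasFDerivWithinAt x hf.2).clm_comp
    (hasFDerivWithinAt_const (AdL (f x) : EG →L[ℝ] EG) x S)
  refine HasFDerivWithinAt.congr_fderiv (h2.congr_of_eventuallyEq ?_ ?_) ?_
  · filter_upwards [hf.eventually_mem] with y hy
    simp only [Function.comp_apply, (lchart (EG := EG) G).left_inv hy]
    rw [← AdL_mul (EG := EG)]
    simp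
  · simp only [Function.comp_apply, mul_inv_cancel,
      (lchart (EG := EG) G).left_inv mem_lchart_source]
    rw [← AdL_mul (EG := EG)]
    simp
  · ext v w; simp

theorem continuous_AdL : Continuous (fun g : G => (AdL g : EG →L[ℝ] EG)) := by
  have := topologicalGroup_of_lieGroup 𝓘(ℝ, EG) ∞ (G := G)
  rw [continuous_iff_continuousAt]
  intro g
  have h1 := (hasFDerivAt_AdL_lchart_symm (EG := EG) (G := G)).continuousAt
  have h2 : Tendsto (fun h : G => lchart (EG := EG) G (h * g⁻¹)) (𝓝 g) (𝓝 (lone G)) := by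
    have h3 : Tendsto (fun h : G => h * g⁻¹) (𝓝 g) (𝓝 1) := by
      have := Tendsto.mul (tendsto_id : Tendsto (fun h : G => h) (𝓝 g) (𝓝 g)) (tendsto_const_nhds (x := g⁻¹))
      rwa [mul_inv_cancel] at this
    exact (continuousAt_lchart (EG := EG) mem_lchart_source).tendsto.comp h3
  have h3 : Tendsto (fun h : G => (AdL ((lchart (EG := EG) G).symm (lchart (EG := EG) G (h * g⁻¹)))
      : EG →L[ℝ] EG).comp (AdL g)) (𝓝 g) (𝓝 (AdL g)) := by
    have := (((ContinuousLinearMap.compL ℝ EG EG EG).flip (AdL g)).continuous.tendsto _).comp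
      (h1.tendsto.comp h2)
    simpa [lchart_symm_lone, AdL_one, Function.comp_def] using this
  refine h3.congr' ?_
  have h4 : Tendsto (fun h : G => h * g⁻¹) (𝓝 g) (𝓝 1) := by
    have := Tendsto.mul (tendsto_id : Tendsto (fun h : G => h) (𝓝 g) (𝓝 g)) (tendsto_const_nhds (x := g⁻¹))
    rwa [mul_inv_cancel] at this
  filter_upwards [h4 (isOpen_lchart_source.mem_nhds (mem_lchart_source (EG := EG)))] with h hh
  rw [(lchart (EG := EG) G).left_inv hh, ← AdL_mul (EG := EG)]
  simp

end BracketFormula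

/-! ### The transport equation: existence, uniqueness, expansion to second order. -/

section Transport

variable {EG : Type*} [NormedAddCommGroup EG] [NormedSpace ℝ EG] [CompleteSpace EG]
  {G : Type*} [TopologicalSpace G] [ChartedSpace EG G] [Group G] [LieGroup 𝓘(ℝ, EG) ∞ G]
  {X : Type*} [NormedAddCommGroup X] [NormedSpace ℝ X]
  {Y : Type*} [NormedAddCommGroup Y] [NormedSpace ℝ Y]

theorem HasLogDeriv.comp {f : X → G} {L : X →L[ℝ] EG} {S : Set X} {φ : Y → X} {φ' : Y →L[ℝ] X}
    {T : Set Y} {y : Y} (hf : HasLogDeriv f L S (φ y)) (hφ : HasFDerivWithinAt φ φ' T y)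
    (hST : MapsTo φ T S) : HasLogDeriv (fun y => f (φ y)) (L.comp φ') T y :=
  ⟨ContinuousWithinAt.comp hf.1 hφ.continuousWithinAt hST, hf.2.comp y hφ hST⟩

/-- `U : [0, T] → G` solves `dU/dt + a(t) U = 0`, `U(0) = 1`. -/
def IsTransport (T : ℝ) (a : ℝ → EG) (U : ℝ → G) : Prop :=
  U 0 = 1 ∧ ∀ t ∈ Icc 0 T, HasLogDeriv U (ContinuousLinearMap.toSpanSingleton ℝ (-(a t))) (Icc 0 T) t

theorem exists_rightTrivialization_bounds :
    ∃ r > 0, ∃ C : NNReal, Metric.closedBall (lone (EG := EG) G) r ⊆ (lchart (EG := EG) G).target ∧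
      LipschitzOnWith C (rightTrivialization (EG := EG) G) (Metric.closedBall (lone G) r) ∧
      ∀ x ∈ Metric.closedBall (lone (EG := EG) G) r, ‖rightTrivialization G x‖ ≤ 2 := by
  have hR := contDiffAt_rightTrivialization (EG := EG) (G := G) lone_mem_target
  obtain ⟨C, t, ht, hC⟩ := (hR.of_le (m := 1) (by simp)).exists_lipschitzOnWith
  have h2 : ∀ᶠ x in 𝓝 (lone (EG := EG) G), ‖rightTrivialization G x‖ < 2 := by
    refine hR.continuousAt.norm.eventually_lt continuousAt_const ?_
    rw [rightTrivialization_lone]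
    exact lt_of_le_of_lt ContinuousLinearMap.norm_id_le (by norm_num)
  obtain ⟨r, hr, hb⟩ := Metric.nhds_basis_closedBall.mem_iff.1
    (Filter.inter_mem (Filter.inter_mem ht h2) (isOpen_lchart_target.mem_nhds
      (lone_mem_target (G := G))))
  exact ⟨r, hr, C, fun x hx => (hb hx).2, hC.mono fun x hx => (hb hx).1.1,
    fun x hx => (hb hx).1.2.le⟩

/-- The Picard-Lindelöf theorem, with the location of the solution. -/
theorem exists_solution_mem_closedBall {F : Type*} [NormedAddCommGroup F] [NormedSpace ℝ F]
    [CompleteSpace F] {f : ℝ → F → F} {tmin tmax : ℝ} {t₀ : Icc tmin tmax} {x₀ : F}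
    {a L K : NNReal} (hf : IsPicardLindelof f t₀ x₀ a 0 L K) :
    ∃ α : ℝ → F, α t₀ = x₀ ∧ ∀ t ∈ Icc tmin tmax, α t ∈ Metric.closedBall x₀ a ∧
      HasDerivWithinAt α (f t (α t)) (Icc tmin tmax) t := by
  have hx : x₀ ∈ Metric.closedBall x₀ ((0 : NNReal) : ℝ) := by simp
  obtain ⟨α, hα⟩ := ODE.FunSpace.exists_isFixedPt_next hf hx
  refine ⟨α.compProj, by rw [ODE.FunSpace.compProj_val, ← hα, ODE.FunSpace.next_apply₀],
    fun t ht => ⟨?_, ?_⟩⟩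
  · exact α.compProj_mem_closedBall hf.mul_max_le
  · apply ODE.hasDerivWithinAt_picard_Icc t₀.2 hf.continuousOn_uncurry
      α.continuous_compProj.continuousOn (fun _ _ => α.compProj_mem_closedBall hf.mul_max_le)
      x₀ ht |>.congr_of_mem _ ht
    intro t' ht'
    nth_rw 1 [← hα]
    rw [ODE.FunSpace.compProj_of_mem ht', ODE.FunSpace.next_apply]

/-- Short time solutions of the transport equation, in the chart. -/
theorem exists_chart_solution :
    ∃ r > 0, ∃ C : ℝ, 0 ≤ C ∧
      Metric.closedBall (lone (EG := EG) G) r ⊆ (lchart (EG := EG) G).target ∧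
      (∀ x ∈ Metric.closedBall (lone (EG := EG) G) r,
        ‖rightTrivialization G x - .id ℝ EG‖ ≤ C * ‖x - lone G‖) ∧
      (∀ x ∈ Metric.closedBall (lone (EG := EG) G) r, ‖rightTrivialization G x‖ ≤ 2) ∧
      ∀ (T K : ℝ) (a : ℝ → EG), 0 ≤ T → 0 ≤ K → ContinuousOn a (Icc 0 T) → (∀ t ∈ Icc 0 T, ‖a t‖ ≤ K) →
        2 * K * T ≤ r → ∃ w : ℝ → EG, w 0 = lone (EG := EG) G ∧ ∀ t ∈ Icc 0 T,
          w t ∈ Metric.closedBall (lone (EG := EG) G) r ∧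
          HasDerivWithinAt w (-(rightTrivialization G (w t) (a t))) (Icc 0 T) t := by
  obtain ⟨r, hr, C, hsub, hlip, hnorm⟩ := exists_rightTrivialization_bounds (EG := EG) (G := G)
  refine ⟨r, hr, C, C.2, hsub, fun x hx => ?_, hnorm, fun T K a hT hK ha hbd hKT => ?_⟩
  · have := hlip.norm_sub_le hx (Metric.mem_closedBall_self hr.le)
    rwa [rightTrivialization_lone] at this
  -- As the trivialization has norm at most `2` on the ball, the speed is at most `2 * K`, and `2 *
  -- K * T ≤ r` keeps the solution inside the ball. The radius is independent of the coefficient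
  -- `a`.
  have hpl : IsPicardLindelof (fun t x => -(rightTrivialization (EG := EG) G x (a t)))
      (⟨0, le_rfl, hT⟩ : Icc (0 : ℝ) T) (lone (EG := EG) G) ⟨r, hr.le⟩ 0
      ⟨2 * K, by positivity⟩ (C * ⟨K, hK⟩) := by
    refine ⟨fun t ht => ?_, fun x _ => ?_, fun t ht x hx => ?_, ?_⟩
    · refine LipschitzOnWith.of_dist_le_mul fun x hx y hy => ?_
      rw [dist_neg_neg, dist_eq_norm, dist_eq_norm, ← sub_apply]
      refine (ContinuousLinearMap.le_opNorm _ _).trans ?_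
      have h1 := hlip.norm_sub_le hx hy
      calc _ ≤ (C * ‖x - y‖) * K := mul_le_mul h1 (hbd t ht) (norm_nonneg _) (by positivity)
        _ = C * K * ‖x - y‖ := by ring
    · exact ((rightTrivialization (EG := EG) G x).continuous.comp_continuousOn ha).neg
    · rw [norm_neg]
      refine (ContinuousLinearMap.le_opNorm _ _).trans ?_
      exact mul_le_mul (hnorm x hx) (hbd t ht) (norm_nonneg _) (by norm_num)
    · simp only [sub_zero, NNReal.coe_zero, sub_self, max_eq_left hT]
      exact hKT
  exact exists_solution_mem_closedBall hpl

theorem isTransport_of_chart {T : ℝ} {a : ℝ → EG} {w : ℝ → EG} (h0 : w 0 = lone (EG := EG) G)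
    (hw : ∀ t ∈ Icc 0 T, w t ∈ (lchart (EG := EG) G).target ∧
      HasDerivWithinAt w (-(rightTrivialization G (w t) (a t))) (Icc 0 T) t) :
    IsTransport T a (fun t => (lchart (EG := EG) G).symm (w t)) := by
  refine ⟨by simp only [h0, lchart_symm_lone], fun t ht => ?_⟩
  refine HasLogDeriv.of_lchart (hw t ht).1 ?_
  refine (hw t ht).2.hasFDerivWithinAt.congr_fderiv ?_
  ext; simp

/-- In the logarithmic derivative of `U⁻¹ V` the two contributions `± Ad(U⁻¹) a` cancel, so `U⁻¹ V`
is constant. -/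
theorem IsTransport.eqOn {T : ℝ} {a : ℝ → EG} {U V : ℝ → G} (hU : IsTransport T a U)
    (hV : IsTransport T a V) : EqOn U V (Icc 0 T) := by
  intro t ht
  have h0 : ∀ s ∈ Icc 0 T, HasLogDeriv (fun s => (U s)⁻¹ * V s) (0 : ℝ →L[ℝ] EG) (Icc 0 T) s := by
    intro s hs
    refine ((hU.2 s hs).inv.mul (hV.2 s hs)).congr_deriv ?_
    ext; simp
  have := HasLogDeriv.eq_of_zero (convex_Icc 0 T) h0 ht ⟨le_rfl, ht.1.trans ht.2⟩
  rw [hU.1, hV.1] at this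
  simp only [inv_one, mul_one] at this
  exact (inv_mul_eq_one.1 this)

theorem IsTransport.congr {T : ℝ} {a b : ℝ → EG} {U : ℝ → G} (hU : IsTransport T a U)
    (h : EqOn a b (Icc 0 T)) : IsTransport T b U :=
  ⟨hU.1, fun t ht => by rw [← h ht]; exact hU.2 t ht⟩

/-- The equation is invariant under right translation, so a solution started at `1` at time `S`
continues `U` after multiplication on the right by `U S`. -/
theorem IsTransport.glue {S T : ℝ} (hS : 0 ≤ S) (hT : 0 ≤ T) {a : ℝ → EG} {U V : ℝ → G}
    (hU : IsTransport S a U) (hV : IsTransport T (fun t => a (t + S)) V) :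
    ∃ W : ℝ → G, IsTransport (T + S) a W := by
  classical
  have hVS : ∀ t ∈ Icc S (T + S), HasLogDeriv (fun t => V (t - S) * U S)
      (ContinuousLinearMap.toSpanSingleton ℝ (-(a t))) (Icc S (T + S)) t := by
    intro t ht
    have h1 := hV.2 (t - S) ⟨by linarith [ht.1], by linarith [ht.2]⟩
    have h2 : HasFDerivWithinAt (fun t : ℝ => t - S) (.id ℝ ℝ) (Icc S (T + S)) t :=
      (hasFDerivWithinAt_id t _).sub_const S
    have h3 := (HasLogDeriv.comp (φ := fun t : ℝ => t - S) h1 h2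
      (fun s hs => ⟨by linarith [hs.1], by linarith [hs.2]⟩)).mul_const (U S)
    refine h3.congr_deriv ?_
    ext; simp
  set W : ℝ → G := fun t => if t ≤ S then U t else V (t - S) * U S with hW
  have hW1 : ∀ t ∈ Icc 0 S, W t = U t := fun t ht => by simp [hW, ht.2]
  have hW2 : ∀ t ∈ Icc S (T + S), W t = V (t - S) * U S := fun t ht => by
    rcases ht.1.eq_or_lt with h | h
    · subst h; simp [hW, hV.1]
    · simp [hW, not_le.2 h]
  refine ⟨W, by rw [hW1 0 ⟨le_rfl, hS⟩, hU.1], fun t ht => ?_⟩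
  have hI : Icc 0 (T + S) = Icc 0 S ∪ Icc S (T + S) := (Icc_union_Icc_eq_Icc hS (by linarith)).symm
  have d1 : ∀ t ∈ Icc 0 S, HasLogDeriv W (ContinuousLinearMap.toSpanSingleton ℝ (-(a t)))
      (Icc 0 S) t := fun t ht => (hU.2 t ht).congr hW1 (hW1 t ht)
  have d2 : ∀ t ∈ Icc S (T + S), HasLogDeriv W (ContinuousLinearMap.toSpanSingleton ℝ (-(a t)))
      (Icc S (T + S)) t := fun t ht => (hVS t ht).congr hW2 (hW2 t ht)
  rcases lt_trichotomy t S with h | h | h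
  · refine (d1 t ⟨ht.1, h.le⟩).mono_of_mem ?_
    have := inter_mem_nhdsWithin (Icc 0 (T + S)) (Iio_mem_nhds h)
    exact Filter.mem_of_superset this fun s hs => ⟨hs.1.1, le_of_lt hs.2⟩
  · rw [hI]
    exact (d1 t ⟨ht.1, h.le⟩).union (d2 t ⟨h.ge, ht.2⟩)
  · refine (d2 t ⟨h.le, ht.2⟩).mono_of_mem ?_
    have := inter_mem_nhdsWithin (Icc 0 (T + S)) (Ioi_mem_nhds h)
    exact Filter.mem_of_superset this fun s hs => ⟨le_of_lt hs.2, hs.1.2⟩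

/-- The transport equation has a solution. -/
theorem exists_isTransport (G : Type*) [TopologicalSpace G] [ChartedSpace EG G] [Group G]
    [LieGroup 𝓘(ℝ, EG) ∞ G] {T : ℝ} (hT : 0 ≤ T) {a : ℝ → EG} (ha : ContinuousOn a (Icc 0 T)) :
    ∃ U : ℝ → G, IsTransport T a U := by
  obtain ⟨r, hr, C, -, hsub, -, -, hsol⟩ := exists_chart_solution (EG := EG) (G := G)
  -- The coefficient is extended by its end values, so that all its time shifts are continuous and
  -- bounded by the same `K`.
  set b : ℝ → EG := IccExtend hT ((Icc 0 T).domRestrict a) with hb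
  have hbc : Continuous b := (continuousOn_iff_continuous_domRestrict.1 ha).Icc_extend'
  obtain ⟨K, hK⟩ := isCompact_Icc.exists_bound_of_continuousOn ha
  have hK0 : 0 ≤ K := (norm_nonneg _).trans (hK 0 ⟨le_rfl, hT⟩)
  have hbK : ∀ t, ‖b t‖ ≤ K := fun t => hK _ (projIcc 0 T hT t).2
  suffices ∃ U : ℝ → G, IsTransport T b U by
    obtain ⟨U, hU⟩ := this
    exact ⟨U, hU.congr fun t ht => IccExtend_of_mem hT _ ht⟩
  -- The length of a solvable step depends only on `K` and `r`; hence `m` equal steps reach `T`.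
  obtain ⟨m, hm⟩ := exists_nat_gt (2 * K * T / r)
  have hm0 : (0 : ℝ) < m := lt_of_le_of_lt (by positivity) hm
  have hstep : 2 * K * (T / m) ≤ r := by
    rw [div_lt_iff₀ hr] at hm
    rw [← mul_div_assoc, div_le_iff₀ hm0]
    linarith
  have key : ∀ j : ℕ, ∃ U : ℝ → G, IsTransport (j * (T / m)) b U := by
    intro j
    induction j with
    | zero =>
      refine ⟨fun _ => 1, rfl, fun t ht => ?_⟩
      have ht0 : t = 0 := by simpa using ht
      refine ⟨continuousWithinAt_const, ?_⟩
      simp only [CharP.cast_eq_zero, zero_mul, Icc_self, ht0]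
      exact HasFDerivWithinAt.of_subsingleton subsingleton_singleton
    | succ j ih =>
      obtain ⟨U, hU⟩ := ih
      obtain ⟨w, hw0, hw⟩ := hsol (T / m) K (fun t => b (t + j * (T / m))) (by positivity) hK0
        (hbc.comp (by fun_prop)).continuousOn (fun t _ => hbK _) hstep
      have hV := isTransport_of_chart hw0 fun t ht => ⟨hsub (hw t ht).1, (hw t ht).2⟩
      obtain ⟨W, hW⟩ := IsTransport.glue (by positivity) (by positivity) hU hV
      refine ⟨W, ?_⟩
      have : ((j + 1 : ℕ) : ℝ) * (T / m) = T / m + j * (T / m) := by push_cast; ring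
      rwa [this]
  obtain ⟨U, hU⟩ := key m
  refine ⟨U, ?_⟩
  rwa [mul_div_cancel₀ _ hm0.ne'] at hU

/-- The solution of the transport equation is `1 - ∫ a` to first order. -/
theorem exists_transport_estimate (G : Type*) [TopologicalSpace G] [ChartedSpace EG G] [Group G]
    [LieGroup 𝓘(ℝ, EG) ∞ G] :
    ∃ δ > 0, ∃ C : ℝ, 0 ≤ C ∧ ∀ (T K : ℝ) (a : ℝ → EG) (U : ℝ → G), 0 ≤ T → 0 ≤ K →
      ContinuousOn a (Icc 0 T) → (∀ t ∈ Icc 0 T, ‖a t‖ ≤ K) → K * T ≤ δ → IsTransport T a U →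
      ∀ t ∈ Icc 0 T, U t ∈ (lchart (EG := EG) G).source ∧
        HasDerivWithinAt (fun t => lchart (EG := EG) G (U t))
          (-(rightTrivialization G (lchart (EG := EG) G (U t)) (a t))) (Icc 0 T) t ∧
        ‖lchart (EG := EG) G (U t) - lone G‖ ≤ 2 * (K * T) ∧
        ‖lchart (EG := EG) G (U t) - lone G + ∫ s in (0)..t, a s‖ ≤ C * (K * T) ^ 2 := by
  obtain ⟨r, hr, C, hC, hsub, hlip, hnorm, hsol⟩ := exists_chart_solution (EG := EG) (G := G)
  refine ⟨r / 2, by positivity, 2 * C, by positivity, fun T K a U hT hK ha hbd hKT hU t ht => ?_⟩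
  obtain ⟨w, hw0, hw⟩ := hsol T K a hT hK ha hbd (by linarith)
  have hV := isTransport_of_chart hw0 fun t ht => ⟨hsub (hw t ht).1, (hw t ht).2⟩
  have hUV := hU.eqOn hV
  have hwU : ∀ s ∈ Icc 0 T, lchart (EG := EG) G (U s) = w s := fun s hs => by
    rw [hUV hs]; exact (lchart (EG := EG) G).right_inv (hsub (hw s hs).1)
  have h1 : ∀ s ∈ Icc 0 T, ‖w s - lone G‖ ≤ 2 * (K * T) := fun s hs => by
    have := norm_image_sub_le_of_norm_deriv_le_segment' (C := 2 * K)
      (fun x hx => (hw x hx).2) (fun x hx => by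
        rw [norm_neg]
        exact (ContinuousLinearMap.le_opNorm _ _).trans (mul_le_mul
          (hnorm _ (hw x ⟨hx.1, hx.2.le⟩).1) (hbd x ⟨hx.1, hx.2.le⟩) (norm_nonneg _)
          (by norm_num))) s hs
    rw [hw0] at this
    refine this.trans ?_
    have : (2 * K) * (s - 0) ≤ (2 * K) * T := by
      apply mul_le_mul_of_nonneg_left _ (by positivity); linarith [hs.2]
    linarith
  refine ⟨?_, ?_, ?_, ?_⟩
  · rw [hUV ht]; exact (lchart (EG := EG) G).map_target (hsub (hw t ht).1)
  · rw [hwU t ht]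
    exact (hw t ht).2.congr hwU (hwU t ht)
  · rw [hwU t ht]; exact h1 t ht
  · rw [hwU t ht]
    set b : ℝ → EG := IccExtend hT ((Icc 0 T).domRestrict a) with hb
    have hbc : Continuous b := (continuousOn_iff_continuous_domRestrict.1 ha).Icc_extend'
    have hab : EqOn a b (Icc 0 T) := fun t ht =>
      (IccExtend_of_mem hT ((Icc 0 T).domRestrict a) ht).symm
    have hint : ∫ s in (0)..t, a s = ∫ s in (0)..t, b s :=
      intervalIntegral.integral_congr fun s hs => hab (by
        rw [uIcc_of_le ht.1] at hs; exact ⟨hs.1, hs.2.trans ht.2⟩)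
    rw [hint]
    -- The derivative of `w - lone + ∫ b` is `-(R(w) - id) a`, where `R` is the right
    -- trivialization. This is at most `C * ‖w - lone‖ * K`, and `‖w - lone‖ ≤ 2 * (K * T)`.
    have := norm_image_sub_le_of_norm_deriv_le_segment' (C := C * (2 * (K * T)) * K)
      (f := fun t => w t - lone (EG := EG) G + ∫ s in (0)..t, b s)
      (f' := fun t => -(rightTrivialization G (w t) (a t)) + b t)
      (fun x hx => ((hw x hx).2.sub_const _).add
        (hbc.integral_hasStrictDerivAt 0 x).hasDerivAt.hasDerivWithinAt) (fun x hx => by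
        have hx' : x ∈ Icc 0 T := ⟨hx.1, hx.2.le⟩
        rw [← hab hx']
        have : -(rightTrivialization G (w x) (a x)) + a x =
          -((rightTrivialization G (w x) - .id ℝ EG) (a x)) := by simp; abel
        rw [this, norm_neg]
        exact (ContinuousLinearMap.le_opNorm _ _).trans (mul_le_mul
          ((hlip _ (hw x hx').1).trans (mul_le_mul_of_nonneg_left (h1 x hx') hC))
            (hbd x hx') (norm_nonneg _) (by positivity))) t ht
    simp only [hw0, sub_self, intervalIntegral.integral_same, add_zero, sub_zero] at this
    refine this.trans ?_
    have : C * (2 * (K * T)) * K * t ≤ C * (2 * (K * T)) * K * T :=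
      mul_le_mul_of_nonneg_left ht.2 (by positivity)
    nlinarith

/-- The second order expansion of the solution of the transport equation. -/
theorem exists_transport_estimate_second (G : Type*) [TopologicalSpace G] [ChartedSpace EG G]
    [Group G] [LieGroup 𝓘(ℝ, EG) ∞ G] {η : ℝ} (hη : 0 < η) :
    ∃ δ > 0, ∀ (T K : ℝ) (a : ℝ → EG) (U : ℝ → G), 0 ≤ T → 0 ≤ K →
      Continuous a → (∀ t ∈ Icc 0 T, ‖a t‖ ≤ K) → K * T ≤ δ → IsTransport T a U →
      U T ∈ (lchart (EG := EG) G).source ∧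
        ‖lchart (EG := EG) G (U T) - lone G + (∫ t in (0)..T, a t)
          - ∫ t in (0)..T, lieQ G (∫ s in (0)..t, a s) (a t)‖ ≤ η * (K * T) ^ 2 := by
  obtain ⟨δ, hδ, C, hC, hest⟩ := exists_transport_estimate (EG := EG) G
  have hR := (hasFDerivAt_rightTrivialization (EG := EG) (G := G)).isLittleO.def
    (show (0 : ℝ) < η / 4 by positivity)
  obtain ⟨ρ, hρ, hball⟩ := Metric.nhds_basis_closedBall.mem_iff.1 hR
  set q := ‖lieQ (EG := EG) G‖ with hq
  have hq0 : 0 ≤ q := norm_nonneg (lieQ (EG := EG) G)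
  -- The three bounds serve in turn to apply the first-order estimate, to keep the solution within
  -- `ρ` of the identity (it moves by at most `2 * (K * T)`), and to absorb the first-order error
  -- multiplied by `‖lieQ‖` into `η / 2`.
  refine ⟨min δ (min (ρ / 2) (η / (2 * (q * C + 1)))), by positivity,
    fun T K a U hT hK ha hbd hKT hU => ?_⟩
  have k1 : K * T ≤ δ := hKT.trans (min_le_left _ _)
  have k2 : K * T ≤ ρ / 2 := hKT.trans ((min_le_right _ _).trans (min_le_left _ _))
  have k3 : K * T ≤ η / (2 * (q * C + 1)) :=
    hKT.trans ((min_le_right _ _).trans (min_le_right _ _))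
  have hKT0 : 0 ≤ K * T := by positivity
  have k4 : q * C * (K * T) ≤ η / 2 := by
    rw [le_div_iff₀ (by positivity)] at k3
    nlinarith
  have hE := hest T K a U hT hK ha.continuousOn hbd k1 hU
  refine ⟨(hE T ⟨hT, le_rfl⟩).1, ?_⟩
  have hA : Continuous fun t => ∫ s in (0)..t, a s :=
    continuous_iff_continuousAt.2 fun t =>
      (ha.integral_hasStrictDerivAt 0 t).hasDerivAt.continuousAt
  have hQ : Continuous fun t => lieQ (EG := EG) G (∫ s in (0)..t, a s) (a t) :=
    ((lieQ (EG := EG) G).continuous.comp hA).clm_apply ha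
  -- The derivative of the remainder splits into the linearization error of the right
  -- trivialization, applied to `a`, and `lieQ` of the first-order error; each part is at most `η /
  -- 2 * (K * T) * K`.
  have hmain := norm_image_sub_le_of_norm_deriv_le_segment' (C := η * (K * T) * K)
    (f := fun t => lchart (EG := EG) G (U t) - lone G + (∫ s in (0)..t, a s)
      - ∫ t in (0)..t, lieQ G (∫ s in (0)..t, a s) (a t))
    (fun x hx => (((hE x hx).2.1.sub_const _).add
        (ha.integral_hasStrictDerivAt 0 x).hasDerivAt.hasDerivWithinAt).sub
        (hQ.integral_hasStrictDerivAt 0 x).hasDerivAt.hasDerivWithinAt) (fun x hx => by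
      have hx' : x ∈ Icc 0 T := ⟨hx.1, hx.2.le⟩
      obtain ⟨-, -, e1, e2⟩ := hE x hx'
      set y := lchart (EG := EG) G (U x)
      have hy : y ∈ Metric.closedBall (lone (EG := EG) G) ρ := by
        rw [Metric.mem_closedBall, dist_eq_norm]; linarith
      have hl := hball hy
      simp only [mem_ofPred_eq, rightTrivialization_lone] at hl
      have : -(rightTrivialization G y (a x)) + a x - lieQ G (∫ s in (0)..x, a s) (a x) =
          -((rightTrivialization G y - .id ℝ EG - lieQ G (y - lone G)) (a x))
            - lieQ G (y - lone G + ∫ s in (0)..x, a s) (a x) := by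
        simp; abel
      rw [this]
      refine (norm_sub_le _ _).trans ?_
      rw [norm_neg]
      have b1 : ‖(rightTrivialization G y - .id ℝ EG - lieQ G (y - lone G)) (a x)‖ ≤
          η / 2 * (K * T) * K := by
        refine (ContinuousLinearMap.le_opNorm _ _).trans (mul_le_mul ?_ (hbd x hx')
          (norm_nonneg _) (by positivity))
        nlinarith
      have b2 : ‖lieQ G (y - lone G + ∫ s in (0)..x, a s) (a x)‖ ≤ η / 2 * (K * T) * K := by
        refine (ContinuousLinearMap.le_opNorm₂ _ _ _).trans (mul_le_mul ?_ (hbd x hx')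
          (norm_nonneg _) (by positivity))
        calc q * _ ≤ q * (C * (K * T) ^ 2) := mul_le_mul_of_nonneg_left e2 hq0
          _ = q * C * (K * T) * (K * T) := by ring
          _ ≤ η / 2 * (K * T) := mul_le_mul_of_nonneg_right k4 hKT0
      linarith) T ⟨hT, le_rfl⟩
  simp only [hU.1, intervalIntegral.integral_same, sub_zero] at hmain
  have e0 : lchart (EG := EG) G 1 - lone G = 0 := sub_self _
  rw [e0, add_zero, sub_zero] at hmain
  refine hmain.trans (le_of_eq ?_)
  ring

end Transport

/-! ### Commuting coefficients, and comparison of holonomies to second order. -/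

section TransportConsequences

variable {EG : Type*} [NormedAddCommGroup EG] [NormedSpace ℝ EG] [CompleteSpace EG]
  {G : Type*} [TopologicalSpace G] [ChartedSpace EG G] [Group G] [LieGroup 𝓘(ℝ, EG) ∞ G]
  {X : Type*} [NormedAddCommGroup X] [NormedSpace ℝ X]

theorem HasLogDeriv.hasFDerivWithinAt_AdL_inv {f : X → G} {L : X →L[ℝ] EG} {S : Set X} {x : X}
    (hf : HasLogDeriv f L S x) :
    HasFDerivWithinAt (fun y => AdL (f y)⁻¹)
      (-(ContinuousLinearMap.compL ℝ EG EG EG (AdL (f x)⁻¹)).comp ((bracketL G).comp L)) S x := by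
  have h1 := (hf.mul_const (f x)⁻¹).inv.hasFDerivWithinAt_AdL
  have h2 := (hasFDerivWithinAt_const (AdL (f x)⁻¹ : EG →L[ℝ] EG) x S).clm_comp h1
  refine HasFDerivWithinAt.congr_fderiv (h2.congr (fun y _ => ?_) ?_) ?_
  · beta_reduce; rw [← AdL_mul (EG := EG)]; simp
  · rw [← AdL_mul (EG := EG)]; simp
  · ext v w; simp [AdL_one]

/-- Derivatives on the group are right translates of logarithmic derivatives, and right translation
is injective on tangent vectors. -/
theorem solvesTransport_iff {a : ℝ → EG} {U : ℝ → G} :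
    SolvesTransport a U ↔ IsTransport (2 * Real.pi) a U := by
  have hpi : (0 : ℝ) < 2 * Real.pi := by positivity
  have hu := uniqueDiffOn_Icc hpi
  have hder : ∀ (L : ℝ →L[ℝ] EG) (t : ℝ), t ∈ Icc 0 (2 * Real.pi) →
      HasLogDeriv U L (Icc 0 (2 * Real.pi)) t →
      (mfderivWithin 𝓘(ℝ, ℝ) 𝓘(ℝ, EG) U (Icc 0 (2 * Real.pi)) t (1 : ℝ)
        + rightTranslate (a t) (U t) = 0 ↔
          (mder (fun h : G => h * U t) 1 : EG →L[ℝ] EG) (L 1 + a t) = 0) := by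
    intro L t ht hL
    rw [hL.hasMFDerivWithinAt.mfderivWithin (hu t ht).uniqueMDiffWithinAt, map_add]
    rfl
  constructor
  · intro h
    refine ⟨h.init, fun t ht => ?_⟩
    obtain ⟨L, hL⟩ := HasLogDeriv.exists_of_mdifferentiableWithinAt (h.diff t ht)
    refine hL.congr_deriv ?_
    have h1 := (hder L t ht hL).1 (h.eqn t ht)
    have h2 : L 1 + a t = 0 := mder_mul_right_injective (U t) (by rw [h1, map_zero])
    ext
    simp [eq_neg_of_add_eq_zero_left h2]
  · intro h
    refine ⟨h.1, fun t ht => (h.2 t ht).hasMFDerivWithinAt.mdifferentiableWithinAt,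
      fun t ht => (hder _ t ht (h.2 t ht)).2 ?_⟩
    simp

theorem IsTransport.holonomy_eq {a : ℝ → EG} {U : ℝ → G} (hU : IsTransport (2 * Real.pi) a U) :
    transportHolonomy G a = U (2 * Real.pi) := by
  have h : ∃ U : ℝ → G, SolvesTransport a U := ⟨U, solvesTransport_iff.2 hU⟩
  rw [transportHolonomy, dif_pos h]
  exact (solvesTransport_iff.1 h.choose_spec).eqOn hU ⟨by positivity, le_rfl⟩

/-- The derivative of `Ad(U⁻¹) v` is `Ad(U⁻¹) [a, v] = 0`. -/
theorem IsTransport.AdL_eq {T : ℝ} {a : ℝ → EG} {U : ℝ → G} (hU : IsTransport T a U) {v : EG}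
    (hv : ∀ t ∈ Icc 0 T, bracketL G (a t) v = 0) : ∀ t ∈ Icc 0 T, AdL (U t) v = v := by
  intro t ht
  have hd : ∀ s ∈ Icc 0 T, HasFDerivWithinAt (fun s => AdL (U s)⁻¹ v) (0 : ℝ →L[ℝ] EG)
      (Icc 0 T) s := fun s hs => by
    have := (hU.2 s hs).hasFDerivWithinAt_AdL_inv.clm_apply (hasFDerivWithinAt_const v s (Icc 0 T))
    refine this.congr_fderiv ?_
    ext
    simp [hv s hs]
  have h0 := (convex_Icc 0 T).norm_image_sub_le_of_norm_hasFDerivWithin_le (C := 0) hd (by simp)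
    ⟨le_rfl, ht.1.trans ht.2⟩ ht
  have h1 : AdL (U t)⁻¹ v = v := by
    have : ‖(AdL (U t)⁻¹ v : EG) - AdL (U 0)⁻¹ v‖ = 0 := le_antisymm (by simpa using h0) (norm_nonneg _)
    rw [norm_eq_zero, sub_eq_zero, hU.1, inv_one, AdL_one] at this
    exact this
  conv_lhs => rw [← h1]
  exact AdL_apply_inv _ _

/-- The product rule yields the coefficient `a + Ad(U) b`, and commutation makes `Ad(U)` fix `b`. -/
theorem IsTransport.mul {T : ℝ} {a b : ℝ → EG} {U V : ℝ → G} (hU : IsTransport T a U)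
    (hV : IsTransport T b V) (hab : ∀ s ∈ Icc 0 T, ∀ t ∈ Icc 0 T, bracketL G (a s) (b t) = 0) :
    IsTransport T (fun t => a t + b t) (fun t => U t * V t) := by
  refine ⟨by simp [hU.1, hV.1], fun t ht => ((hU.2 t ht).mul (hV.2 t ht)).congr_deriv ?_⟩
  have := hU.AdL_eq (fun s hs => hab s hs t ht) t ht
  ext
  simp [this]
  abel

/-- The solution of a transport equation with commuting coefficients of integral zero. -/
theorem IsTransport.eq_one_of_integral_eq_zero {T : ℝ} (hT : 0 ≤ T) {d : ℝ → EG} {V : ℝ → G}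
    (hd : ContinuousOn d (Icc 0 T))
    (hdd : ∀ s ∈ Icc 0 T, ∀ t ∈ Icc 0 T, bracketL G (d s) (d t) = 0)
    (hint : ∫ t in (0)..T, d t = 0) (hV : IsTransport T d V) : V T = 1 := by
  have hex : ∀ s : ℝ, ∃ U : ℝ → G, IsTransport T (fun t => s • d t) U := fun s =>
    exists_isTransport G hT (hd.const_smul s)
  choose W hW using hex
  -- The final value for the coefficient `s • d` is a one-parameter subgroup in `s`, because the
  -- coefficients commute. Its velocity at `0` is `-∫ d = 0`, so it is trivial; `s = 1` is the
  -- assertion.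
  set g : ℝ → G := fun s => W s T with hg
  have hadd : ∀ s t, g (s + t) = g s * g t := by
    intro s t
    have h1 := (hW s).mul (hW t) (fun x hx y hy => by simp [hdd x hx y hy])
    have h2 := (hW (s + t)).eqOn (h1.congr fun x _ => by simp [add_smul])
    exact h2 ⟨hT, le_rfl⟩
  have hg0 : g 0 = 1 := by
    have := hadd 0 0
    simpa using this
  obtain ⟨δ, hδ, C, hC, hest⟩ := exists_transport_estimate (EG := EG) G
  obtain ⟨K, hK⟩ := isCompact_Icc.exists_bound_of_continuousOn hd
  have hK0 : 0 ≤ K := (norm_nonneg _).trans (hK 0 ⟨le_rfl, hT⟩)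
  have hsmall : ∀ᶠ s : ℝ in 𝓝 0, g s ∈ (lchart (EG := EG) G).source ∧
      ‖lchart (EG := EG) G (g s) - lone G‖ ≤ C * (K * T) ^ 2 * ‖s‖ ^ 2 := by
    have hev : ∀ᶠ s : ℝ in 𝓝 0, ‖s‖ * K * T < δ := by
      have : Tendsto (fun s : ℝ => ‖s‖ * K * T) (𝓝 0) (𝓝 (‖(0 : ℝ)‖ * K * T)) :=
        (Continuous.tendsto (by fun_prop) _)
      rw [norm_zero, zero_mul, zero_mul] at this
      exact this.eventually_lt_const hδ
    filter_upwards [hev] with s hs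
    obtain ⟨h1, -, -, h2⟩ := hest T (‖s‖ * K) (fun t => s • d t) _ hT (by positivity) (hd.const_smul s)
      (fun t ht => by
        rw [norm_smul]; exact mul_le_mul_of_nonneg_left (hK t ht) (norm_nonneg _)) hs.le (hW s) T
      ⟨hT, le_rfl⟩
    refine ⟨h1, ?_⟩
    rw [intervalIntegral.integral_smul, hint, smul_zero, add_zero] at h2
    refine h2.trans (le_of_eq ?_)
    ring
  -- With vanishing integral, the first-order estimate leaves only an error of order `s²`.
  have hder0 : HasFDerivAt (fun s => lchart (EG := EG) G (g s)) (0 : ℝ →L[ℝ] EG) 0 := by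
    rw [hasFDerivAt_iff_isLittleO_nhds_zero]
    have hO : (fun h : ℝ => lchart (EG := EG) G (g (0 + h)) - lchart (EG := EG) G (g 0)
        - (0 : ℝ →L[ℝ] EG) h) =O[𝓝 0] fun h : ℝ => ‖h‖ ^ 2 := by
      refine Asymptotics.IsBigO.of_bound (C * (K * T) ^ 2) ?_
      filter_upwards [hsmall] with s hs
      simpa [hg0, lone] using hs.2
    refine hO.trans_isLittleO ?_
    have := Asymptotics.isLittleO_pow_id (𝕜 := ℝ) (n := 2) (by norm_num)
    simpa using this
  have hcont0 : ContinuousAt g 0 := by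
    have h1 : Tendsto (fun s => (lchart (EG := EG) G).symm (lchart (EG := EG) G (g s))) (𝓝 0)
        (𝓝 (g 0)) := by
      have h2 := (continuousAt_lchart_symm (EG := EG) (G := G) lone_mem_target).tendsto
      rw [lchart_symm_lone] at h2
      have h3 := hder0.continuousAt.tendsto
      rw [hg0] at h3 ⊢
      exact h2.comp h3
    refine h1.congr' ?_
    filter_upwards [hsmall] with s hs
    exact (lchart (EG := EG) G).left_inv hs.1
  have hl0 : HasLogDeriv g (0 : ℝ →L[ℝ] EG) univ 0 :=
    HasLogDeriv.of_lchart_one hg0 hcont0.continuousWithinAt hder0.hasFDerivWithinAt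
  -- The derivative at `0` is transported to `s` by `g t = g s * g (t - s)`.
  have hl : ∀ s ∈ univ, HasLogDeriv g (0 : ℝ →L[ℝ] EG) univ s := by
    intro s _
    have h1 : HasFDerivWithinAt (fun t : ℝ => t - s) (.id ℝ ℝ) univ s :=
      (hasFDerivWithinAt_id s _).sub_const s
    have h2 := (HasLogDeriv.comp (φ := fun t : ℝ => t - s) (by simpa using hl0) h1
      (mapsTo_univ _ _)).const_mul (g s)
    refine (h2.congr (fun t _ => ?_) ?_).congr_deriv (by simp)
    · rw [← hadd]; simp
    · rw [← hadd]; simp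
  have h1 := HasLogDeriv.eq_of_zero convex_univ hl (mem_univ 0) (mem_univ 1)
  have h2 := hV.eqOn ((hW 1).congr fun t _ => by simp) ⟨hT, le_rfl⟩
  rw [h2]
  exact h1.symm.trans hg0

/-- If `W` solves the equation with coefficient `b - a`, then `U W` solves the one with coefficient
`b`, so it is `V`. As `b - a` has integral zero, `W T = 1`. -/
theorem IsTransport.eq_of_integral_eq {T : ℝ} (hT : 0 ≤ T) {a b : ℝ → EG} {U V : ℝ → G}
    (ha : ContinuousOn a (Icc 0 T)) (hb : ContinuousOn b (Icc 0 T))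
    (haa : ∀ s ∈ Icc 0 T, ∀ t ∈ Icc 0 T, bracketL G (a s) (a t) = 0)
    (hab : ∀ s ∈ Icc 0 T, ∀ t ∈ Icc 0 T, bracketL G (a s) (b t) = 0)
    (hbb : ∀ s ∈ Icc 0 T, ∀ t ∈ Icc 0 T, bracketL G (b s) (b t) = 0)
    (hint : ∫ t in (0)..T, a t = ∫ t in (0)..T, b t) (hU : IsTransport T a U)
    (hV : IsTransport T b V) : U T = V T := by
  have hba : ∀ s ∈ Icc 0 T, ∀ t ∈ Icc 0 T, bracketL G (b s) (a t) = 0 := fun s hs t ht => by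
    rw [bracketL_antisymm, hab t ht s hs, neg_zero]
  have hd : ContinuousOn (fun t => b t - a t) (Icc 0 T) := hb.sub ha
  obtain ⟨W, hW⟩ := exists_isTransport G hT hd
  have hW1 := hW.eq_one_of_integral_eq_zero hT hd
    (fun s hs t ht => by simp [haa s hs t ht, hab s hs t ht, hba s hs t ht, hbb s hs t ht]) (by
      rw [intervalIntegral.integral_sub, hint, sub_self]
      · exact ContinuousOn.intervalIntegrable (by rwa [uIcc_of_le hT])
      · exact ContinuousOn.intervalIntegrable (by rwa [uIcc_of_le hT]))
  have h1 := hU.mul hW (fun s hs t ht => by simp [haa s hs t ht, hab s hs t ht])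
  have h2 := hV.eqOn (h1.congr fun t _ => by simp) ⟨hT, le_rfl⟩
  rw [h2, hW1, mul_one]

/-- Two families of transport equations with the same holonomy and the same integral agree to
second order. -/
theorem integral_lieQ_eq_of_transport_eq {T : ℝ} (hT : 0 ≤ T) {α β : ℝ → ℝ → EG}
    (hα : Continuous (Function.uncurry α)) (hβ : Continuous (Function.uncurry β))
    (hint : ∀ ε, ∫ t in (0)..T, α ε t = ∫ t in (0)..T, β ε t)
    (hol : ∀ ε > 0, ∀ U V : ℝ → G, IsTransport T (fun t => ε • α ε t) U →
      IsTransport T (fun t => ε • β ε t) V → U T = V T) :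
    ∫ t in (0)..T, lieQ G (∫ s in (0)..t, α 0 s) (α 0 t) =
      ∫ t in (0)..T, lieQ G (∫ s in (0)..t, β 0 s) (β 0 t) := by
  have hcont : ∀ γ : ℝ → ℝ → EG, Continuous (Function.uncurry γ) →
      Continuous (fun ε => ∫ t in (0)..T, lieQ G (∫ s in (0)..t, γ ε s) (γ ε t)) := by
    intro γ hγ
    refine intervalIntegral.continuous_parametric_intervalIntegral_of_continuous' ?_ _ _
    have h1 : Continuous fun p : ℝ × ℝ => ∫ s in (0)..p.2, γ p.1 s :=
      intervalIntegral.continuous_parametric_intervalIntegral_of_continuous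
        (f := fun (p : ℝ × ℝ) s => γ p.1 s)
        (hγ.comp ((continuous_fst.comp continuous_fst).prodMk continuous_snd)) continuous_snd
    exact ((lieQ (EG := EG) G).continuous.comp h1).clm_apply hγ
  obtain ⟨K, hK⟩ : ∃ K, ∀ p ∈ Icc (0 : ℝ) 1 ×ˢ Icc 0 T, ‖α p.1 p.2‖ ≤ K ∧ ‖β p.1 p.2‖ ≤ K := by
    have hc : IsCompact (Icc (0 : ℝ) 1 ×ˢ Icc 0 T) := isCompact_Icc.prod isCompact_Icc
    obtain ⟨K1, h1⟩ := hc.exists_bound_of_continuousOn hα.continuousOn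
    obtain ⟨K2, h2⟩ := hc.exists_bound_of_continuousOn hβ.continuousOn
    exact ⟨max K1 K2, fun p hp => ⟨(h1 p hp).trans (le_max_left _ _),
      (h2 p hp).trans (le_max_right _ _)⟩⟩
  have hK0 : 0 ≤ K := (norm_nonneg _).trans (hK (0, 0) ⟨⟨le_rfl, zero_le_one⟩, le_rfl, hT⟩).1
  rw [← sub_eq_zero, ← norm_le_zero_iff]
  refine le_of_forall_pos_le_add fun η' hη' => ?_
  rw [zero_add]
  -- Each family contributes an error `η * (ε * K * T) ^ 2`. This `η` makes their sum at most `ε ^ 2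
  -- * η'`, after which `ε ^ 2` is divided out and `ε` tends to `0`.
  obtain ⟨η, hη, hηK⟩ : ∃ η > 0, 2 * η * (K * T) ^ 2 ≤ η' := by
    refine ⟨η' / (2 * ((K * T) ^ 2 + 1)), by positivity, ?_⟩
    have h1 : (0 : ℝ) < 2 * ((K * T) ^ 2 + 1) := by positivity
    rw [show 2 * (η' / (2 * ((K * T) ^ 2 + 1))) * (K * T) ^ 2 =
      (η' * (2 * (K * T) ^ 2)) / (2 * ((K * T) ^ 2 + 1)) by ring, div_le_iff₀ h1]
    nlinarith
  obtain ⟨δ, hδ, hest⟩ := exists_transport_estimate_second (EG := EG) G hη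
  have hev : ∀ᶠ ε : ℝ in 𝓝[>] 0, ε ∈ Ioc (0 : ℝ) 1 ∧ ε * K * T ≤ δ := by
    refine Filter.Eventually.and (Ioc_mem_nhdsGT zero_lt_one) ?_
    have : Tendsto (fun s : ℝ => s * K * T) (𝓝[>] 0) (𝓝 (0 * K * T)) :=
      (Continuous.tendsto (by fun_prop) _).mono_left nhdsWithin_le_nhds
    rw [zero_mul, zero_mul] at this
    exact (this.eventually_lt_const hδ).mono fun _ h => h.le
  have hlim : Tendsto (fun ε => ‖(∫ t in (0)..T, lieQ G (∫ s in (0)..t, α ε s) (α ε t)) -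
      ∫ t in (0)..T, lieQ G (∫ s in (0)..t, β ε s) (β ε t)‖) (𝓝[>] 0) (𝓝 _) :=
    (((hcont α hα).sub (hcont β hβ)).norm.tendsto 0).mono_left nhdsWithin_le_nhds
  refine le_of_tendsto hlim ?_
  filter_upwards [hev] with ε hε
  have hεpos := hε.1.1
  have main : ∀ γ : ℝ → ℝ → EG, Continuous (Function.uncurry γ) →
      (∀ t ∈ Icc 0 T, ‖γ ε t‖ ≤ K) → ∃ U : ℝ → G, IsTransport T (fun t => ε • γ ε t) U ∧
        ‖lchart (EG := EG) G (U T) - lone G + ε • (∫ t in (0)..T, γ ε t)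
          - ε ^ 2 • ∫ t in (0)..T, lieQ G (∫ s in (0)..t, γ ε s) (γ ε t)‖ ≤
            η * (ε * K * T) ^ 2 := by
    intro γ hγ hγK
    have hc : Continuous (fun t => ε • γ ε t) :=
      (hγ.comp (continuous_const.prodMk continuous_id)).const_smul ε
    obtain ⟨U, hU⟩ := exists_isTransport G hT hc.continuousOn
    have h1 := (hest T (ε * K) _ U hT (by positivity) hc (fun t ht => by
      rw [norm_smul, Real.norm_of_nonneg hεpos.le]
      exact mul_le_mul_of_nonneg_left (hγK t ht) hεpos.le) hε.2 hU).2
    refine ⟨U, hU, ?_⟩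
    simp only [intervalIntegral.integral_smul, map_smul, smul_apply, smul_smul] at h1
    rwa [← pow_two] at h1
  obtain ⟨U, hU, h1⟩ := main α hα fun t ht => (hK (ε, t) ⟨⟨hεpos.le, hε.1.2⟩, ht⟩).1
  obtain ⟨V, hV, h2⟩ := main β hβ fun t ht => (hK (ε, t) ⟨⟨hεpos.le, hε.1.2⟩, ht⟩).2
  -- Equal end points and equal first-order terms cancel in the difference of the two expansions,
  -- which leaves `ε ^ 2` times the difference of the quadratic terms.
  rw [hol ε hεpos U V hU hV, hint ε] at h1
  have h3 := norm_sub_le_of_le h2 h1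
  rw [sub_sub_sub_cancel_left, ← smul_sub, norm_smul, Real.norm_of_nonneg (by positivity)] at h3
  have h4 : ε ^ 2 * ‖(∫ t in (0)..T, lieQ G (∫ s in (0)..t, α ε s) (α ε t)) -
      ∫ t in (0)..T, lieQ G (∫ s in (0)..t, β ε s) (β ε t)‖ ≤ ε ^ 2 * η' := by
    refine h3.trans ?_
    calc _ = ε ^ 2 * (2 * η * (K * T) ^ 2) := by ring
      _ ≤ _ := mul_le_mul_of_nonneg_left hηK (by positivity)
  exact le_of_mul_le_mul_left h4 (by positivity)

end TransportConsequences

/-! ### Derivatives of maps from normed spaces to manifolds, and the action on the bundle. -/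

section ManifoldDerivative

variable {X : Type*} [NormedAddCommGroup X] [NormedSpace ℝ X]
  {Y : Type*} [NormedAddCommGroup Y] [NormedSpace ℝ Y]
  {E : Type*} [NormedAddCommGroup E] [NormedSpace ℝ E]
  {E' : Type*} [NormedAddCommGroup E'] [NormedSpace ℝ E']
  {M : Type*} [TopologicalSpace M] [ChartedSpace E M]
  {M' : Type*} [TopologicalSpace M'] [ChartedSpace E' M']

/-- `f` has derivative `L` at `x` within `S`, for a map from a normed space to a manifold, with the
tangent spaces identified with the model space. -/
def HasMDer (f : X → M) (L : X →L[ℝ] E) (S : Set X) (x : X) : Prop :=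
  HasMFDerivWithinAt 𝓘(ℝ, X) 𝓘(ℝ, E) f S x L

theorem HasMDer.comp_map {f : X → M} {L : X →L[ℝ] E} {S : Set X} {x : X} (hf : HasMDer f L S x)
    {F : M → M'} (hF : MDifferentiableAt 𝓘(ℝ, E) 𝓘(ℝ, E') F (f x)) :
    HasMDer (fun y => F (f y)) ((mder F (f x) : E →L[ℝ] E').comp L) S x :=
  HasMFDerivAt.comp_hasMFDerivWithinAt x hF.hasMFDerivAt hf

theorem HasMDer.unique {f : X → M} {L L' : X →L[ℝ] E} {S : Set X} {x : X} (hf : HasMDer f L S x)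
    (hf' : HasMDer f L' S x) (hS : UniqueDiffWithinAt ℝ S x) : L = L' :=
  hS.uniqueMDiffWithinAt.eq hf hf'

theorem HasMDer.congr {f g : X → M} {L : X →L[ℝ] E} {S : Set X} {x : X} (hf : HasMDer f L S x)
    (h : ∀ y ∈ S, g y = f y) (hx : g x = f x) : HasMDer g L S x :=
  HasMFDerivWithinAt.congr_mono hf h hx subset_rfl

theorem HasMDer.congr_of_eventuallyEq {f g : X → M} {L : X →L[ℝ] E} {S : Set X} {x : X}
    (hf : HasMDer f L S x) (h : g =ᶠ[𝓝[S] x] f) (hx : g x = f x) : HasMDer g L S x :=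
  HasMFDerivWithinAt.congr_of_eventuallyEq hf h hx

theorem hasMDer_of_mdifferentiableAt {f : X → M} {x : X} {S : Set X}
    (hf : MDifferentiableAt 𝓘(ℝ, X) 𝓘(ℝ, E) f x) : HasMDer f (mder f x : X →L[ℝ] E) S x :=
  hf.hasMFDerivAt.hasMFDerivWithinAt

theorem hasMDer_univ_iff {f : X → M} {x : X} {L : X →L[ℝ] E} :
    HasMDer f L univ x ↔ MDifferentiableAt 𝓘(ℝ, X) 𝓘(ℝ, E) f x ∧ mder f x = L := by
  constructor
  · intro h
    have h' := hasMFDerivWithinAt_univ.1 h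
    exact ⟨h'.mdifferentiableAt, h'.mfderiv⟩
  · rintro ⟨h, rfl⟩
    exact hasMDer_of_mdifferentiableAt h

end ManifoldDerivative

section BundleCalculus

variable {E : Type*} [NormedAddCommGroup E] [NormedSpace ℝ E]
  {EG : Type*} [NormedAddCommGroup EG] [NormedSpace ℝ EG] [CompleteSpace EG]
  {EP : Type*} [NormedAddCommGroup EP] [NormedSpace ℝ EP]
  {M : Type*} [TopologicalSpace M] [ChartedSpace E M] [IsManifold 𝓘(ℝ, E) ∞ M]
  {G : Type*} [TopologicalSpace G] [ChartedSpace EG G] [Group G] [LieGroup 𝓘(ℝ, EG) ∞ G]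
  {P : Type*} [TopologicalSpace P] [ChartedSpace EP P] [IsManifold 𝓘(ℝ, EP) ∞ P]
  {X : Type*} [NormedAddCommGroup X] [NormedSpace ℝ X]
  {π : PrincipalBundle E EG EP M G P}

/-- The connection form with values in the model spaces. -/
def PrincipalConnection.conn (A : PrincipalConnection π) (p : P) : EP →L[ℝ] EG := A.form p

theorem PrincipalBundle.mdifferentiable_act (π : PrincipalBundle E EG EP M G P) :
    MDifferentiable (𝓘(ℝ, EP).prod 𝓘(ℝ, EG)) 𝓘(ℝ, EP) (fun z : P × G => π.act z.1 z.2) :=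
  π.smooth_act.mdifferentiable (by simp)

theorem PrincipalBundle.contMDiff_act_right (π : PrincipalBundle E EG EP M G P) (g : G) :
    ContMDiff 𝓘(ℝ, EP) 𝓘(ℝ, EP) ∞ (fun p : P => π.act p g) :=
  π.smooth_act.comp (contMDiff_id.prodMk contMDiff_const)

theorem PrincipalBundle.mfderiv_act_one (π : PrincipalBundle E EG EP M G P) (p : P) {k : G}
    (hk : k = 1) (u : EP) (w : EG) :
    (mfderiv (𝓘(ℝ, EP).prod 𝓘(ℝ, EG)) 𝓘(ℝ, EP) (fun z : P × G => π.act z.1 z.2) (p, k)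
      ((u, w) : EP × EG) : EP) = u + (mder (fun g : G => π.act p g) 1 : EG →L[ℝ] EP) w := by
  subst hk
  have h := mfderiv_prod_eq_add_apply (v := ((u, w) : EP × EG)) (π.mdifferentiable_act (p, 1))
  refine h.trans ?_
  have h1 : (fun z : P => π.act z 1) = id := by ext z; exact π.act_one z
  congr 1
  change (mder (fun z : P => π.act z 1) p : EP →L[ℝ] EP) u = u
  rw [h1]
  exact DFunLike.congr_fun (mfderiv_id (I := 𝓘(ℝ, EP))) u

theorem PrincipalConnection.conn_vertical (A : PrincipalConnection π) (p : P) (w : EG) :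
    A.conn p ((mder (fun g : G => π.act p g) 1 : EG →L[ℝ] EP) w) = w := A.vertical p w

theorem PrincipalConnection.conn_act (A : PrincipalConnection π) (p : P) (g : G) (v : EP) :
    A.conn (π.act p g) ((mder (fun q : P => π.act q g) p : EP →L[ℝ] EP) v) =
      AdL g⁻¹ (A.conn p v) := A.equivariant p g v

/-- The gauge transformation law. It shows that `p g` is horizontal exactly when the logarithmic
derivative of `g` is minus the pullback of the connection form. -/
theorem PrincipalConnection.hasMDer_act (A : PrincipalConnection π) {p : X → P} {g : X → G}
    {p' : X →L[ℝ] EP} {L : X →L[ℝ] EG} {S : Set X} {x : X} (hp : HasMDer p p' S x)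
    (hg : HasLogDeriv g L S x) :
    ∃ D : X →L[ℝ] EP, HasMDer (fun y => π.act (p y) (g y)) D S x ∧
      ∀ v, A.conn (π.act (p x) (g x)) (D v) =
        AdL (g x)⁻¹ (A.conn (p x) (p' v) + L v) := by
  -- The group factor is first moved to the identity, where the derivative of the action has a
  -- horizontal and a vertical term; the constant `g x` is restored by equivariance.
  have h1 := (hg.mul_const (g x)⁻¹).hasMFDerivWithinAt
  have hid : ∀ k : G, k = 1 → (mder (fun h : G => h * k) 1 : EG →L[ℝ] EG) = .id ℝ EG := by
    rintro k rfl
    have : (fun h : G => h * 1) = id := by ext; simp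
    rw [this]
    exact mfderiv_id
  rw [hid _ (mul_inv_cancel _)] at h1
  have h2 := HasMFDerivWithinAt.prodMk hp h1
  have h3 := HasMFDerivAt.comp_hasMFDerivWithinAt x
    (π.mdifferentiable_act (p x, g x * (g x)⁻¹)).hasMFDerivAt h2
  obtain ⟨D0, hD0, hD0v⟩ : ∃ D0 : X →L[ℝ] EP,
      HasMDer (fun y => π.act (p y) (g y * (g x)⁻¹)) D0 S x ∧
      ∀ v, D0 v = p' v + (mder (fun k : G => π.act (p x) k) 1 : EG →L[ℝ] EP) (L v) :=
    ⟨_, h3, fun v => π.mfderiv_act_one (p x) (mul_inv_cancel (g x)) (p' v) (L v)⟩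
  have hx : π.act (p x) (g x * (g x)⁻¹) = p x := by rw [mul_inv_cancel, π.act_one]
  have h4 := hD0.comp_map (F := fun q : P => π.act q (g x))
    ((π.contMDiff_act_right (g x)).mdifferentiable (by simp) _)
  rw [hx] at h4
  refine ⟨_, h4.congr (fun y _ => ?_) ?_, fun v => ?_⟩
  · rw [← π.act_mul]; simp
  · rw [← π.act_mul]; simp
  · rw [ContinuousLinearMap.comp_apply, A.conn_act, hD0v, map_add, A.conn_vertical]

end BundleCalculus

/-! ### A flat connection form is locally a pure gauge. -/

section RadialGauge

variable {EG : Type*} [NormedAddCommGroup EG] [NormedSpace ℝ EG] [CompleteSpace EG]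
  {G : Type*} [TopologicalSpace G] [ChartedSpace EG G] [Group G] [LieGroup 𝓘(ℝ, EG) ∞ G]
  {E : Type*} [NormedAddCommGroup E] [NormedSpace ℝ E]

/-- Variation of constants: compares the solutions of two equations without commutation assumptions.
-/
theorem IsTransport.inv_mul {T : ℝ} {a b : ℝ → EG} {U V : ℝ → G} (hU : IsTransport T a U)
    (hV : IsTransport T b V) :
    IsTransport T (fun t => AdL (U t)⁻¹ (b t - a t)) (fun t => (U t)⁻¹ * V t) := by
  refine ⟨by simp [hU.1, hV.1], fun t ht => ((hU.2 t ht).inv.mul (hV.2 t ht)).congr_deriv ?_⟩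
  ext
  simp
  abel

theorem IsTransport.continuousOn_AdL_inv {T : ℝ} {a : ℝ → EG} {U : ℝ → G}
    (hU : IsTransport T a U) : ContinuousOn (fun t => (AdL (U t)⁻¹ : EG →L[ℝ] EG)) (Icc 0 T) :=
  fun t ht => (hU.2 t ht).hasFDerivWithinAt_AdL_inv.continuousWithinAt

theorem HasLogDeriv.of_lchart_one_of_eventually {f : E → G} {L : E →L[ℝ] EG} {x : E} (hx : f x = 1)
    (hs : ∀ᶠ y in 𝓝 x, f y ∈ (lchart (EG := EG) G).source)
    (hf : HasFDerivAt (fun y => lchart (EG := EG) G (f y)) L x) :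
    HasLogDeriv f L univ x := by
  refine HasLogDeriv.of_lchart_one hx ?_ hf.hasFDerivWithinAt
  rw [continuousWithinAt_univ]
  have h1 : Tendsto (fun s => (lchart (EG := EG) G).symm (lchart (EG := EG) G (f s))) (𝓝 x)
      (𝓝 (f x)) := by
    have h2 := (continuousAt_lchart_symm (EG := EG) (G := G) lone_mem_target).tendsto
    rw [lchart_symm_lone] at h2
    have h3 := hf.continuousAt.tendsto
    rw [hx] at h3 ⊢
    exact h2.comp h3
  refine h1.congr' ?_
  filter_upwards [hs] with s hs
  exact (lchart (EG := EG) G).left_inv hs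

theorem eventually_norm_lt_of_continuousAt {X F : Type*} [TopologicalSpace X]
    [SeminormedAddCommGroup F] {f : X → F} {x : X} (hf : ContinuousAt f x) :
    ∀ᶠ z in 𝓝 x, ‖f z‖ < ‖f x‖ + 1 :=
  hf.norm.eventually_lt continuousAt_const (lt_add_one _)

/-- Local bounds for a smooth one-form and its derivative. -/
theorem exists_oneForm_bounds {θ : E → E →L[ℝ] EG} {y₀ : E} {r : ℝ} (hr : 0 < r)
    (hθ : ContDiffOn ℝ ∞ θ (Metric.ball y₀ r)) :
    ∃ ρ > 0, ρ ≤ r ∧ ∃ K : ℝ, 0 ≤ K ∧ (∀ z ∈ Metric.ball y₀ ρ, ‖θ z‖ ≤ K) ∧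
      (∀ z ∈ Metric.ball y₀ ρ, ‖fderiv ℝ θ z‖ ≤ K) ∧
      ∀ z ∈ Metric.ball y₀ ρ, ∀ z' ∈ Metric.ball y₀ ρ,
        ‖θ z' - θ z - fderiv ℝ θ z (z' - z)‖ ≤ K * ‖z' - z‖ ^ 2 := by
  have h0 : ContDiffAt ℝ ∞ θ y₀ := hθ.contDiffAt (Metric.ball_mem_nhds _ hr)
  have h1 : ContDiffAt ℝ ∞ (fderiv ℝ θ) y₀ := h0.fderiv_right (m := ∞) le_rfl
  obtain ⟨C, t, ht, hC⟩ := (h1.of_le (m := 1) (by simp)).exists_lipschitzOnWith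
  have e0 : ∀ᶠ z in 𝓝 y₀, ‖θ z‖ < ‖θ y₀‖ + 1 :=
    eventually_norm_lt_of_continuousAt h0.continuousAt
  have e1 : ∀ᶠ z in 𝓝 y₀, ‖fderiv ℝ θ z‖ < ‖fderiv ℝ θ y₀‖ + 1 :=
    eventually_norm_lt_of_continuousAt h1.continuousAt
  obtain ⟨ρ, hρ, hb⟩ := Metric.mem_nhds_iff.1 (Filter.inter_mem (Filter.inter_mem ht
    (Metric.ball_mem_nhds y₀ hr)) (Filter.inter_mem e0 e1))
  set ρ' := min ρ r
  have hsub : Metric.ball y₀ ρ' ⊆ Metric.ball y₀ ρ := Metric.ball_subset_ball (min_le_left _ _)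
  refine ⟨ρ', lt_min hρ hr, min_le_right _ _, max (max (‖θ y₀‖ + 1) (‖fderiv ℝ θ y₀‖ + 1)) C,
    C.2.trans (le_max_right _ _), fun z hz => ?_, fun z hz => ?_, fun z hz z' hz' => ?_⟩
  · exact (hb (hsub hz)).2.1.le.trans ((le_max_left _ _).trans (le_max_left _ _))
  · exact (hb (hsub hz)).2.2.le.trans ((le_max_right _ _).trans (le_max_left _ _))
  · have hseg : segment ℝ z z' ⊆ Metric.ball y₀ ρ :=
      ((convex_ball y₀ ρ').segment_subset hz hz').trans hsub
    have := (convex_segment z z').norm_image_sub_le_of_norm_hasFDerivWithin_le' (f := θ)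
      (f' := fderiv ℝ θ) (C := C * ‖z' - z‖) (φ := fderiv ℝ θ z)
      (fun x hx => ((hθ.contDiffAt (Metric.isOpen_ball.mem_nhds (hb (hseg hx)).1.2)).differentiableAt
        (by simp)).hasFDerivAt.hasFDerivWithinAt)
      (fun x hx => by
        refine (hC.norm_sub_le (hb (hseg hx)).1.1 (hb (hsub hz)).1.1).trans
          (mul_le_mul_of_nonneg_left ?_ C.2)
        obtain ⟨s, hs, rfl⟩ := (segment_eq_image' ℝ z z') ▸ hx
        rw [add_sub_cancel_left, norm_smul, Real.norm_of_nonneg hs.1]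
        exact mul_le_of_le_one_left (norm_nonneg _) hs.2)
      (left_mem_segment _ _ _) (right_mem_segment _ _ _)
    refine this.trans ?_
    rw [mul_assoc, ← pow_two]
    exact mul_le_mul_of_nonneg_right (le_max_right _ _) (by positivity)

/-- A flat Lie-algebra-valued one-form on a ball is a pure gauge near the centre. -/
theorem exists_gauge (G : Type*) [TopologicalSpace G] [ChartedSpace EG G] [Group G]
    [LieGroup 𝓘(ℝ, EG) ∞ G] {θ : E → E →L[ℝ] EG} {y₀ : E} {r : ℝ} (hr : 0 < r)
    (hθ : ContDiffOn ℝ ∞ θ (Metric.ball y₀ r))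
    (hflat : ∀ y ∈ Metric.ball y₀ r, ∀ u v, fderiv ℝ θ y u v - fderiv ℝ θ y v u
      + bracketL G (θ y u) (θ y v) = 0) :
    ∃ ρ > 0, ρ ≤ r ∧ ∃ g : E → G, ∀ y ∈ Metric.ball y₀ ρ, HasLogDeriv g (-(θ y)) univ y := by
  obtain ⟨ρ, hρ, hρr, K, hK, hK0, hK1, hK2⟩ := exists_oneForm_bounds hr hθ
  refine ⟨ρ, hρ, hρr, ?_⟩
  have hdiff : ∀ z ∈ Metric.ball y₀ ρ, ContDiffAt ℝ ∞ θ z := fun z hz =>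
    hθ.contDiffAt (Metric.isOpen_ball.mem_nhds (Metric.ball_subset_ball hρr hz))
  -- The gauge is obtained by transport along the rays from `y₀`: `a w` is the connection form along
  -- the ray in the direction `w`, and the gauge at `y₀ + w` is the end value of the solution.
  set a : E → ℝ → EG := fun w t => θ (y₀ + t • w) w with ha
  have hmem : ∀ w : E, ‖w‖ < ρ → ∀ t ∈ Icc (0 : ℝ) 1, y₀ + t • w ∈ Metric.ball y₀ ρ := by
    intro w hw t ht
    rw [Metric.mem_ball, dist_eq_norm, add_sub_cancel_left, norm_smul, Real.norm_of_nonneg ht.1]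
    exact (mul_le_of_le_one_left (norm_nonneg _) ht.2).trans_lt hw
  have hpath : ∀ (w : E) (t : ℝ), HasDerivAt (fun t : ℝ => y₀ + t • w) w t := fun w t => by
    simpa using ((hasDerivAt_id t).smul_const w).const_add y₀
  have hθt : ∀ w : E, ‖w‖ < ρ → ∀ t ∈ Icc (0 : ℝ) 1,
      HasDerivAt (fun t : ℝ => θ (y₀ + t • w)) (fderiv ℝ θ (y₀ + t • w) w) t := fun w hw t ht =>
    HasFDerivAt.comp_hasDerivAt t
      ((hdiff _ (hmem w hw t ht)).differentiableAt (by simp)).hasFDerivAt (hpath w t)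
  have hac : ∀ w : E, ‖w‖ < ρ → ContinuousOn (a w) (Icc 0 1) := fun w hw t ht =>
    ((hθt w hw t ht).continuousAt.clm_apply continuousAt_const).continuousWithinAt
  have hex : ∀ w : E, ∃ U : ℝ → G, ‖w‖ < ρ → IsTransport 1 (a w) U := fun w => by
    by_cases hw : ‖w‖ < ρ
    · obtain ⟨U, hU⟩ := exists_isTransport G zero_le_one (hac w hw)
      exact ⟨U, fun _ => hU⟩
    · exact ⟨fun _ => 1, fun h => absurd h hw⟩
  choose U hU using hex
  refine ⟨fun y => U (y - y₀) 1, fun y hy => ?_⟩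
  set w : E := y - y₀ with hwdef
  have hw : ‖w‖ < ρ := by simpa [hwdef, dist_eq_norm] using hy
  have hyw : y₀ + (1 : ℝ) • w = y := by simp [hwdef]
  obtain ⟨c, hc⟩ := isCompact_Icc.exists_bound_of_continuousOn (hU w hw).continuousOn_AdL_inv
  have hc0 : 0 ≤ c := (norm_nonneg _).trans (hc 0 ⟨le_rfl, zero_le_one⟩)
  -- the variation of the coefficient
  set δ : E → ℝ → EG := fun v t =>
    fderiv ℝ θ (y₀ + t • w) (t • v) w + θ (y₀ + t • w) v with hδ
  have hδint : ∀ v, ∫ t in (0 : ℝ)..1, AdL (U w t)⁻¹ (δ v t) = AdL (U w 1)⁻¹ (θ y v) ∧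
      IntervalIntegrable (fun t => AdL (U w t)⁻¹ (δ v t)) volume 0 1 := by
    intro v
    have hfc : ContinuousOn (fun t : ℝ => fderiv ℝ θ (y₀ + t • w)) (Icc 0 1) := fun t ht =>
      (ContinuousAt.comp (f := fun t : ℝ => y₀ + t • w)
        ((hdiff _ (hmem w hw t ht)).fderiv_right (m := ∞) le_rfl).continuousAt
        (hpath w t).continuousAt).continuousWithinAt
    have hθc : ContinuousOn (fun t : ℝ => θ (y₀ + t • w)) (Icc 0 1) := fun t ht =>
      (hθt w hw t ht).continuousAt.continuousWithinAt
    have hcont : ContinuousOn (fun t => AdL (U w t)⁻¹ (δ v t)) (Icc 0 1) := by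
      refine (hU w hw).continuousOn_AdL_inv.clm_apply (ContinuousOn.add ?_ ?_)
      · exact (hfc.clm_apply (by fun_prop)).clm_apply continuousOn_const
      · exact hθc.clm_apply continuousOn_const
    have hii : IntervalIntegrable (fun t => AdL (U w t)⁻¹ (δ v t)) volume 0 1 :=
      ContinuousOn.intervalIntegrable (by rwa [uIcc_of_le zero_le_one])
    refine ⟨?_, hii⟩
    -- The only use of flatness: it trades the derivative in the direction `t • v` for the one along
    -- the ray plus a bracket. The transported variation then becomes a total derivative and
    -- integrates to its end value.
    have hderiv : ∀ t ∈ Icc (0 : ℝ) 1, HasDerivWithinAt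
        (fun t => AdL (U w t)⁻¹ (θ (y₀ + t • w) (t • v))) (AdL (U w t)⁻¹ (δ v t)) (Icc 0 1) t := by
      intro t ht
      have h1 := ((hU w hw).2 t ht).hasFDerivWithinAt_AdL_inv.hasDerivWithinAt
      have h2 := (hθt w hw t ht).clm_apply ((hasDerivAt_id t).smul_const v)
      have h3 := h1.clm_apply h2.hasDerivWithinAt
      refine h3.congr_deriv ?_
      have hf := hflat _ (Metric.ball_subset_ball hρr (hmem w hw t ht)) (t • v) w
      have hf' : δ v t = fderiv ℝ θ (y₀ + t • w) w (t • v) + θ (y₀ + t • w) v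
          + bracketL G (a w t) (θ (y₀ + t • w) (t • v)) := by
        rw [bracketL_antisymm]
        simp only [hδ, ha]
        rw [sub_add_eq_add_sub, sub_eq_zero] at hf
        rw [← hf]
        abel
      rw [hf']
      simp
      abel
    rw [intervalIntegral.integral_eq_sub_of_hasDerivAt_of_le zero_le_one
      (fun t ht => (hderiv t ht).continuousWithinAt)
      (fun t ht => (hderiv t ⟨ht.1.le, ht.2.le⟩).hasDerivAt (Icc_mem_nhds ht.1 ht.2)) hii]
    simp only [one_smul, zero_smul, map_zero, sub_zero]
    rw [← hyw, one_smul]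
  obtain ⟨η, hη, C, hC, hest⟩ := exists_transport_estimate (EG := EG) G
  -- bounds for small variations
  have hvar : ∀ v : E, ‖w + v‖ < ρ → ∀ t ∈ Icc (0 : ℝ) 1,
      ‖a (w + v) t - a w t‖ ≤ (K * ρ + K) * ‖v‖ + (K * ρ + K) * ‖v‖ ^ 2 ∧
      ‖a (w + v) t - a w t - δ v t‖ ≤ (K * ρ + K) * ‖v‖ ^ 2 := by
    intro v hv t ht
    have m1 := hmem w hw t ht
    have m2 := hmem (w + v) hv t ht
    have htv : y₀ + t • (w + v) - (y₀ + t • w) = t • v := by rw [smul_add]; abel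
    have htn : ‖t • v‖ ≤ ‖v‖ := by
      rw [norm_smul, Real.norm_of_nonneg ht.1]
      exact mul_le_of_le_one_left (norm_nonneg _) ht.2
    have t1 := hK2 _ m1 _ m2
    rw [htv] at t1
    have t1' : ‖θ (y₀ + t • (w + v)) - θ (y₀ + t • w) - fderiv ℝ θ (y₀ + t • w) (t • v)‖ ≤
        K * ‖v‖ ^ 2 := t1.trans (by gcongr)
    have t2 : ‖fderiv ℝ θ (y₀ + t • w) (t • v)‖ ≤ K * ‖v‖ :=
      (ContinuousLinearMap.le_opNorm _ _).trans (by gcongr; exact hK1 _ m1)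
    have s2 : ‖a (w + v) t - a w t - δ v t‖ ≤ (K * ρ + K) * ‖v‖ ^ 2 := by
      have : a (w + v) t - a w t - δ v t =
          (θ (y₀ + t • (w + v)) - θ (y₀ + t • w) - fderiv ℝ θ (y₀ + t • w) (t • v)) (w + v)
          + fderiv ℝ θ (y₀ + t • w) (t • v) v := by
        simp only [ha, hδ, sub_apply, map_add]; abel
      rw [this]
      have b1 := (ContinuousLinearMap.le_opNorm
        (θ (y₀ + t • (w + v)) - θ (y₀ + t • w) - fderiv ℝ θ (y₀ + t • w) (t • v)) (w + v)).trans
        (mul_le_mul t1' hv.le (norm_nonneg _) (by positivity))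
      have b2 := (ContinuousLinearMap.le_opNorm (fderiv ℝ θ (y₀ + t • w) (t • v)) v).trans
        (mul_le_mul_of_nonneg_right t2 (norm_nonneg _))
      refine (norm_add_le _ _).trans ((add_le_add b1 b2).trans (le_of_eq (by ring)))
    refine ⟨?_, s2⟩
    have s1 : ‖δ v t‖ ≤ (K * ρ + K) * ‖v‖ := by
      have b1 := (ContinuousLinearMap.le_opNorm (fderiv ℝ θ (y₀ + t • w) (t • v)) w).trans
        (mul_le_mul t2 hw.le (norm_nonneg _) (by positivity))
      have b2 := (ContinuousLinearMap.le_opNorm (θ (y₀ + t • w)) v).trans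
        (mul_le_mul_of_nonneg_right (hK0 _ m1) (norm_nonneg _))
      refine (norm_add_le _ _).trans ((add_le_add b1 b2).trans (le_of_eq (by ring)))
    have := norm_add_le (δ v t) (a (w + v) t - a w t - δ v t)
    rw [add_sub_cancel] at this
    linarith
  set L : ℝ := 2 * (c * (K * ρ + K)) with hL
  have hL0 : 0 ≤ L := by positivity
  -- The quotient of the solutions along neighbouring rays solves the equation with coefficient
  -- `Ad(U⁻¹)(a (w + v) - a w)`. The first-order transport estimate and `hδint` determine it up to
  -- an error of order `‖v‖ ^ 2`.
  have hmain : ∀ᶠ v in 𝓝 (0 : E),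
      (U w 1)⁻¹ * U (w + v) 1 ∈ (lchart (EG := EG) G).source ∧
      ‖lchart (EG := EG) G ((U w 1)⁻¹ * U (w + v) 1) - lone G + AdL (U w 1)⁻¹ (θ y v)‖ ≤
        (C * L ^ 2 + L) * ‖v‖ ^ 2 := by
    have e1 : ∀ᶠ v in 𝓝 (0 : E), ‖w + v‖ < ρ := by
      have : Tendsto (fun v : E => ‖w + v‖) (𝓝 0) (𝓝 ‖w + 0‖) := Continuous.tendsto (by fun_prop) _
      rw [add_zero] at this
      exact this.eventually_lt_const hw
    have e2 : ∀ᶠ v in 𝓝 (0 : E), L * ‖v‖ < η ∧ ‖v‖ < 1 := by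
      have h1 : Tendsto (fun v : E => L * ‖v‖) (𝓝 0) (𝓝 (L * ‖(0 : E)‖)) :=
        Continuous.tendsto (by fun_prop) _
      have h2 : Tendsto (fun v : E => ‖v‖) (𝓝 0) (𝓝 ‖(0 : E)‖) := Continuous.tendsto (by fun_prop) _
      rw [norm_zero, mul_zero] at h1
      rw [norm_zero] at h2
      exact (h1.eventually_lt_const hη).and (h2.eventually_lt_const one_pos)
    filter_upwards [e1, e2] with v hv hv2
    have hW := (hU w hw).inv_mul (hU (w + v) hv)
    have hkc : ContinuousOn (fun t => AdL (U w t)⁻¹ (a (w + v) t - a w t)) (Icc 0 1) :=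
      (hU w hw).continuousOn_AdL_inv.clm_apply ((hac _ hv).sub (hac _ hw))
    obtain ⟨h1, -, -, h2⟩ := hest 1 (L * ‖v‖) _ _ zero_le_one (by positivity) hkc (fun t ht => by
      refine (ContinuousLinearMap.le_opNorm _ _).trans ?_
      have := mul_le_mul (hc t ht) (hvar v hv t ht).1 (norm_nonneg _) hc0
      refine this.trans ?_
      have h3 : ‖v‖ ^ 2 ≤ ‖v‖ := by nlinarith [norm_nonneg v, hv2.2]
      have h4 : (K * ρ + K) * ‖v‖ ^ 2 ≤ (K * ρ + K) * ‖v‖ :=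
        mul_le_mul_of_nonneg_left h3 (by positivity)
      calc _ ≤ c * ((K * ρ + K) * ‖v‖ + (K * ρ + K) * ‖v‖) := by gcongr
        _ = _ := by rw [hL]; ring) (by rw [mul_one]; exact hv2.1.le) hW 1 ⟨zero_le_one, le_rfl⟩
    refine ⟨h1, ?_⟩
    rw [mul_one] at h2
    have hki : IntervalIntegrable (fun t => AdL (U w t)⁻¹ (a (w + v) t - a w t)) volume 0 1 :=
      ContinuousOn.intervalIntegrable (by rwa [uIcc_of_le zero_le_one])
    have h3 : ‖(∫ t in (0 : ℝ)..1, AdL (U w t)⁻¹ (a (w + v) t - a w t)) - AdL (U w 1)⁻¹ (θ y v)‖ ≤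
        L * ‖v‖ ^ 2 := by
      rw [← (hδint v).1, ← intervalIntegral.integral_sub hki (hδint v).2]
      have := intervalIntegral.norm_integral_le_of_norm_le_const (a := (0 : ℝ)) (b := 1)
        (C := c * ((K * ρ + K) * ‖v‖ ^ 2))
        (f := fun t => AdL (U w t)⁻¹ (a (w + v) t - a w t) - AdL (U w t)⁻¹ (δ v t)) (fun t ht => by
          rw [uIoc_of_le zero_le_one] at ht
          have ht' : t ∈ Icc (0 : ℝ) 1 := ⟨ht.1.le, ht.2⟩
          rw [← map_sub]
          exact (ContinuousLinearMap.le_opNorm _ _).trans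
            (mul_le_mul (hc t ht') (hvar v hv t ht').2 (norm_nonneg _) hc0))
      refine this.trans ?_
      rw [sub_zero, abs_one, mul_one, hL]
      have : 0 ≤ c * (K * ρ + K) * ‖v‖ ^ 2 := by positivity
      linarith
    have h4 := norm_sub_le_of_le h2 h3
    rw [show ∀ x y z : EG, x + y - (y - z) = x + z by intros; abel] at h4
    refine h4.trans (le_of_eq (by ring))
  have hone : (U w 1)⁻¹ * U (w + 0) 1 = 1 := by simp
  have hlog0 : HasLogDeriv (fun v => (U w 1)⁻¹ * U (w + v) 1)
      (-((AdL (U w 1)⁻¹ : EG →L[ℝ] EG).comp (θ y))) univ 0 := by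
    refine HasLogDeriv.of_lchart_one_of_eventually hone (hmain.mono fun v hv => hv.1) ?_
    rw [hasFDerivAt_iff_isLittleO_nhds_zero]
    have hO : (fun h : E => lchart (EG := EG) G ((U w 1)⁻¹ * U (w + (0 + h)) 1) -
        lchart (EG := EG) G ((U w 1)⁻¹ * U (w + 0) 1)
        - (-((AdL (U w 1)⁻¹ : EG →L[ℝ] EG).comp (θ y))) h) =O[𝓝 0] fun h : E => ‖h‖ ^ 2 := by
      refine Asymptotics.IsBigO.of_bound (C * L ^ 2 + L) ?_
      filter_upwards [hmain] with v hv
      rw [hone, zero_add]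
      simpa [lone, sub_eq_add_neg] using hv.2
    exact hO.trans_isLittleO (Asymptotics.isLittleO_norm_pow_id one_lt_two)
  -- Left multiplication by `U w 1` returns from the quotient to the gauge itself; the resulting `Ad
  -- (U w 1)` cancels the `Ad (U w 1)⁻¹` in the derivative.
  have hlog1 := (HasLogDeriv.comp (φ := fun y' : E => y' - y) (φ' := .id ℝ E) (y := y) (T := univ)
    (by simpa using hlog0) ((hasFDerivAt_id y).sub_const y).hasFDerivWithinAt
    (mapsTo_univ _ _)).const_mul (U w 1)
  refine (hlog1.congr (fun y' _ => ?_) ?_).congr_deriv ?_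
  · rw [mul_inv_cancel_left, hwdef]; congr 2; abel
  · rw [mul_inv_cancel_left, hwdef]; congr 2; abel
  · ext v
    simp [AdL_apply_inv]

end RadialGauge

/-! ### Local horizontal sections of a flat connection. -/

section HorizontalSections

variable {E : Type*} [NormedAddCommGroup E] [NormedSpace ℝ E]
  {EG : Type*} [NormedAddCommGroup EG] [NormedSpace ℝ EG] [CompleteSpace EG]
  {EP : Type*} [NormedAddCommGroup EP] [NormedSpace ℝ EP]
  {M : Type*} [TopologicalSpace M] [ChartedSpace E M] [IsManifold 𝓘(ℝ, E) ∞ M]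
  {G : Type*} [TopologicalSpace G] [ChartedSpace EG G] [Group G] [LieGroup 𝓘(ℝ, EG) ∞ G]
  {P : Type*} [TopologicalSpace P] [ChartedSpace EP P] [IsManifold 𝓘(ℝ, EP) ∞ P]
  {X : Type*} [NormedAddCommGroup X] [NormedSpace ℝ X]
  {π : PrincipalBundle E EG EP M G P}

/-- The pullback of the connection form along a map from a normed space. -/
def PrincipalConnection.pullback (A : PrincipalConnection π) (S : X → P) (y : X) : X →L[ℝ] EG :=
  (A.conn (S y)).comp (mder S y : X →L[ℝ] EP)

theorem PrincipalConnection.oneFormInChart_eq (A : PrincipalConnection π) (p : P) (z : EP) :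
    oneFormInChart A.form p z = (A.conn ((extChartAt 𝓘(ℝ, EP) p).symm z)).comp
      (mder (extChartAt 𝓘(ℝ, EP) p).symm z : EP →L[ℝ] EP) := rfl

theorem PrincipalConnection.pullback_eventuallyEq (A : PrincipalConnection π) {S : X → P} {y : X}
    (hS : ∀ᶠ z in 𝓝 y, ContMDiffAt 𝓘(ℝ, X) 𝓘(ℝ, EP) ∞ S z) :
    A.pullback S =ᶠ[𝓝 y] fun z =>
      (oneFormInChart A.form (S y) (extChartAt 𝓘(ℝ, EP) (S y) (S z))).comp
        (fderiv ℝ (fun z => extChartAt 𝓘(ℝ, EP) (S y) (S z)) z) := by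
  have hc : ContinuousAt S y := hS.self_of_nhds.continuousAt
  have h1 := (hc.eventually ((isOpen_extChartAt_source (I := 𝓘(ℝ, EP)) (S y)).mem_nhds
    (mem_extChartAt_source (I := 𝓘(ℝ, EP)) (S y)))).eventually_nhds
  filter_upwards [h1, hS] with z hz hSz
  have hz0 := hz.self_of_nhds
  have hl := (extChartAt 𝓘(ℝ, EP) (S y)).left_inv hz0
  rw [A.oneFormInChart_eq, hl, PrincipalConnection.pullback, ContinuousLinearMap.comp_assoc]
  congr 1
  rw [← mfderiv_eq_fderiv]
  have hφ : MDifferentiableAt 𝓘(ℝ, EP) 𝓘(ℝ, EP) (extChartAt 𝓘(ℝ, EP) (S y)) (S z) :=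
    mdifferentiableAt_extChartAt (by rwa [← extChartAt_source 𝓘(ℝ, EP)])
  have hf : MDifferentiableAt 𝓘(ℝ, X) 𝓘(ℝ, EP) (fun z => extChartAt 𝓘(ℝ, EP) (S y) (S z)) z :=
    hφ.comp z (hSz.mdifferentiableAt (by simp))
  have hg : MDifferentiableAt 𝓘(ℝ, EP) 𝓘(ℝ, EP) (extChartAt 𝓘(ℝ, EP) (S y)).symm
      (extChartAt 𝓘(ℝ, EP) (S y) (S z)) :=
    ((contMDiffOn_extChartAt_symm (n := ∞) (S y)).contMDiffAt
      ((isOpen_extChartAt_target (S y)).mem_nhds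
        ((extChartAt 𝓘(ℝ, EP) (S y)).map_source hz0))).mdifferentiableAt (by simp)
  have h2 := mder_comp (f := fun z => extChartAt 𝓘(ℝ, EP) (S y) (S z)) (x := z) hg hf rfl
  refine Eq.trans ?_ h2
  exact Filter.EventuallyEq.mfderiv_eq (hz.mono fun w hw =>
    ((extChartAt 𝓘(ℝ, EP) (S y)).left_inv hw).symm)

theorem PrincipalConnection.contDiffAt_pullback (A : PrincipalConnection π) {S : X → P} {y : X}
    (hS : ∀ᶠ z in 𝓝 y, ContMDiffAt 𝓘(ℝ, X) 𝓘(ℝ, EP) ∞ S z) :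
    ContDiffAt ℝ ∞ (A.pullback S) y := by
  refine ContDiffAt.congr_of_eventuallyEq ?_ (A.pullback_eventuallyEq hS)
  have hf : ContDiffAt ℝ ∞ (fun z => extChartAt 𝓘(ℝ, EP) (S y) (S z)) y :=
    contMDiffAt_iff_contDiffAt.1 ((contMDiffAt_extChartAt (n := ∞)).comp y hS.self_of_nhds)
  have hΘ : ContDiffAt ℝ ∞ (oneFormInChart A.form (S y)) (extChartAt 𝓘(ℝ, EP) (S y) (S y)) :=
    (A.smooth (S y)).contDiffAt (extChartAt_target_mem_nhds (S y))
  exact (hΘ.comp y hf).clm_comp (hf.fderiv_right (m := ∞) le_rfl)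

/-- Curvature is natural under pullback: in a chart of `P` the second derivative of `S` enters
symmetrically and cancels in the antisymmetrization. -/
theorem PrincipalConnection.flat_pullback {A : PrincipalConnection π} (hA : A.IsFlat) {S : X → P}
    {y : X} (hS : ∀ᶠ z in 𝓝 y, ContMDiffAt 𝓘(ℝ, X) 𝓘(ℝ, EP) ∞ S z) (u v : X) :
    fderiv ℝ (A.pullback S) y u v - fderiv ℝ (A.pullback S) y v u
      + bracketL G (A.pullback S y u) (A.pullback S y v) = 0 := by
  set ψ := extChartAt 𝓘(ℝ, EP) (S y) with hψ
  have hf : ContDiffAt ℝ ∞ (fun z => ψ (S z)) y :=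
    contMDiffAt_iff_contDiffAt.1 ((contMDiffAt_extChartAt (n := ∞)).comp y hS.self_of_nhds)
  have hΘ : ContDiffAt ℝ ∞ (oneFormInChart A.form (S y)) (ψ (S y)) :=
    (A.smooth (S y)).contDiffAt (extChartAt_target_mem_nhds (S y))
  have hsymm := (hf.isSymmSndFDerivAt (by simpa using ENat.LEInfty.out)).eq u v
  have hd1 := (hΘ.differentiableAt (by simp)).hasFDerivAt.comp y
    (hf.differentiableAt (by simp)).hasFDerivAt
  have hd2 := ((hf.fderiv_right (m := ∞) le_rfl).differentiableAt (by simp)).hasFDerivAt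
  have hd := (hd1.clm_comp hd2).congr_of_eventuallyEq (A.pullback_eventuallyEq hS)
  have hF := hA (S y) ((mder S y : X →L[ℝ] EP) u) ((mder S y : X →L[ℝ] EP) v)
  have hm : ∀ w, (mder ψ (S y) : EP →L[ℝ] EP) ((mder S y : X →L[ℝ] EP) w) =
      fderiv ℝ (fun z => ψ (S z)) y w := by
    intro w
    rw [← mfderiv_eq_fderiv]
    have h := mder_comp (f := S) (g := ψ) (x := y) (y := S y)
      (mdifferentiableAt_extChartAt (mem_chart_source EP (S y)))
      (hS.self_of_nhds.mdifferentiableAt (by simp)) rfl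
    exact (DFunLike.congr_fun h w).symm
  have hF' : fderiv ℝ (oneFormInChart A.form (S y)) (ψ (S y))
        ((mder ψ (S y) : EP →L[ℝ] EP) ((mder S y : X →L[ℝ] EP) u))
        ((mder ψ (S y) : EP →L[ℝ] EP) ((mder S y : X →L[ℝ] EP) v))
      - fderiv ℝ (oneFormInChart A.form (S y)) (ψ (S y))
        ((mder ψ (S y) : EP →L[ℝ] EP) ((mder S y : X →L[ℝ] EP) v))
        ((mder ψ (S y) : EP →L[ℝ] EP) ((mder S y : X →L[ℝ] EP) u))
      + bracket G (A.pullback S y u) (A.pullback S y v) = 0 := hF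
  rw [bracket_eq, hm, hm] at hF'
  rw [hd.fderiv]
  refine Eq.trans ?_ hF'
  simp [hsymm]

/-- A section is horizontal at `y` if its derivative at `y` is annihilated by the connection. -/
def PrincipalConnection.IsHorizontalAt (A : PrincipalConnection π) (s : M → P) (y : M) : Prop :=
  MDifferentiableAt 𝓘(ℝ, E) 𝓘(ℝ, EP) s y ∧ ∀ v, A.conn (s y) ((mder s y : E →L[ℝ] EP) v) = 0

/-- A smooth local section, read in a chart, pulls the connection back to a flat form. Multiplying
the section by the gauge of `exists_gauge` annihilates that form. -/
theorem PrincipalConnection.exists_local_horizontal_section {A : PrincipalConnection π}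
    (hA : A.IsFlat) (x : M) : ∃ U : Set M, IsOpen U ∧ x ∈ U ∧ ∃ s : M → P,
      (∀ y ∈ U, π.proj (s y) = y) ∧ ∀ y ∈ U, A.IsHorizontalAt s y := by
  obtain ⟨V, hV, hxV, s₀, -, hs₀, -, hproj, -⟩ := π.locally_trivial x
  set φ := extChartAt 𝓘(ℝ, E) x with hφ
  have hO : IsOpen (φ.target ∩ φ.symm ⁻¹' V) :=
    (continuousOn_extChartAt_symm x).isOpen_inter_preimage (isOpen_extChartAt_target x) hV
  have hmem : φ x ∈ φ.target ∩ φ.symm ⁻¹' V :=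
    ⟨mem_extChartAt_target x, by simpa [hφ, extChartAt_to_inv] using hxV⟩
  obtain ⟨r, hr, hrO⟩ := Metric.isOpen_iff.1 hO _ hmem
  set S : E → P := fun z => s₀ (φ.symm z) with hSdef
  have hS : ∀ z ∈ Metric.ball (φ x) r, ContMDiffAt 𝓘(ℝ, E) 𝓘(ℝ, EP) ∞ S z := fun z hz =>
    (hs₀.contMDiffAt (hV.mem_nhds (hrO hz).2)).comp z
      ((contMDiffOn_extChartAt_symm (n := ∞) x).contMDiffAt
        ((isOpen_extChartAt_target x).mem_nhds (hrO hz).1))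
  have hS' : ∀ z ∈ Metric.ball (φ x) r, ∀ᶠ z' in 𝓝 z, ContMDiffAt 𝓘(ℝ, E) 𝓘(ℝ, EP) ∞ S z' :=
    fun z hz => Filter.mem_of_superset (Metric.isOpen_ball.mem_nhds hz) hS
  obtain ⟨ρ, hρ, hρr, g, hg⟩ := exists_gauge G hr
    (fun z hz => (A.contDiffAt_pullback (hS' z hz)).contDiffWithinAt)
    (fun z hz => A.flat_pullback hA (hS' z hz))
  have key : ∀ z ∈ Metric.ball (φ x) ρ, MDifferentiableAt 𝓘(ℝ, E) 𝓘(ℝ, EP)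
      (fun z => π.act (S z) (g z)) z ∧
      ∀ v, A.conn (π.act (S z) (g z)) ((mder (fun z => π.act (S z) (g z)) z : E →L[ℝ] EP) v) = 0 := by
    intro z hz
    obtain ⟨D, hD, hDv⟩ := A.hasMDer_act (hasMDer_of_mdifferentiableAt (S := univ)
      ((hS z (Metric.ball_subset_ball hρr hz)).mdifferentiableAt (by simp))) (hg z hz)
    obtain ⟨h1, h2⟩ := hasMDer_univ_iff.1 hD
    refine ⟨h1, fun v => ?_⟩
    rw [h2, hDv]
    simp [PrincipalConnection.pullback]
  refine ⟨φ.source ∩ φ ⁻¹' Metric.ball (φ x) ρ, (continuousOn_extChartAt x).isOpen_inter_preimage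
    (isOpen_extChartAt_source x) Metric.isOpen_ball, ⟨mem_extChartAt_source x,
    Metric.mem_ball_self hρ⟩, fun y => π.act (S (φ y)) (g (φ y)), fun y hy => ?_, fun y hy => ?_⟩
  · rw [π.proj_act, hproj _ (hrO (Metric.ball_subset_ball hρr hy.2)).2, φ.left_inv hy.1]
  · have h1 : MDifferentiableAt 𝓘(ℝ, E) 𝓘(ℝ, E) φ y :=
      mdifferentiableAt_extChartAt (by rw [← extChartAt_source 𝓘(ℝ, E)]; exact hy.1)
    obtain ⟨h2, h3⟩ := key _ hy.2
    refine ⟨h2.comp y h1, fun v => ?_⟩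
    have h := mder_comp (f := φ) (g := fun z => π.act (S z) (g z)) (x := y) (y := φ y) h2 h1 rfl
    exact (congrArg (fun T : E →L[ℝ] EP => A.conn _ (T v)) h).trans (h3 _)

end HorizontalSections

/-! ### The covering by leaves, the global horizontal section, parallel transport. -/

section GlobalSection

variable {E : Type*} [NormedAddCommGroup E] [NormedSpace ℝ E]
  {EG : Type*} [NormedAddCommGroup EG] [NormedSpace ℝ EG] [CompleteSpace EG]
  {EP : Type*} [NormedAddCommGroup EP] [NormedSpace ℝ EP]
  {M : Type*} [TopologicalSpace M] [ChartedSpace E M] [IsManifold 𝓘(ℝ, E) ∞ M]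
  {G : Type*} [TopologicalSpace G] [ChartedSpace EG G] [Group G] [LieGroup 𝓘(ℝ, EG) ∞ G]
  {P : Type*} [TopologicalSpace P] [ChartedSpace EP P] [IsManifold 𝓘(ℝ, EP) ∞ P]
  {X : Type*} [NormedAddCommGroup X] [NormedSpace ℝ X]
  {π : PrincipalBundle E EG EP M G P}

theorem PrincipalBundle.existsUnique_act (π : PrincipalBundle E EG EP M G P) {p q : P}
    (h : π.proj p = π.proj q) : ∃! g : G, π.act p g = q := by
  obtain ⟨V, -, hV, s₀, k, -, -, -, h1, h2⟩ := π.locally_trivial (π.proj p)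
  have hp : π.act (s₀ (π.proj p)) (k p) = p := h1 p hV
  have hq : π.act (s₀ (π.proj p)) (k q) = q := by rw [h]; exact h1 q (by rwa [mem_preimage, ← h])
  have key : ∀ g : G, π.act p g = π.act (s₀ (π.proj p)) (k p * g) := fun g => by
    rw [π.act_mul, hp]
  refine ⟨(k p)⁻¹ * k q, (key _).trans (by rw [mul_inv_cancel_left, hq]), fun g hg => ?_⟩
  change π.act p g = q at hg
  have h3 := h2 _ hV (k p * g)
  rw [← key, hg] at h3
  rw [h3, inv_mul_cancel_left]

open Classical in
/-- The element of the structure group that takes `p` to `q`. -/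
def PrincipalBundle.quot (π : PrincipalBundle E EG EP M G P) (p q : P) : G :=
  if h : π.proj p = π.proj q then (π.existsUnique_act h).choose else 1

theorem PrincipalBundle.act_quot (π : PrincipalBundle E EG EP M G P) {p q : P}
    (h : π.proj p = π.proj q) : π.act p (π.quot p q) = q := by
  rw [quot, dif_pos h]
  exact (π.existsUnique_act h).choose_spec.1

theorem PrincipalBundle.quot_eq (π : PrincipalBundle E EG EP M G P) {p q : P} {g : G}
    (h : π.act p g = q) : π.quot p q = g := by
  have hpq : π.proj p = π.proj q := by rw [← h, π.proj_act]
  exact (π.existsUnique_act hpq).unique (π.act_quot hpq) h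

/-- Two horizontal maps with the same projection that agree at a point agree near it. -/
theorem PrincipalConnection.eventuallyEq_of_horizontal (A : PrincipalConnection π) {c c' : X → P}
    {D D' : X → X →L[ℝ] EP} {S : Set X} (hS : Convex ℝ S) (hu : UniqueDiffOn ℝ S)
    (hc : ∀ x ∈ S, HasMDer c (D x) S x) (hc' : ∀ x ∈ S, HasMDer c' (D' x) S x)
    (hh : ∀ x ∈ S, ∀ v, A.conn (c x) (D x v) = 0) (hh' : ∀ x ∈ S, ∀ v, A.conn (c' x) (D' x v) = 0)
    (hproj : ∀ x ∈ S, π.proj (c x) = π.proj (c' x)) {x₁ : X} (hx₁ : x₁ ∈ S) (h₁ : c x₁ = c' x₁) :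
    ∀ᶠ x in 𝓝[S] x₁, c x = c' x := by
  obtain ⟨V, hV, hxV, s₀, k, -, hk, -, hsk, -⟩ := π.locally_trivial (π.proj (c x₁))
  have hpre : ∀ {d : X → P} {L : X →L[ℝ] EP}, HasMDer d L S x₁ → π.proj (d x₁) ∈ V →
      ∀ᶠ x in 𝓝[S] x₁, π.proj (d x) ∈ V := by
    intro d L hd hdV
    exact (π.smooth_proj.continuous.continuousAt.comp_continuousWithinAt
      (HasMFDerivWithinAt.continuousWithinAt hd)).eventually (hV.mem_nhds hdV)
  have he := (hpre (hc x₁ hx₁) hxV).and (hpre (hc' x₁ hx₁) (h₁ ▸ hxV))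
  obtain ⟨r, hr, hrV⟩ := Metric.mem_nhdsWithin_iff.1 he
  set T := Metric.ball x₁ r ∩ S with hT
  have hTS : T ⊆ S := inter_subset_right
  have hTc : Convex ℝ T := (convex_ball _ _).inter hS
  have hTu : ∀ x ∈ T, UniqueDiffWithinAt ℝ T x := fun x hx =>
    ((hu x hx.2).inter (Metric.isOpen_ball.mem_nhds hx.1)).mono (by rw [hT, inter_comm])
  set g : X → G := fun x => (k (c x))⁻¹ * k (c' x) with hg
  have hk' : ∀ p, π.proj p ∈ V → MDifferentiableAt 𝓘(ℝ, EP) 𝓘(ℝ, EG) k p := fun p hp =>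
    (hk.contMDiffAt ((hV.preimage π.smooth_proj.continuous).mem_nhds hp)).mdifferentiableAt
      (by simp)
  have hact : ∀ x ∈ T, π.act (c x) (g x) = c' x := by
    intro x hx
    have e1 := hsk (c x) (hrV hx).1
    have e2 := hsk (c' x) (hrV hx).2
    rw [← hproj x hx.2] at e2
    calc π.act (c x) (g x) = π.act (π.act (s₀ (π.proj (c x))) (k (c x))) (g x) := by rw [e1]
      _ = c' x := by rw [← π.act_mul, hg, mul_inv_cancel_left, e2]
  -- Since `c' = c g` with `c` and `c'` both horizontal, the transformation law reads `0 = Ad(g⁻¹)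
  -- L` for the logarithmic derivative `L` of `g`. Hence `L = 0`, and `g` keeps its value `1` at
  -- `x₁`.
  have hlog : ∀ x ∈ T, HasLogDeriv g (0 : X →L[ℝ] EG) T x := by
    intro x hx
    have m : ∀ {d : X → P} {L : X →L[ℝ] EP}, HasMDer d L S x → π.proj (d x) ∈ V →
        ∃ L' : X →L[ℝ] EG, HasLogDeriv (fun y => k (d y)) L' T x := by
      intro d L hd hdV
      refine HasLogDeriv.exists_of_mdifferentiableWithinAt ?_
      exact (MDifferentiableAt.comp_mdifferentiableWithinAt x (hk' _ hdV)
        (HasMFDerivWithinAt.mdifferentiableWithinAt hd)).mono hTS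
    obtain ⟨L1, hL1⟩ := m (hc x hx.2) (hrV hx).1
    obtain ⟨L2, hL2⟩ := m (hc' x hx.2) (hrV hx).2
    have hL := hL1.inv.mul hL2
    obtain ⟨D₀, hD₀, hD₀v⟩ := A.hasMDer_act
      (HasMFDerivWithinAt.mono (hc x hx.2) hTS : HasMDer c (D x) T x) hL
    have h3 : HasMDer c' D₀ T x := hD₀.congr (fun y hy => (hact y hy).symm) (hact x hx).symm
    have h4 := h3.unique (HasMFDerivWithinAt.mono (hc' x hx.2) hTS : HasMDer c' (D' x) T x)
      (hTu x hx)
    refine hL.congr_deriv ?_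
    ext v
    have h5 := hD₀v v
    have h6 : π.act (c x) ((k (c x))⁻¹ * k (c' x)) = c' x := hact x hx
    rw [h6, h4, hh' x hx.2, hh x hx.2, zero_add] at h5
    have h7 := congrArg (AdL (EG := EG) (g x)) h5
    rw [map_zero, AdL_apply_inv] at h7
    exact h7.symm
  have hg1 : g x₁ = 1 := by simp [hg, h₁]
  have hmem : x₁ ∈ T := ⟨Metric.mem_ball_self hr, hx₁⟩
  filter_upwards [inter_mem_nhdsWithin S (Metric.ball_mem_nhds x₁ hr)] with x hx
  rw [inter_comm] at hx
  rw [← hact x hx, HasLogDeriv.eq_of_zero hTc hlog hx hmem, hg1, π.act_one]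

theorem PrincipalConnection.IsHorizontalAt.hasMDer_comp {A : PrincipalConnection π} {s : M → P}
    {f : X → M} {L : X →L[ℝ] E} {S : Set X} {x : X} (hs : A.IsHorizontalAt s (f x))
    (hf : HasMDer f L S x) : ∃ D : X →L[ℝ] EP, HasMDer (fun y => s (f y)) D S x ∧
      ∀ v, A.conn (s (f x)) (D v) = 0 :=
  ⟨_, hf.comp_map hs.1, fun v => hs.2 (L v)⟩

theorem PrincipalConnection.IsHorizontalAt.act_const {A : PrincipalConnection π} {s : M → P}
    {y : M} (hs : A.IsHorizontalAt s y) (g : G) :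
    A.IsHorizontalAt (fun z => π.act (s z) g) y := by
  have h1 := (π.contMDiff_act_right g).mdifferentiable (by simp) (s y)
  refine ⟨h1.comp y hs.1, fun v => ?_⟩
  have h := mder_comp (f := s) (g := fun q => π.act q g) (x := y) h1 hs.1 rfl
  refine (congrArg (fun T : E →L[ℝ] EP => A.conn _ (T v)) h).trans ?_
  refine (A.conn_act (s y) g ((mder s y : E →L[ℝ] EP) v)).trans ?_
  exact (congrArg (AdL g⁻¹) (hs.2 v)).trans (map_zero _)

theorem PrincipalConnection.IsHorizontalAt.congr_of_eventuallyEq {A : PrincipalConnection π}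
    {s s' : M → P} {y : M} (hs : A.IsHorizontalAt s y) (h : s' =ᶠ[𝓝 y] s) :
    A.IsHorizontalAt s' y := by
  refine ⟨hs.1.congr_of_eventuallyEq h, fun v => ?_⟩
  have h1 : (mder s' y : E →L[ℝ] EP) = mder s y := h.mfderiv_eq
  rw [h1, h.eq_of_nhds]
  exact hs.2 v

theorem PrincipalConnection.eventuallyEq_section (A : PrincipalConnection π) {s s' : M → P}
    {y : M} (hs : ∀ᶠ z in 𝓝 y, A.IsHorizontalAt s z ∧ π.proj (s z) = z)
    (hs' : ∀ᶠ z in 𝓝 y, A.IsHorizontalAt s' z ∧ π.proj (s' z) = z) (h : s y = s' y) :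
    s =ᶠ[𝓝 y] s' := by
  set φ := extChartAt 𝓘(ℝ, E) y with hφ
  have hcont : ContinuousAt φ.symm (φ y) := continuousAt_extChartAt_symm y
  have hy : φ.symm (φ y) = y := extChartAt_to_inv y
  have h1 : ∀ᶠ w in 𝓝 (φ y), w ∈ φ.target ∧
      ((A.IsHorizontalAt s (φ.symm w) ∧ π.proj (s (φ.symm w)) = φ.symm w) ∧
        (A.IsHorizontalAt s' (φ.symm w) ∧ π.proj (s' (φ.symm w)) = φ.symm w)) := by
    refine Filter.Eventually.and (extChartAt_target_mem_nhds y) ?_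
    have := hs.and hs'
    rw [← hy] at this
    exact hcont.eventually this
  obtain ⟨r, hr, hrV⟩ := Metric.eventually_nhds_iff_ball.1 h1
  have hd : ∀ w ∈ Metric.ball (φ y) r, HasMDer φ.symm (mder φ.symm w : E →L[ℝ] E)
      (Metric.ball (φ y) r) w := fun w hw => hasMDer_of_mdifferentiableAt
    (((contMDiffOn_extChartAt_symm (n := ∞) y).contMDiffAt
      ((isOpen_extChartAt_target y).mem_nhds (hrV w hw).1)).mdifferentiableAt (by simp))
  have hex : ∀ w, ∃ D : E →L[ℝ] EP, w ∈ Metric.ball (φ y) r →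
      HasMDer (fun z => s (φ.symm z)) D (Metric.ball (φ y) r) w ∧
      ∀ v, A.conn (s (φ.symm w)) (D v) = 0 := fun w => by
    by_cases hw : w ∈ Metric.ball (φ y) r
    · obtain ⟨D, hD⟩ := (hrV w hw).2.1.1.hasMDer_comp (hd w hw)
      exact ⟨D, fun _ => hD⟩
    · exact ⟨0, fun h => absurd h hw⟩
  have hex' : ∀ w, ∃ D : E →L[ℝ] EP, w ∈ Metric.ball (φ y) r →
      HasMDer (fun z => s' (φ.symm z)) D (Metric.ball (φ y) r) w ∧
      ∀ v, A.conn (s' (φ.symm w)) (D v) = 0 := fun w => by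
    by_cases hw : w ∈ Metric.ball (φ y) r
    · obtain ⟨D, hD⟩ := (hrV w hw).2.2.1.hasMDer_comp (hd w hw)
      exact ⟨D, fun _ => hD⟩
    · exact ⟨0, fun h => absurd h hw⟩
  choose D hD using hex
  choose D' hD' using hex'
  have key := A.eventuallyEq_of_horizontal (convex_ball (φ y) r) Metric.isOpen_ball.uniqueDiffOn
    (fun w hw => (hD w hw).1) (fun w hw => (hD' w hw).1) (fun w hw => (hD w hw).2)
    (fun w hw => (hD' w hw).2)
    (fun w hw => (hrV w hw).2.1.2.trans (hrV w hw).2.2.2.symm) (Metric.mem_ball_self hr)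
    (by rw [hy, h])
  rw [Metric.isOpen_ball.nhdsWithin_eq (Metric.mem_ball_self hr)] at key
  have h2 := (continuousAt_extChartAt (I := 𝓘(ℝ, E)) y).eventually key
  filter_upwards [h2, extChartAt_source_mem_nhds (I := 𝓘(ℝ, E)) y] with z hz hz'
  rwa [φ.left_inv hz'] at hz

/-- The structure group with the discrete topology. -/
structure DiscreteCopy (G : Type*) where
  val : G

instance (G : Type*) : TopologicalSpace (DiscreteCopy G) := ⊥

instance (G : Type*) : DiscreteTopology (DiscreteCopy G) := ⟨rfl⟩

/-- The covering of the base by the leaves of a flat connection, in terms of a family of local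
horizontal sections. -/
def PrincipalConnection.leafCore (A : PrincipalConnection π) (U : M → Set M)
    (hU : ∀ x, IsOpen (U x)) (hxU : ∀ x, x ∈ U x) (s : M → M → P)
    (hs : ∀ x, ∀ y ∈ U x, π.proj (s x y) = y) (hh : ∀ x, ∀ y ∈ U x, A.IsHorizontalAt (s x) y) :
    FiberBundleCore M M (DiscreteCopy G) where
  baseSet := U
  isOpen_baseSet := hU
  indexAt := id
  mem_baseSet_at := hxU
  coordChange i j y g := ⟨π.quot (s j y) (π.act (s i y) g.val)⟩
  coordChange_self i y _ g := congrArg DiscreteCopy.mk (π.quot_eq rfl)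
  continuousOn_coordChange i j := by
    rintro ⟨y, ⟨g⟩⟩ ⟨⟨hi, hj⟩, -⟩
    replace hi : y ∈ U i := hi
    replace hj : y ∈ U j := hj
    have hact := π.act_quot (p := s j y) (q := π.act (s i y) g)
      (by rw [π.proj_act, hs i y hi, hs j y hj])
    -- A right translate of a horizontal section is horizontal, and two horizontal sections that
    -- meet agree nearby. The transition functions are therefore locally constant, that is,
    -- continuous for the discrete topology on the group.
    have h1 := A.eventuallyEq_section (y := y)
      (s := fun z => π.act (s j z) (π.quot (s j y) (π.act (s i y) g)))
      (s' := fun z => π.act (s i z) g)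
      (Filter.mem_of_superset ((hU j).mem_nhds hj) fun z hz =>
        ⟨(hh j z hz).act_const _, by rw [π.proj_act, hs j z hz]⟩)
      (Filter.mem_of_superset ((hU i).mem_nhds hi) fun z hz =>
        ⟨(hh i z hz).act_const _, by rw [π.proj_act, hs i z hz]⟩) hact
    refine ContinuousAt.continuousWithinAt ?_
    unfold ContinuousAt
    rw [nhds_discrete (DiscreteCopy G), tendsto_pure, nhds_prod_eq,
      nhds_discrete (DiscreteCopy G), prod_pure, eventually_map]
    exact h1.mono fun z hz => congrArg DiscreteCopy.mk (π.quot_eq hz)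
  coordChange_comp i j k y hy g := by
    refine congrArg DiscreteCopy.mk (π.quot_eq ?_).symm
    rw [π.act_quot, π.act_quot]
    · rw [π.proj_act, hs i y hy.1.1, hs j y hy.1.2]
    · rw [π.proj_act, hs j y hy.1.2, hs k y hy.2]

/-- With discrete fibres the bundle of leaves is a covering. Simple connectedness lifts the identity
of `M` through the leaf of `p₀`, and the lift names one frame over each point. -/
theorem PrincipalConnection.exists_horizontal_section [SimplyConnectedSpace M]
    {A : PrincipalConnection π} (hA : A.IsFlat) {x₀ : M} {p₀ : P} (hp₀ : π.proj p₀ = x₀) :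
    ∃ s : M → P, s x₀ = p₀ ∧ (∀ y, π.proj (s y) = y) ∧ ∀ y, A.IsHorizontalAt s y := by
  choose U hU hxU s hs hh using fun x => PrincipalConnection.exists_local_horizontal_section hA x
  let Z := A.leafCore U hU hxU s hs hh
  have hcov : IsCoveringMap Z.proj := FiberBundle.isCoveringMap (F := DiscreteCopy G) (E := Z.Fiber)
  have : LocallyPathConnectedSpace M := ChartedSpace.locallyPathConnectedSpace E M
  obtain ⟨f, ⟨hf0, hf⟩, -⟩ := hcov.existsUnique_continuousMap_lifts (ContinuousMap.id M) x₀
    (⟨x₀, ⟨π.quot (s x₀ x₀) p₀⟩⟩ : Z.TotalSpace) rfl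
  have hf1 : ∀ y, (f y).1 = y := fun y => congrFun hf y
  refine ⟨fun y => π.act (s (f y).1 (f y).1) (DiscreteCopy.val (f y).2), ?_, fun y => ?_, fun y => ?_⟩
  · have h : ∀ e : Z.TotalSpace, e = ⟨x₀, ⟨π.quot (s x₀ x₀) p₀⟩⟩ →
        π.act (s e.1 e.1) (DiscreteCopy.val e.2) = p₀ := by
      rintro _ rfl
      exact π.act_quot (q := p₀) (by rw [hs x₀ x₀ (hxU x₀), hp₀])
    exact h _ hf0
  · rw [π.proj_act, hs _ _ (hxU _), hf1]
  · have hc : ContinuousAt (fun z => ((Z.localTriv y) (f z)).2) y := by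
      refine continuousAt_snd.comp (ContinuousAt.comp (f := f) (g := Z.localTriv y) ?_
        f.continuous.continuousAt)
      refine (Z.localTriv y).continuousOn.continuousAt ((Z.localTriv y).open_source.mem_nhds ?_)
      rw [Z.mem_localTriv_source]
      change (f y).1 ∈ U y
      rw [hf1]
      exact hxU y
    rw [ContinuousAt, nhds_discrete (DiscreteCopy G), tendsto_pure] at hc
    refine ((hh y y (hxU y)).act_const ((Z.localTriv y) (f y)).2.val).congr_of_eventuallyEq ?_
    filter_upwards [hc, (hU y).mem_nhds (hxU y)] with z hz hzU
    rw [← hz]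
    have h3 : ((Z.localTriv y) (f z)).2.val =
      π.quot (s y (f z).1) (π.act (s (f z).1 (f z).1) (DiscreteCopy.val (f z).2)) := rfl
    rw [h3]
    have h4 : s y z = s y (f z).1 := by rw [hf1]
    rw [h4, π.act_quot]
    rw [π.proj_act, hs _ _ (hxU _), hs]
    rw [hf1]
    exact hzU

/-- Along a path from the base point, parallel transport is evaluation of the horizontal
section. -/
theorem PrincipalConnection.parallelTransport_eq [T2Space P] {A : PrincipalConnection π}
    {x₀ : M} {p₀ : P} {s : M → P} (hs₀ : s x₀ = p₀) (hs : ∀ y, π.proj (s y) = y)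
    (hh : ∀ y, A.IsHorizontalAt s y) {γ : ℝ → M}
    (hγ : ContMDiffOn 𝓘(ℝ, ℝ) 𝓘(ℝ, E) 1 γ (Icc 0 1)) (h0 : γ 0 = x₀) :
    parallelTransport A p₀ γ = s (γ 1) := by
  have hI : UniqueDiffOn ℝ (Icc (0 : ℝ) 1) := uniqueDiffOn_Icc zero_lt_one
  have hγd : ∀ t ∈ Icc (0 : ℝ) 1, ∃ L : ℝ →L[ℝ] E, HasMDer γ L (Icc 0 1) t := fun t ht =>
    ⟨_, ((hγ t ht).mdifferentiableWithinAt (by simp)).hasMFDerivWithinAt⟩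
  have hsd : ∀ t ∈ Icc (0 : ℝ) 1, ∃ D : ℝ →L[ℝ] EP, HasMDer (fun t => s (γ t)) D (Icc 0 1) t ∧
      ∀ v, A.conn (s (γ t)) (D v) = 0 := fun t ht => by
    obtain ⟨L, hL⟩ := hγd t ht
    exact (hh (γ t)).hasMDer_comp hL
  have hlift : IsHorizontalLift A p₀ γ (fun t => s (γ t)) := by
    refine ⟨by rw [h0, hs₀], fun t _ => hs _, fun t ht => ?_, fun t ht => ?_⟩
    · obtain ⟨D, hD, -⟩ := hsd t ht
      exact HasMFDerivWithinAt.mdifferentiableWithinAt hD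
    · obtain ⟨D, hD, hDv⟩ := hsd t ht
      have h1 : mfderivWithin 𝓘(ℝ, ℝ) 𝓘(ℝ, EP) (fun t => s (γ t)) (Icc 0 1) t = D :=
        HasMFDerivWithinAt.mfderivWithin hD (hI t ht).uniqueMDiffWithinAt
      exact (congrArg (fun T : ℝ →L[ℝ] EP => A.conn (s (γ t)) (T 1)) h1).trans (hDv 1)
  have hex : ∃ c : ℝ → P, IsHorizontalLift A p₀ γ c := ⟨_, hlift⟩
  rw [parallelTransport, dif_pos hex]
  set c := hex.choose with hcdef
  have hc : IsHorizontalLift A p₀ γ c := hex.choose_spec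
  have hcd : ∀ t ∈ Icc (0 : ℝ) 1, ∃ D : ℝ →L[ℝ] EP, HasMDer c D (Icc 0 1) t ∧
      ∀ v, A.conn (c t) (D v) = 0 := fun t ht => by
    refine ⟨_, (hc.diff t ht).hasMFDerivWithinAt, fun v => ?_⟩
    set D : ℝ →L[ℝ] EP := mfderivWithin 𝓘(ℝ, ℝ) 𝓘(ℝ, EP) c (Icc 0 1) t with hD
    have h1 : A.conn (c t) (D 1) = 0 := hc.horizontal t ht
    have h2 : D v = v • D 1 := by rw [← map_smul]; simp
    refine Eq.trans (congrArg (A.conn (c t)) h2) ?_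
    rw [map_smul, h1, smul_zero]
  have hcc : ContinuousOn c (Icc 0 1) := fun t ht => (hc.diff t ht).continuousWithinAt
  have hsc : ContinuousOn (fun t => s (γ t)) (Icc 0 1) := fun t ht =>
    (hlift.diff t ht).continuousWithinAt
  choose! D hD hDv using hcd
  choose! D' hD' hDv' using hsd
  have hclosed : IsClosed ({t | c t = s (γ t)} ∩ Icc (0 : ℝ) 1) := by
    have h1 := (hcc.prodMk hsc).preimage_isClosed_of_isClosed isClosed_Icc
      (isClosed_diagonal (X := P))
    rw [inter_comm]
    exact h1
  -- The chosen lift `c` and `s ∘ γ` are two horizontal lifts of `γ`. The set where they agree is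
  -- closed because `P` is Hausdorff, contains `0`, and extends to the right by local uniqueness.
  refine (hclosed.Icc_subset_of_forall_mem_nhdsWithin (a := 0) (b := 1) ?_ ?_)
    (right_mem_Icc.2 zero_le_one)
  · change c 0 = s (γ 0)
    rw [hc.init, h0, hs₀]
  · rintro t ⟨ht, ht'⟩
    have h2 := A.eventuallyEq_of_horizontal (convex_Icc (0 : ℝ) 1) hI hD hD' hDv hDv'
      (fun t ht => by rw [hc.lifts t ht, hs]) ⟨ht'.1, ht'.2.le⟩ ht
    rw [mem_nhdsWithin_iff_eventually]
    have h3 : ∀ᶠ u in 𝓝 t, u < 1 := gt_mem_nhds ht'.2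
    filter_upwards [eventually_nhdsWithin_iff.1 h2, h3] with u hu hu1 hut
    exact hu ⟨ht'.1.trans (le_of_lt hut), hu1.le⟩

end GlobalSection

/-! ### Continuity of adjoint forms in a continuous frame, and alternating algebra. -/

section AdjointForms

variable {E : Type*} [NormedAddCommGroup E] [NormedSpace ℝ E]
  {EG : Type*} [NormedAddCommGroup EG] [NormedSpace ℝ EG] [CompleteSpace EG]
  {EP : Type*} [NormedAddCommGroup EP] [NormedSpace ℝ EP]
  {M : Type*} [TopologicalSpace M] [ChartedSpace E M] [IsManifold 𝓘(ℝ, E) ∞ M]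
  {G : Type*} [TopologicalSpace G] [ChartedSpace EG G] [Group G] [LieGroup 𝓘(ℝ, EG) ∞ G]
  {P : Type*} [TopologicalSpace P] [ChartedSpace EP P] [IsManifold 𝓘(ℝ, EP) ∞ P]
  {X : Type*} [NormedAddCommGroup X] [NormedSpace ℝ X]
  {π : PrincipalBundle E EG EP M G P} {k : ℕ}

/-- The value of an adjoint form in the frame `p`, as a form on the model space. -/
def AdjointForm.inFrame (B : AdjointForm π k) (p : P) : E [⋀^Fin k]→L[ℝ] EG := B.form p

theorem AdjointForm.inFrame_act (B : AdjointForm π k) (p : P) (g : G) (v : Fin k → E) :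
    B.inFrame (π.act p g) v = AdL g⁻¹ (B.inFrame p v) := B.equivariant p g v

/-- The smooth coordinate expression of the pullback of `B` to the total space. -/
def AdjointForm.inChart (B : AdjointForm π k) (p₀ : P) (z : EP) : EP [⋀^Fin k]→L[ℝ] EG :=
  (B.inFrame ((extChartAt 𝓘(ℝ, EP) p₀).symm z)).compContinuousLinearMap
    ((mder π.proj ((extChartAt 𝓘(ℝ, EP) p₀).symm z) : EP →L[ℝ] E).comp
      (mder (extChartAt 𝓘(ℝ, EP) p₀).symm z : EP →L[ℝ] EP))

theorem AdjointForm.contDiffOn_inChart (B : AdjointForm π k) (p₀ : P) :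
    ContDiffOn ℝ ∞ (B.inChart p₀) (extChartAt 𝓘(ℝ, EP) p₀).target := B.smooth p₀

/-- Along a smooth lift `S` of a map to the base, the value of `B` in the frame `S` depends
continuously on the point and on vectors of the parameter space. -/
theorem AdjointForm.continuousAt_inFrame_lift (B : AdjointForm π k) {S : X → P} {z₀ : X}
    (hS : ∀ᶠ z in 𝓝 z₀, ContMDiffAt 𝓘(ℝ, X) 𝓘(ℝ, EP) ∞ S z) (w₀ : Fin k → X) :
    ContinuousAt (fun p : X × (Fin k → X) => B.inFrame (S p.1)
      (fun i => (mder (fun z => π.proj (S z)) p.1 : X →L[ℝ] E) (p.2 i))) (z₀, w₀) := by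
  set ψ := extChartAt 𝓘(ℝ, EP) (S z₀) with hψ
  have hc : ContinuousAt S z₀ := hS.self_of_nhds.continuousAt
  have hf : ContDiffAt ℝ ∞ (fun z => ψ (S z)) z₀ :=
    contMDiffAt_iff_contDiffAt.1 ((contMDiffAt_extChartAt (n := ∞)).comp z₀ hS.self_of_nhds)
  have hF : ContinuousAt (B.inChart (S z₀)) (ψ (S z₀)) :=
    ((B.contDiffOn_inChart (S z₀)).contDiffAt (extChartAt_target_mem_nhds (S z₀))).continuousAt
  have hf' : ContinuousAt (fderiv ℝ (fun z => ψ (S z))) z₀ :=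
    (hf.fderiv_right (m := ∞) le_rfl).continuousAt
  have hcont : ContinuousAt (fun p : X × (Fin k → X) => B.inChart (S z₀) (ψ (S p.1))
      (fun i => fderiv ℝ (fun z => ψ (S z)) p.1 (p.2 i))) (z₀, w₀) := by
    have h1 : ContinuousAt (fun z => B.inChart (S z₀) (ψ (S z))) z₀ :=
      ContinuousAt.comp (f := fun z => ψ (S z)) (g := B.inChart (S z₀)) hF hf.continuousAt
    have h2 : ContinuousAt (fun p : X × (Fin k → X) => B.inChart (S z₀) (ψ (S p.1))) (z₀, w₀) :=
      ContinuousAt.comp (f := Prod.fst) (x := (z₀, w₀)) (g := fun z => B.inChart (S z₀) (ψ (S z)))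
        h1 continuousAt_fst
    have h3 : ContinuousAt (fun p : X × (Fin k → X) => fderiv ℝ (fun z => ψ (S z)) p.1)
        (z₀, w₀) := ContinuousAt.comp (f := Prod.fst) (x := (z₀, w₀))
      (g := fderiv ℝ (fun z => ψ (S z))) hf' continuousAt_fst
    have h4 : ContinuousAt (fun p : X × (Fin k → X) => fun i =>
        fderiv ℝ (fun z => ψ (S z)) p.1 (p.2 i)) (z₀, w₀) :=
      continuousAt_pi.2 fun i => h3.clm_apply ((continuous_apply i).comp continuous_snd).continuousAt
    exact h2.eval h4
  refine hcont.congr_of_eventuallyEq ?_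
  have h1 := (hc.eventually ((isOpen_extChartAt_source (I := 𝓘(ℝ, EP)) (S z₀)).mem_nhds
    (mem_extChartAt_source (I := 𝓘(ℝ, EP)) (S z₀)))).eventually_nhds
  filter_upwards [(h1.and hS).prod_inl_nhds w₀] with p hp
  obtain ⟨hz, hSz⟩ := hp
  set z := p.1
  set v := p.2
  have hz0 := hz.self_of_nhds
  have hl := (extChartAt 𝓘(ℝ, EP) (S z₀)).left_inv hz0
  have hφ : MDifferentiableAt 𝓘(ℝ, EP) 𝓘(ℝ, EP) ψ (S z) :=
    mdifferentiableAt_extChartAt (by rwa [← extChartAt_source 𝓘(ℝ, EP)])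
  have hfz : MDifferentiableAt 𝓘(ℝ, X) 𝓘(ℝ, EP) (fun z => ψ (S z)) z :=
    hφ.comp z (hSz.mdifferentiableAt (by simp))
  have hg : MDifferentiableAt 𝓘(ℝ, EP) 𝓘(ℝ, EP) ψ.symm (ψ (S z)) :=
    ((contMDiffOn_extChartAt_symm (n := ∞) (S z₀)).contMDiffAt
      ((isOpen_extChartAt_target (S z₀)).mem_nhds (ψ.map_source hz0))).mdifferentiableAt (by simp)
  have h2 := mder_comp (f := fun z => ψ (S z)) (x := z) hg hfz rfl
  have h3 : (mder (ψ.symm ∘ fun z => ψ (S z)) z : X →L[ℝ] EP) = mder S z :=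
    Filter.EventuallyEq.mfderiv_eq (hz.mono fun w hw => ψ.left_inv hw)
  have h4 := mder_comp (f := S) (g := π.proj) (x := z)
    (π.smooth_proj.mdifferentiable (by simp) (S z)) (hSz.mdifferentiableAt (by simp)) rfl
  have h5 : ∀ w, (mder (fun z => π.proj (S z)) z : X →L[ℝ] E) w =
      (mder π.proj (S z) : EP →L[ℝ] E) ((mder ψ.symm (ψ (S z)) : EP →L[ℝ] EP)
        (fderiv ℝ (fun z => ψ (S z)) z w)) := by
    intro w
    rw [h3] at h2
    rw [← mfderiv_eq_fderiv]
    refine (DFunLike.congr_fun h4 w).trans ?_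
    rw [ContinuousLinearMap.comp_apply, h2]
    rfl
  rw [AdjointForm.inChart, ← hψ, ContinuousAlternatingMap.compContinuousLinearMap_apply]
  simp only [h5]
  rw [hl]
  rfl

/-- In a chart at `N x₁`, the components of a continuous vector field along `N` are continuous. -/
theorem continuousWithinAt_mder_extChartAt {Y : Type*} [TopologicalSpace Y] {N : Y → M} {v : Y → E}
    {S : Set Y} {y : Y}
    (h : ContinuousWithinAt (fun z => (⟨N z, v z⟩ : TangentBundle 𝓘(ℝ, E) M)) S y) :
    ContinuousWithinAt N S y ∧
      ContinuousWithinAt (fun z => (mder (extChartAt 𝓘(ℝ, E) (N y)) (N z) : E →L[ℝ] E) (v z))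
        S y := by
  obtain ⟨h1, h2⟩ := (FiberBundle.continuousWithinAt_totalSpace (F := E)
    (E := (TangentSpace 𝓘(ℝ, E) : M → Type _)) _).1 h
  refine ⟨h1, ?_⟩
  have h3 : ∀ z, N z ∈ (chartAt E (N y)).source →
      ((trivializationAt E (TangentSpace 𝓘(ℝ, E)) (N y))
        (⟨N z, v z⟩ : TangentBundle 𝓘(ℝ, E) M)).2 =
        (mder (extChartAt 𝓘(ℝ, E) (N y)) (N z) : E →L[ℝ] E) (v z) := by
    intro z hz
    have h4 := TangentBundle.continuousLinearMapAt_trivializationAt (I := 𝓘(ℝ, E)) hz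
    refine Eq.trans ?_ (DFunLike.congr_fun h4 (v z))
    exact (congrFun (Bundle.Trivialization.coe_linearMapAt_of_mem (R := ℝ)
      (trivializationAt E (TangentSpace 𝓘(ℝ, E)) (N y)) (b := N z) (by simpa using hz)) (v z)).symm
  refine h2.congr_of_eventuallyEq ?_ ?_
  · filter_upwards [h1.eventually ((chartAt E (N y)).open_source.mem_nhds
      (mem_chart_source E (N y)))] with z hz
    exact (h3 z hz).symm
  · exact (h3 y (mem_chart_source E (N y))).symm

/-- The values of `B` in the frames of a continuous section, on continuous vector fields along a
map, are continuous. -/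
theorem AdjointForm.continuousWithinAt_inFrame (B : AdjointForm π k) {s : M → P}
    (hsc : Continuous s) (hs : ∀ y, π.proj (s y) = y)
    {Y : Type*} [TopologicalSpace Y] {N : Y → M} {v : Fin k → Y → E} {S : Set Y} {y : Y}
    (hN : ContinuousWithinAt N S y)
    (hv : ∀ i, ContinuousWithinAt (fun z => (⟨N z, v i z⟩ : TangentBundle 𝓘(ℝ, E) M)) S y) :
    ContinuousWithinAt (fun z => B.inFrame (s (N z)) (fun i => v i z)) S y := by
  have := topologicalGroup_of_lieGroup 𝓘(ℝ, EG) ∞ (G := G)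
  -- The section `s` is only assumed continuous, so the value of `B` is computed in a smooth local
  -- frame `s₀` and then corrected by the continuous factor `Ad(κ(s)⁻¹)`.
  obtain ⟨V, hV, hxV, s₀, κ, hs₀, hκ, hproj, hsk, -⟩ := π.locally_trivial (N y)
  set φ := extChartAt 𝓘(ℝ, E) (N y) with hφ
  have hy : φ.symm (φ (N y)) = N y := extChartAt_to_inv (N y)
  have hsym : ContinuousAt φ.symm (φ (N y)) := continuousAt_extChartAt_symm (N y)
  have hev : ∀ᶠ z in 𝓝 (φ (N y)), z ∈ φ.target ∧ φ.symm z ∈ V :=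
    Filter.Eventually.and (extChartAt_target_mem_nhds (N y))
      (hsym.eventually (by rw [hy]; exact hV.mem_nhds hxV))
  have hS : ∀ᶠ z in 𝓝 (φ (N y)), ContMDiffAt 𝓘(ℝ, E) 𝓘(ℝ, EP) ∞ (fun z => s₀ (φ.symm z)) z :=
    hev.mono fun z hz => (hs₀.contMDiffAt (hV.mem_nhds hz.2)).comp z
      ((contMDiffOn_extChartAt_symm (n := ∞) (N y)).contMDiffAt
        ((isOpen_extChartAt_target (N y)).mem_nhds hz.1))
  have hφN : ContinuousWithinAt (fun z => φ (N z)) S y :=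
    (continuousAt_extChartAt (I := 𝓘(ℝ, E)) (N y)).comp_continuousWithinAt hN
  have hsrc : ∀ᶠ z in 𝓝[S] y, N z ∈ φ.source ∧ N z ∈ V :=
    hN.eventually (Filter.Eventually.and (extChartAt_source_mem_nhds (I := 𝓘(ℝ, E)) (N y))
      (hV.mem_nhds hxV))
  have hg : ContinuousWithinAt (fun z => (AdL (κ (s (N z)))⁻¹ : EG →L[ℝ] EG)) S y := by
    have h1 : ContinuousAt κ (s (N y)) := (hκ.continuousOn).continuousAt
      ((hV.preimage π.smooth_proj.continuous).mem_nhds (by rwa [mem_preimage, hs]))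
    have h2 : ContinuousAt (fun p : P => (AdL (κ p)⁻¹ : EG →L[ℝ] EG)) (s (N y)) :=
      (continuous_AdL.comp continuous_inv).continuousAt.comp h1
    exact ContinuousAt.comp_continuousWithinAt (f := fun z => s (N z)) h2
      (hsc.continuousAt.comp_continuousWithinAt hN)
  have hw : ContinuousWithinAt (fun z => fun i => (mder φ (N z) : E →L[ℝ] E) (v i z)) S y :=
    continuousWithinAt_pi.2 fun i => (continuousWithinAt_mder_extChartAt (hv i)).2
  have heval := (B.continuousAt_inFrame_lift hS
    (fun i => (mder φ (N y) : E →L[ℝ] E) (v i y))).comp_continuousWithinAt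
    (f := fun z => (φ (N z), fun i => (mder φ (N z) : E →L[ℝ] E) (v i z))) (hφN.prodMk hw)
  have key : ∀ z, N z ∈ φ.source → N z ∈ V → B.inFrame (s (N z)) (fun i => v i z) =
      AdL (κ (s (N z)))⁻¹ (B.inFrame (s₀ (φ.symm (φ (N z)))) (fun i =>
        (mder (fun w => π.proj (s₀ (φ.symm w))) (φ (N z)) : E →L[ℝ] E)
          ((mder φ (N z) : E →L[ℝ] E) (v i z)))) := by
    intro z hz hzV
    have h1 := hsk (s (N z)) (by rwa [mem_preimage, hs])
    rw [hs] at h1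
    have hφz : MDifferentiableAt 𝓘(ℝ, E) 𝓘(ℝ, E) φ (N z) :=
      mdifferentiableAt_extChartAt (by rwa [← extChartAt_source 𝓘(ℝ, E)])
    have htar := (isOpen_extChartAt_target (I := 𝓘(ℝ, E)) (N y)).mem_nhds (φ.map_source hz)
    have hcs : ContMDiffAt 𝓘(ℝ, E) 𝓘(ℝ, E) ∞ φ.symm (φ (N z)) :=
      (contMDiffOn_extChartAt_symm (n := ∞) (N y)).contMDiffAt htar
    have hg' : MDifferentiableAt 𝓘(ℝ, E) 𝓘(ℝ, E) φ.symm (φ (N z)) :=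
      hcs.mdifferentiableAt (by simp)
    have hcV : ∀ᶠ w in 𝓝 (φ (N z)), φ.symm w ∈ V :=
      hcs.continuousAt.eventually (by rw [φ.left_inv hz]; exact hV.mem_nhds hzV)
    have h2 : (mder (fun w => π.proj (s₀ (φ.symm w))) (φ (N z)) : E →L[ℝ] E) =
        mder φ.symm (φ (N z)) :=
      Filter.EventuallyEq.mfderiv_eq (hcV.mono fun w hw => hproj _ hw)
    have h3 := mder_comp (f := φ) (g := φ.symm) (x := N z) hg' hφz rfl
    have h4 : (mder (φ.symm ∘ φ) (N z) : E →L[ℝ] E) = mder (id : M → M) (N z) :=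
      Filter.EventuallyEq.mfderiv_eq (Filter.mem_of_superset
        ((isOpen_extChartAt_source (I := 𝓘(ℝ, E)) (N y)).mem_nhds hz) fun w hw => φ.left_inv hw)
    have h5 : (mder (id : M → M) (N z) : E →L[ℝ] E) = .id ℝ E := mfderiv_id
    have h6 : ∀ u : E, (mder (fun w => π.proj (s₀ (φ.symm w))) (φ (N z)) : E →L[ℝ] E)
        ((mder φ (N z) : E →L[ℝ] E) u) = u := by
      intro u
      rw [h2, ← ContinuousLinearMap.comp_apply, ← h3, h4, h5]
      rfl
    simp only [h6]
    rw [φ.left_inv hz, ← B.inFrame_act, h1]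
  refine (hg.clm_apply heval).congr_of_eventuallyEq ?_ ?_
  · filter_upwards [hsrc] with z hz
    exact key z hz.1 hz.2
  · exact key y (mem_extChartAt_source (N y)) hxV

end AdjointForms

section Alternating

variable {E : Type*} [NormedAddCommGroup E] [NormedSpace ℝ E]
  {F : Type*} [NormedAddCommGroup F] [NormedSpace ℝ F] {k : ℕ}

theorem alternating_eq_zero_of_eq_smul (θ : E [⋀^Fin k]→L[ℝ] F) (v : Fin k → E) {i j : Fin k}
    (hij : i ≠ j) (c : ℝ) (h : v i = c • v j) : θ v = 0 := by
  have h1 : v = Function.update v i (c • v j) := by rw [← h, Function.update_eq_self]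
  have h2 : θ (Function.update v i (v j)) = 0 := θ.toAlternatingMap.map_update_self v hij
  rw [h1, θ.map_update_smul, h2, smul_zero]

/-- Expanding by multilinearity, every term with a multiple of `a` beyond the first slot has two
proportional entries and vanishes. -/
theorem alternating_shear (θ : E [⋀^Fin (k + 1)]→L[ℝ] F) (c : ℝ) (a : E) (w : Fin k → E)
    (l : Fin k → ℝ) :
    θ (Fin.cons (c • a) fun i => w i + l i • a) = c • θ (Fin.cons a w) := by
  have h1 := θ.toContinuousMultilinearMap.cons_smul (fun i => w i + l i • a) c a
  refine h1.trans (congrArg (c • ·) ?_)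
  change θ (Fin.cons a fun i => w i + l i • a) = θ (Fin.cons a w)
  have h2 : (Fin.cons a fun i => w i + l i • a : Fin (k + 1) → E) =
      Fin.cons a w + Fin.cons 0 fun i => l i • a := by
    ext i
    refine Fin.cases ?_ (fun i => ?_) i <;> simp
  rw [h2, θ.map_add_univ, Finset.sum_eq_single Finset.univ]
  · simp
  · intro t _ ht
    by_cases h0 : (0 : Fin (k + 1)) ∈ t
    · obtain ⟨i, hi⟩ : ∃ i, i ∉ t := by
        by_contra! h
        exact ht (Finset.eq_univ_iff_forall.2 h)
      have hi0 : i ≠ 0 := fun h => hi (h ▸ h0)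
      obtain ⟨j, rfl⟩ := Fin.exists_succ_eq.2 hi0
      refine alternating_eq_zero_of_eq_smul θ _ hi0 (l j) ?_
      rw [Finset.piecewise_eq_of_notMem _ _ _ hi, Finset.piecewise_eq_of_mem _ _ _ h0]
      simp
    · refine θ.map_coord_zero 0 ?_
      rw [Finset.piecewise_eq_of_notMem _ _ _ h0, Fin.cons_zero]
  · simp

end Alternating

/-! ### The cube, the box and their coordinate directions. -/

section Box

variable {n : ℕ}

theorem isCompact_cube (n : ℕ) : IsCompact (cube n) := isCompact_Icc

theorem cube_eq_pi (n : ℕ) : cube n = Set.pi univ fun _ => Icc 0 (2 * Real.pi) :=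
  (pi_univ_Icc _ _).symm

theorem mem_cube_iff {σ : Fin n → ℝ} : σ ∈ cube n ↔ ∀ i, σ i ∈ Icc 0 (2 * Real.pi) := by
  rw [cube_eq_pi, mem_univ_pi]

theorem uniqueDiffOn_cube (n : ℕ) : UniqueDiffOn ℝ (cube n) := by
  rw [cube_eq_pi]
  exact UniqueDiffOn.univ_pi fun _ => uniqueDiffOn_Icc Real.two_pi_pos

theorem uniqueDiffOn_box (n : ℕ) : UniqueDiffOn ℝ (box n) :=
  (uniqueDiffOn_cube n).prod (uniqueDiffOn_Icc Real.two_pi_pos)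

theorem isCompact_box (n : ℕ) : IsCompact (box n) := (isCompact_cube n).prod isCompact_Icc

/-- The interior of the cube. -/
def openCube (n : ℕ) : Set (Fin n → ℝ) := Set.pi univ fun _ => Ioo 0 (2 * Real.pi)

theorem isOpen_openCube (n : ℕ) : IsOpen (openCube n) :=
  isOpen_set_pi finite_univ fun _ _ => isOpen_Ioo

theorem openCube_subset_cube (n : ℕ) : openCube n ⊆ cube n := fun _ h =>
  mem_cube_iff.2 fun i => Ioo_subset_Icc_self (h i (mem_univ i))

theorem mem_openCube_or_mem_cubeBoundary {σ : Fin n → ℝ} (h : σ ∈ cube n) :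
    σ ∈ openCube n ∨ σ ∈ cubeBoundary n := by
  by_cases hb : ∃ i, σ i = 0 ∨ σ i = 2 * Real.pi
  · exact Or.inr ⟨h, hb⟩
  · push Not at hb
    exact Or.inl fun i _ => ⟨lt_of_le_of_ne (mem_cube_iff.1 h i).1 (Ne.symm (hb i).1),
      lt_of_le_of_ne (mem_cube_iff.1 h i).2 (hb i).2⟩

theorem notMem_openCube_of_mem_cubeBoundary {σ : Fin n → ℝ} (h : σ ∈ cubeBoundary n) :
    σ ∉ openCube n := by
  obtain ⟨-, i, hi⟩ := h
  intro hσ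
  rcases hi with hi | hi
  · exact (hσ i (mem_univ i)).1.ne' hi
  · exact (hσ i (mem_univ i)).2.ne hi

/-- The coordinate directions `∂/∂τ, ∂/∂σ¹, …, ∂/∂σⁿ`. -/
def coordVec (n : ℕ) : Fin (n + 1) → (Fin n → ℝ) × ℝ :=
  Fin.cons (0, 1) fun i => (Pi.single i 1, 0)

end Box

/-! ### Vector fields along maps, and the density of a loop of `n`-loops. -/

section VectorFieldsAlong

variable {E : Type*} [NormedAddCommGroup E] [NormedSpace ℝ E]
  {M : Type*} [TopologicalSpace M] [ChartedSpace E M] [IsManifold 𝓘(ℝ, E) ∞ M]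
  {X : Type*} [NormedAddCommGroup X] [NormedSpace ℝ X]
  {Y : Type*} [NormedAddCommGroup Y] [NormedSpace ℝ Y]

theorem HasMDer.comp_hasFDerivWithinAt {f : X → M} {L : X →L[ℝ] E} {S : Set X} {H : Y → X}
    {H' : Y →L[ℝ] X} {T : Set Y} {y : Y} (hf : HasMDer f L S (H y))
    (hH : HasFDerivWithinAt H H' T y) (hm : MapsTo H T S) :
    HasMDer (fun y => f (H y)) (L.comp H') T y :=
  HasMFDerivWithinAt.comp y hf hH.hasMFDerivWithinAt hm

theorem contMDiffOn_tangentBundle_mk {j w : Y → X} {S : Set Y} (hj : ContDiffOn ℝ ∞ j S)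
    (hw : ContDiffOn ℝ ∞ w S) : ContMDiffOn 𝓘(ℝ, Y) 𝓘(ℝ, X).tangent ∞
      (fun y => (⟨j y, w y⟩ : TangentBundle 𝓘(ℝ, X) X)) S := by
  intro y hy
  refine (Bundle.contMDiffWithinAt_totalSpace (F := X)
    (E := (TangentSpace 𝓘(ℝ, X) : X → Type _))).2 ⟨(hj y hy).contMDiffWithinAt, ?_⟩
  refine ((hw y hy).contMDiffWithinAt).congr (fun z _ => ?_) ?_
  · simp
  · simp

theorem contMDiffOn_mfderivWithin_along {f : X → M} {S : Set X} (hS : UniqueDiffOn ℝ S)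
    (hf : ContMDiffOn 𝓘(ℝ, X) 𝓘(ℝ, E) ∞ f S) {j w : Y → X} {T : Set Y}
    (hj : ContDiffOn ℝ ∞ j T) (hw : ContDiffOn ℝ ∞ w T) (hm : MapsTo j T S) :
    ContMDiffOn 𝓘(ℝ, Y) 𝓘(ℝ, E).tangent ∞
      (fun y => (⟨f (j y), mfderivWithin 𝓘(ℝ, X) 𝓘(ℝ, E) f S (j y) (w y)⟩ :
        TangentBundle 𝓘(ℝ, E) M)) T :=
  (hf.contMDiffOn_tangentMapWithin (m := ∞) le_rfl hS.uniqueMDiffOn).comp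
    (contMDiffOn_tangentBundle_mk hj hw) hm

end VectorFieldsAlong

section Density

variable {E : Type*} [NormedAddCommGroup E] [NormedSpace ℝ E]
  {EG : Type*} [NormedAddCommGroup EG] [NormedSpace ℝ EG] [CompleteSpace EG]
  {EP : Type*} [NormedAddCommGroup EP] [NormedSpace ℝ EP]
  {M : Type*} [TopologicalSpace M] [ChartedSpace E M] [IsManifold 𝓘(ℝ, E) ∞ M]
  {G : Type*} [TopologicalSpace G] [ChartedSpace EG G] [Group G] [LieGroup 𝓘(ℝ, EG) ∞ G]
  {P : Type*} [TopologicalSpace P] [ChartedSpace EP P] [IsManifold 𝓘(ℝ, EP) ∞ P]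
  {π : PrincipalBundle E EG EP M G P} {n : ℕ}

/-- The derivative of a map on the box, with values in the model space. -/
def boxDeriv (Γ : (Fin n → ℝ) × ℝ → M) (z : (Fin n → ℝ) × ℝ) : (Fin n → ℝ) × ℝ →L[ℝ] E :=
  mfderivWithin 𝓘(ℝ, (Fin n → ℝ) × ℝ) 𝓘(ℝ, E) Γ (box n) z

theorem hasMDer_boxDeriv {Γ : (Fin n → ℝ) × ℝ → M}
    (hΓ : ContMDiffOn 𝓘(ℝ, (Fin n → ℝ) × ℝ) 𝓘(ℝ, E) ∞ Γ (box n)) {z : (Fin n → ℝ) × ℝ}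
    (hz : z ∈ box n) : HasMDer Γ (boxDeriv Γ z : (Fin n → ℝ) × ℝ →L[ℝ] E) (box n) z :=
  ((hΓ z hz).mdifferentiableWithinAt (by simp)).hasMFDerivWithinAt

/-- The coefficient of the pullback to the box of the form `B` in the frames `s`. -/
def AdjointForm.density (B : AdjointForm π (n + 1)) (s : M → P) (Γ : (Fin n → ℝ) × ℝ → M)
    (z : (Fin n → ℝ) × ℝ) : EG :=
  B.inFrame (s (Γ z)) fun j => (boxDeriv Γ z : _ →L[ℝ] E) (coordVec n j)

theorem AdjointForm.continuousOn_density (B : AdjointForm π (n + 1)) {s : M → P}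
    (hsc : Continuous s) (hs : ∀ y, π.proj (s y) = y) {Γ : (Fin n → ℝ) × ℝ → M}
    (hΓ : ContMDiffOn 𝓘(ℝ, (Fin n → ℝ) × ℝ) 𝓘(ℝ, E) ∞ Γ (box n)) :
    ContinuousOn (B.density s Γ) (box n) := fun z hz =>
  B.continuousWithinAt_inFrame hsc hs (hΓ.continuousOn z hz) fun i =>
    (contMDiffOn_mfderivWithin_along (uniqueDiffOn_box n) hΓ (j := id) (w := fun _ => coordVec n i)
      contDiffOn_id contDiffOn_const (mapsTo_id _)).continuousOn z hz

theorem AdjointForm.density_comp (B : AdjointForm π (n + 1)) (s : M → P)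
    {Γ : (Fin n → ℝ) × ℝ → M} (hΓ : ContMDiffOn 𝓘(ℝ, (Fin n → ℝ) × ℝ) 𝓘(ℝ, E) ∞ Γ (box n))
    {H : (Fin n → ℝ) × ℝ → (Fin n → ℝ) × ℝ} {H' : (Fin n → ℝ) × ℝ →L[ℝ] (Fin n → ℝ) × ℝ}
    {z : (Fin n → ℝ) × ℝ} (hz : z ∈ box n) (hm : MapsTo H (box n) (box n))
    (hH : HasFDerivWithinAt H H' (box n) z) :
    B.density s (fun z => Γ (H z)) z =
      B.inFrame (s (Γ (H z))) fun j => (boxDeriv Γ (H z) : _ →L[ℝ] E) (H' (coordVec n j)) := by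
  have h1 := (hasMDer_boxDeriv hΓ (hm hz)).comp_hasFDerivWithinAt hH hm
  have h2 : (boxDeriv (fun z => Γ (H z)) z : _ →L[ℝ] E) = (boxDeriv Γ (H z)).comp H' :=
    HasMFDerivWithinAt.mfderivWithin h1 (uniqueDiffOn_box n z hz).uniqueMDiffWithinAt
  rw [AdjointForm.density, h2]
  rfl

/-- Change of the density under a map of the box of the form `(σ, τ) ↦ (σ, g(σ, τ))`. -/
theorem AdjointForm.density_comp_shear (B : AdjointForm π (n + 1)) (s : M → P)
    {Γ : (Fin n → ℝ) × ℝ → M} (hΓ : ContMDiffOn 𝓘(ℝ, (Fin n → ℝ) × ℝ) 𝓘(ℝ, E) ∞ Γ (box n))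
    {g : (Fin n → ℝ) × ℝ → ℝ} {g' : (Fin n → ℝ) × ℝ →L[ℝ] ℝ}
    {z : (Fin n → ℝ) × ℝ} (hz : z ∈ box n) (hm : MapsTo g (box n) (Icc 0 (2 * Real.pi)))
    (hg : HasFDerivWithinAt g g' (box n) z) :
    B.density s (fun z => Γ (z.1, g z)) z = g' (0, 1) • B.density s Γ (z.1, g z) := by
  rw [B.density_comp s hΓ (H := fun z => (z.1, g z)) hz (fun w hw => ⟨hw.1, hm hw⟩)
    ((hasFDerivAt_fst.hasFDerivWithinAt).prodMk hg)]
  rw [AdjointForm.density]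
  set D : (Fin n → ℝ) × ℝ →L[ℝ] E := boxDeriv Γ (z.1, g z) with hD
  have h1 : (fun j => D (coordVec n j)) = Fin.cons (D (0, 1)) fun i => D (Pi.single i 1, 0) := by
    ext i
    refine Fin.cases ?_ (fun i => ?_) i <;> simp [coordVec]
  -- The last coordinate `g` changes each `∂_i Γ` only by a multiple of `∂_τ Γ`, which alternation
  -- removes; what remains is the factor `∂_τ g`.
  rw [h1, ← alternating_shear _ _ _ _ fun i => g' (Pi.single i 1, 0)]
  congr 1
  ext i
  refine Fin.cases ?_ (fun i => ?_) i
  · simp only [coordVec, Fin.cons_zero, ← map_smul]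
    congr 1
    simp
  · simp only [coordVec, Fin.cons_succ, ← map_smul, ← map_add]
    congr 1
    simp

theorem IsLoopOfNLoops.isNLoop_graph {x₀ : M} {Γ : (Fin n → ℝ) × ℝ → M}
    (hΓ : IsLoopOfNLoops (E := E) x₀ Γ) {f : (Fin n → ℝ) → ℝ} (hf : ContDiffOn ℝ ∞ f (cube n))
    (hm : MapsTo f (cube n) (Icc 0 (2 * Real.pi))) :
    IsNLoop (E := E) x₀ (fun σ => Γ (σ, f σ)) where
  smooth := hΓ.smooth.comp (contDiffOn_id.prodMk hf).contMDiffOn fun _ hσ => ⟨hσ, hm hσ⟩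
  boundary σ hσ := hΓ.boundary σ hσ _ (hm hσ.1)

theorem IsLoopOfNLoops.isDeformation_graph {x₀ : M} {Γ : (Fin n → ℝ) × ℝ → M}
    (hΓ : IsLoopOfNLoops (E := E) x₀ Γ) {f c : (Fin n → ℝ) → ℝ} (hf : ContDiffOn ℝ ∞ f (cube n))
    (hm : MapsTo f (cube n) (Icc 0 (2 * Real.pi))) (hc : ContDiffOn ℝ ∞ c (cube n))
    (hc0 : ∀ σ ∈ cubeBoundary n, c σ = 0) :
    IsDeformation (E := E) (fun σ => Γ (σ, f σ))
      (fun σ => (boxDeriv Γ (σ, f σ) : _ →L[ℝ] E) (0, c σ)) where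
  smooth := contMDiffOn_mfderivWithin_along (uniqueDiffOn_box n) hΓ.smooth
    (contDiffOn_id.prodMk hf) (contDiffOn_const.prodMk hc) fun σ hσ => ⟨hσ, hm hσ⟩
  boundary σ hσ := by
    rw [hc0 σ hσ]
    exact map_zero (boxDeriv Γ (σ, f σ) : _ →L[ℝ] E)

end Density

/-! ### Integrals over the cube and the box. -/

section Integrals

variable {F : Type*} [NormedAddCommGroup F] [NormedSpace ℝ F] {n : ℕ}

/-- The retraction of the space onto the box. -/
def boxClamp (n : ℕ) (z : (Fin n → ℝ) × ℝ) : (Fin n → ℝ) × ℝ :=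
  (fun i => max 0 (min (2 * Real.pi) (z.1 i)), max 0 (min (2 * Real.pi) z.2))

theorem continuous_boxClamp (n : ℕ) : Continuous (boxClamp n) := by
  unfold boxClamp
  fun_prop

theorem clamp_mem (x : ℝ) : max 0 (min (2 * Real.pi) x) ∈ Icc 0 (2 * Real.pi) :=
  ⟨le_max_left _ _, max_le Real.two_pi_pos.le (min_le_left _ _)⟩

theorem clamp_eq {x : ℝ} (hx : x ∈ Icc 0 (2 * Real.pi)) : max 0 (min (2 * Real.pi) x) = x := by
  rw [min_eq_right hx.2, max_eq_right hx.1]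

theorem boxClamp_mem (z : (Fin n → ℝ) × ℝ) : boxClamp n z ∈ box n :=
  ⟨mem_cube_iff.2 fun _ => clamp_mem _, clamp_mem _⟩

theorem boxClamp_eq {z : (Fin n → ℝ) × ℝ} (hz : z ∈ box n) : boxClamp n z = z := by
  refine Prod.ext (funext fun i => clamp_eq (mem_cube_iff.1 hz.1 i)) (clamp_eq hz.2)

theorem continuousOn_integral_cube {f : (Fin n → ℝ) × ℝ → F} (hf : ContinuousOn f (box n)) :
    ContinuousOn (fun τ => ∫ σ in cube n, f (σ, τ)) (Icc 0 (2 * Real.pi)) := by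
  -- Composition with the retraction makes the integrand continuous everywhere without changing it
  -- on the box.
  have h1 : Continuous (fun z => f (boxClamp n z)) :=
    hf.comp_continuous (continuous_boxClamp n) boxClamp_mem
  have h2 : Continuous (fun τ : ℝ => ∫ σ in cube n, f (boxClamp n (σ, τ))) :=
    continuous_parametric_integral_of_continuous (f := fun τ σ => f (boxClamp n (σ, τ)))
      (by exact h1.comp continuous_swap) (isCompact_cube n)
  refine h2.continuousOn.congr fun τ hτ => ?_
  refine setIntegral_congr_fun (isCompact_cube n).measurableSet fun σ hσ => ?_
  rw [boxClamp_eq ⟨hσ, hτ⟩]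

theorem integral_integral_cube {f : (Fin n → ℝ) × ℝ → F} (hf : ContinuousOn f (box n)) :
    ∫ τ in (0 : ℝ)..(2 * Real.pi), ∫ σ in cube n, f (σ, τ) = ∫ z in box n, f z := by
  have h1 : ContinuousOn (fun z : ℝ × (Fin n → ℝ) => f z.swap) (Icc 0 (2 * Real.pi) ×ˢ cube n) :=
    hf.comp continuous_swap.continuousOn fun z hz => ⟨hz.2, hz.1⟩
  rw [intervalIntegral.integral_of_le Real.two_pi_pos.le, ← integral_Icc_eq_integral_Ioc]
  exact (setIntegral_prod _ (h1.integrableOn_compact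
    (isCompact_Icc.prod (isCompact_cube n)))).symm.trans
    (setIntegral_prod_swap (μ := volume) (ν := volume) (cube n) (Icc 0 (2 * Real.pi)) f)

/-- The fundamental lemma of the calculus of variations, in the form that localizes an integral
identity to a point. `L` will be a bracket with a fixed element, in either slot. -/
theorem eq_zero_of_forall_integral_smul_eq_zero [CompleteSpace F] {f : (Fin n → ℝ) → F}
    (hf : ContinuousOn f (cube n)) {U : Set (Fin n → ℝ)} (hU : IsOpen U) (hUc : U ⊆ cube n)
    (L : F →L[ℝ] F)
    (h : ∀ φ : (Fin n → ℝ) → ℝ, ContDiff ℝ ∞ φ → HasCompactSupport φ → tsupport φ ⊆ U →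
      L (∫ σ in cube n, φ σ • f σ) = 0) {σ : Fin n → ℝ} (hσ : σ ∈ U) : L (f σ) = 0 := by
  have hLf : ContinuousOn (fun σ => L (f σ)) (cube n) := L.continuous.comp_continuousOn hf
  have hae := hU.ae_eq_zero_of_integral_contDiff_smul_eq_zero (μ := volume)
    (f := fun σ => L (f σ))
    ((hLf.mono hUc).locallyIntegrableOn hU.measurableSet) fun φ hφ hφc hφU => by
      have h1 := h φ hφ hφc hφU
      have hint : IntegrableOn (fun σ => φ σ • f σ) (cube n) :=
        (hφ.continuous.continuousOn.smul hf).integrableOn_compact (isCompact_cube n)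
      have h2 := L.integral_comp_comm hint
      rw [h1] at h2
      simp only [map_smul] at h2
      rw [← h2]
      refine (setIntegral_eq_integral_of_forall_compl_eq_zero fun x hx => ?_).symm
      rw [image_eq_zero_of_notMem_tsupport fun h => hx (hUc (hφU h)), zero_smul]
  have h3 : (fun σ => L (f σ)) =ᵐ[volume.restrict U] fun _ => 0 :=
    (ae_restrict_iff' hU.measurableSet).2 hae
  exact Measure.eqOn_open_of_ae_eq h3 hU (hLf.mono hUc) continuousOn_const hσ

/-- A smooth bump at a point of an open set. -/
theorem exists_bump {U : Set (Fin n → ℝ)} (hU : IsOpen U) {σ : Fin n → ℝ} (hσ : σ ∈ U) :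
    ∃ φ : (Fin n → ℝ) → ℝ, ContDiff ℝ ∞ φ ∧ HasCompactSupport φ ∧ tsupport φ ⊆ U ∧ φ σ = 1 ∧
      ∀ x, φ x ∈ Icc (0 : ℝ) 1 := by
  obtain ⟨f, hf1, hf2, hf3, hf4, hf5⟩ := exists_contDiff_tsupport_subset (n := ⊤) (hU.mem_nhds hσ)
  exact ⟨f, hf3, hf2, hf1, hf5, fun x => hf4 ⟨x, rfl⟩⟩

end Integrals

/-! ### From the commutation condition to commuting densities. -/

section Contraction

variable {E : Type*} [NormedAddCommGroup E] [NormedSpace ℝ E]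
  {EG : Type*} [NormedAddCommGroup EG] [NormedSpace ℝ EG] [CompleteSpace EG]
  {EP : Type*} [NormedAddCommGroup EP] [NormedSpace ℝ EP]
  {M : Type*} [TopologicalSpace M] [ChartedSpace E M] [IsManifold 𝓘(ℝ, E) ∞ M]
  {G : Type*} [TopologicalSpace G] [ChartedSpace EG G] [Group G] [LieGroup 𝓘(ℝ, EG) ∞ G]
  {P : Type*} [TopologicalSpace P] [ChartedSpace EP P] [IsManifold 𝓘(ℝ, EP) ∞ P] [T2Space P]
  {π : PrincipalBundle E EG EP M G P} {n : ℕ}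
  {A : PrincipalConnection π} {B : AdjointForm π (n + 1)} {x₀ : M} {p₀ : P}
  {γ : ((Fin n → ℝ) → M) → (Fin n → ℝ) → ℝ → M} {s : M → P}

/-- A global horizontal section with value `p₀` at `x₀`. -/
structure IsFlatFrame (A : PrincipalConnection π) (x₀ : M) (p₀ : P) (s : M → P) : Prop where
  base : s x₀ = p₀
  proj : ∀ y, π.proj (s y) = y
  horizontal : ∀ y, A.IsHorizontalAt s y

theorem IsFlatFrame.continuous (h : IsFlatFrame A x₀ p₀ s) : Continuous s :=
  continuous_iff_continuousAt.2 fun y => (h.horizontal y).1.continuousAt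

/-- The derivative of a map on the cube, with values in the model space. -/
def cubeDeriv (N : (Fin n → ℝ) → M) (σ : Fin n → ℝ) : (Fin n → ℝ) →L[ℝ] E :=
  mfderivWithin 𝓘(ℝ, Fin n → ℝ) 𝓘(ℝ, E) N (cube n) σ

/-- Here the choice of paths drops out: parallel transport along any of them ends at the value of
the flat frame. -/
theorem IsFlatFrame.contraction_eq (h : IsFlatFrame A x₀ p₀ s)
    (hγ : IsPathChoice (E := E) x₀ γ) {N : (Fin n → ℝ) → M} (hN : IsNLoop (E := E) x₀ N)
    (T : ∀ σ, TangentSpace 𝓘(ℝ, E) (N σ)) {σ : Fin n → ℝ} (hσ : σ ∈ cube n) :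
    contraction A B p₀ γ N T σ = B.inFrame (s (N σ))
      (Fin.cons (T σ : E) fun i => (cubeDeriv N σ : _ →L[ℝ] E) (Pi.single i 1)) := by
  have h1 : parallelTransport A p₀ (γ N σ) = s (N σ) := by
    rw [PrincipalConnection.parallelTransport_eq h.base h.proj h.horizontal
      (hγ.contDiff N hN σ hσ) (hγ.source N hN σ hσ), hγ.target N hN σ hσ]
  have h2 : contraction A B p₀ γ N T σ = B.inFrame (parallelTransport A p₀ (γ N σ))
      (Fin.cons (T σ : E) fun i => (cubeDeriv N σ : _ →L[ℝ] E) (Pi.single i 1)) := rfl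
  rw [h2, h1]

theorem IsFlatFrame.continuousOn_contraction (h : IsFlatFrame A x₀ p₀ s)
    (hγ : IsPathChoice (E := E) x₀ γ) {N : (Fin n → ℝ) → M} (hN : IsNLoop (E := E) x₀ N)
    {T : ∀ σ, TangentSpace 𝓘(ℝ, E) (N σ)} (hT : IsDeformation N T) :
    ContinuousOn (contraction A B p₀ γ N T) (cube n) := by
  have h1 : ContinuousOn (fun σ => B.inFrame (s (N σ)) fun j =>
      (Fin.cons (T σ : E) (fun i => (cubeDeriv N σ : _ →L[ℝ] E) (Pi.single i 1)) :
        Fin (n + 1) → E) j) (cube n) := by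
    intro σ hσ
    refine B.continuousWithinAt_inFrame h.continuous h.proj
      (v := fun j σ => (Fin.cons (T σ : E) (fun i => (cubeDeriv N σ : _ →L[ℝ] E) (Pi.single i 1)) :
        Fin (n + 1) → E) j)
      (hN.smooth.continuousOn σ hσ) fun j => ?_
    refine Fin.cases ?_ (fun i => ?_) j
    · exact hT.smooth.continuousOn σ hσ
    · exact (contMDiffOn_mfderivWithin_along (uniqueDiffOn_cube n) hN.smooth (j := id)
        (w := fun _ => Pi.single i 1) contDiffOn_id contDiffOn_const
        (mapsTo_id _)).continuousOn σ hσ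
  exact h1.congr fun σ hσ => h.contraction_eq hγ hN T hσ

/-- The partial derivatives of `σ ↦ Γ(σ, f σ)` differ from those of `Γ` by multiples of `∂_τ Γ`,
which is also the direction of the deformation, so `alternating_shear` applies. -/
theorem IsFlatFrame.contraction_graph (h : IsFlatFrame A x₀ p₀ s)
    (hγ : IsPathChoice (E := E) x₀ γ) {Γ : (Fin n → ℝ) × ℝ → M}
    (hΓ : IsLoopOfNLoops (E := E) x₀ Γ) {f : (Fin n → ℝ) → ℝ} (hf : ContDiffOn ℝ ∞ f (cube n))
    (hm : MapsTo f (cube n) (Icc 0 (2 * Real.pi))) (c : (Fin n → ℝ) → ℝ) {σ : Fin n → ℝ}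
    (hσ : σ ∈ cube n) :
    contraction (E := E) A B p₀ γ (fun σ => Γ (σ, f σ))
      (fun σ => (boxDeriv Γ (σ, f σ) : _ →L[ℝ] E) (0, c σ)) σ = c σ • B.density s Γ (σ, f σ) := by
  refine (h.contraction_eq hγ (hΓ.isNLoop_graph hf hm) _ hσ).trans ?_
  rw [AdjointForm.density]
  set D : (Fin n → ℝ) × ℝ →L[ℝ] E := boxDeriv Γ (σ, f σ) with hD
  set f' := fderivWithin ℝ f (cube n) σ with hf'
  have h1 : HasFDerivWithinAt f f' (cube n) σ :=
    ((hf σ hσ).differentiableWithinAt (by simp)).hasFDerivWithinAt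
  have h2 := (hasMDer_boxDeriv hΓ.smooth (z := (σ, f σ)) ⟨hσ, hm hσ⟩).comp_hasFDerivWithinAt
    (H := fun σ => (σ, f σ)) ((hasFDerivAt_id σ).hasFDerivWithinAt.prodMk h1)
    (fun σ hσ => ⟨hσ, hm hσ⟩)
  have h3 : (cubeDeriv (fun σ => Γ (σ, f σ)) σ : _ →L[ℝ] E) =
      D.comp ((ContinuousLinearMap.id ℝ _).prod f') :=
    HasMFDerivWithinAt.mfderivWithin h2 (uniqueDiffOn_cube n σ hσ).uniqueMDiffWithinAt
  have h4 : (fun j => D (coordVec n j)) = Fin.cons (D (0, 1)) fun i => D (Pi.single i 1, 0) := by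
    ext i
    refine Fin.cases ?_ (fun i => ?_) i <;> simp [coordVec]
  rw [h3, h4, ← alternating_shear _ _ _ _ fun i => f' (Pi.single i 1)]
  congr 1
  ext i
  refine Fin.cases ?_ (fun i => ?_) i
  · simp only [Fin.cons_zero, ← map_smul]
    congr 1
    simp
  · simp only [Fin.cons_succ, ← map_smul, ← map_add, ContinuousLinearMap.comp_apply]
    congr 1
    simp

theorem IsFlatFrame.loopConnection_eq (h : IsFlatFrame A x₀ p₀ s)
    (hγ : IsPathChoice (E := E) x₀ γ) {Γ : (Fin n → ℝ) × ℝ → M}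
    (hΓ : IsLoopOfNLoops (E := E) x₀ Γ) {τ : ℝ} (hτ : τ ∈ Icc 0 (2 * Real.pi)) :
    loopConnection A B p₀ γ (fun σ => Γ (σ, τ))
      (fun σ => mfderivWithin 𝓘(ℝ, (Fin n → ℝ) × ℝ) 𝓘(ℝ, E) Γ (box n) (σ, τ)
        ((0, 1) : (Fin n → ℝ) × ℝ)) = ∫ σ in cube n, B.density s Γ (σ, τ) := by
  refine setIntegral_congr_fun (isCompact_cube n).measurableSet fun σ hσ => ?_
  refine (h.contraction_graph (f := fun _ => τ) hγ hΓ contDiffOn_const (fun _ _ => hτ)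
    (fun _ => 1) hσ).trans (one_smul _ _)

theorem IsFlatFrame.hol_eq (h : IsFlatFrame A x₀ p₀ s)
    (hγ : IsPathChoice (E := E) x₀ γ) {Γ : (Fin n → ℝ) × ℝ → M}
    (hΓ : IsLoopOfNLoops (E := E) x₀ Γ) {U : ℝ → G}
    (hU : IsTransport (2 * Real.pi) (fun τ => ∫ σ in cube n, B.density s Γ (σ, τ)) U) :
    hol A B p₀ γ Γ = U (2 * Real.pi) :=
  (hU.congr fun _ hτ => (h.loopConnection_eq hγ hΓ hτ).symm).holonomy_eq

/-- The commutation condition for all deformations of `n`-loops forces the values of the density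
along any loop of `n`-loops to commute. -/
theorem IsFlatFrame.bracket_density_eq_zero (h : IsFlatFrame A x₀ p₀ s)
    (hγ : IsPathChoice (E := E) x₀ γ)
    (hC : ∀ N : (Fin n → ℝ) → M, IsNLoop (E := E) x₀ N →
      ∀ T : (∀ σ : Fin n → ℝ, TangentSpace 𝓘(ℝ, E) (N σ)), IsDeformation N T → ∀ σ ∈ cube n,
        bracket G (contraction A B p₀ γ N T σ) (∫ σ' in cube n, contraction A B p₀ γ N T σ') = 0)
    {Γ : (Fin n → ℝ) × ℝ → M} (hΓ : IsLoopOfNLoops (E := E) x₀ Γ) {σ₁ σ₂ : Fin n → ℝ}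
    (h₁ : σ₁ ∈ openCube n) (h₂ : σ₂ ∈ openCube n) (h₁₂ : σ₁ ≠ σ₂) {τ₁ τ₂ : ℝ}
    (hτ₁ : τ₁ ∈ Icc 0 (2 * Real.pi)) (hτ₂ : τ₂ ∈ Icc 0 (2 * Real.pi)) :
    bracketL G (B.density s Γ (σ₁, τ₁)) (B.density s Γ (σ₂, τ₂)) = 0 := by
  -- A height function `f` that interpolates from `τ₁` at `σ₁` to `τ₂` at `σ₂` puts both points of
  -- the box on the graph of one `n`-loop.
  obtain ⟨ψ, hψ, -, hψs, hψ2, hψI⟩ := exists_bump (U := {σ₁}ᶜ) isOpen_compl_singleton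
    (mem_compl_singleton_iff.2 h₁₂.symm)
  have hψ1 : ψ σ₁ = 0 := image_eq_zero_of_notMem_tsupport fun h => hψs h rfl
  set f : (Fin n → ℝ) → ℝ := fun σ => τ₁ + ψ σ * (τ₂ - τ₁) with hf
  have hfs : ContDiff ℝ ∞ f := contDiff_const.add (hψ.mul contDiff_const)
  have hfm : MapsTo f (cube n) (Icc 0 (2 * Real.pi)) := fun σ _ => by
    have := (convex_Icc 0 (2 * Real.pi)).add_smul_sub_mem hτ₁ hτ₂ (hψI σ)
    simpa [hf] using this
  have hFc : ContinuousOn (fun σ => B.density s Γ (σ, f σ)) (cube n) :=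
    (B.continuousOn_density h.continuous h.proj hΓ.smooth).comp
      (continuousOn_id.prodMk hfs.continuous.continuousOn) fun σ hσ => ⟨hσ, hfm hσ⟩
  have e1 : B.density s Γ (σ₁, τ₁) = B.density s Γ (σ₁, f σ₁) := by simp [hf, hψ1]
  have e2 : B.density s Γ (σ₂, τ₂) = B.density s Γ (σ₂, f σ₂) := by simp [hf, hψ2]
  rw [e1, e2]
  have key : ∀ c : (Fin n → ℝ) → ℝ, ContDiff ℝ ∞ c → tsupport c ⊆ openCube n →
      c σ₁ • bracketL G (B.density s Γ (σ₁, f σ₁))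
        (∫ σ in cube n, c σ • B.density s Γ (σ, f σ)) = 0 := by
    intro c hc hcs
    have h3 := hC _ (hΓ.isNLoop_graph hfs.contDiffOn hfm) _
      (hΓ.isDeformation_graph hfs.contDiffOn hfm hc.contDiffOn fun σ hσ =>
        image_eq_zero_of_notMem_tsupport fun h =>
          notMem_openCube_of_mem_cubeBoundary hσ (hcs h)) σ₁ (openCube_subset_cube n h₁)
    rw [bracket_eq, h.contraction_graph hγ hΓ hfs.contDiffOn hfm c (openCube_subset_cube n h₁),
      setIntegral_congr_fun (isCompact_cube n).measurableSet fun σ hσ =>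
        h.contraction_graph hγ hΓ hfs.contDiffOn hfm c hσ, map_smul] at h3
    exact h3
  obtain ⟨η, hη, -, hηs, hη1, -⟩ := exists_bump (isOpen_openCube n) h₁
  refine eq_zero_of_forall_integral_smul_eq_zero hFc (isOpen_openCube n) (openCube_subset_cube n)
    (bracketL G (B.density s Γ (σ₁, f σ₁))) (fun c hc hcc hcs => ?_) h₂
  have k1 := key η hη hηs
  -- The factor `c σ₁` in `key` may vanish. Adding a multiple of `η` normalizes the value at `σ₁` to
  -- `1`, and `k1` removes the contribution of `η` to the integral.
  have k2 := key (fun σ => c σ + (1 - c σ₁) * η σ) (hc.add (contDiff_const.mul hη))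
    ((tsupport_add _ _).trans (union_subset hcs ((tsupport_mul_subset_right).trans hηs)))
  have hint : ∀ φ : (Fin n → ℝ) → ℝ, ContDiff ℝ ∞ φ →
      IntegrableOn (fun σ => φ σ • B.density s Γ (σ, f σ)) (cube n) := fun φ hφ =>
    (hφ.continuous.continuousOn.smul hFc).integrableOn_compact (isCompact_cube n)
  have hsplit : ∫ σ in cube n, (c σ + (1 - c σ₁) * η σ) • B.density s Γ (σ, f σ) =
      (∫ σ in cube n, c σ • B.density s Γ (σ, f σ)) +
        (1 - c σ₁) • ∫ σ in cube n, η σ • B.density s Γ (σ, f σ) := by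
    have h4 := integral_add (hint c hc) ((hint η hη).smul (1 - c σ₁))
    rw [← integral_smul]
    refine Eq.trans ?_ h4
    simp only [add_smul, mul_smul, Pi.smul_apply]
  rw [hη1, one_smul] at k1
  rw [hsplit, hη1, map_add, map_smul, k1] at k2
  simpa using k2

/-- Two cases are left over from distinct interior points. On the lateral boundary the loop rests at
`x₀`, so `∂_τ Γ` and the density vanish. For equal `σ` and different times one `σ` is moved slightly
and continuity is used. -/
theorem IsFlatFrame.bracket_density_eq_zero_box (hn : 1 ≤ n) (h : IsFlatFrame A x₀ p₀ s)
    {Γ : (Fin n → ℝ) × ℝ → M} (hΓ : IsLoopOfNLoops (E := E) x₀ Γ)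
    (hcomm : ∀ σ₁ ∈ openCube n, ∀ σ₂ ∈ openCube n, σ₁ ≠ σ₂ → ∀ τ₁ ∈ Icc 0 (2 * Real.pi),
      ∀ τ₂ ∈ Icc 0 (2 * Real.pi),
        bracketL G (B.density s Γ (σ₁, τ₁)) (B.density s Γ (σ₂, τ₂)) = 0)
    {z z' : (Fin n → ℝ) × ℝ} (hz : z ∈ box n) (hz' : z' ∈ box n) :
    bracketL G (B.density s Γ z) (B.density s Γ z') = 0 := by
  have hb : ∀ σ ∈ cubeBoundary n, ∀ τ ∈ Icc 0 (2 * Real.pi), B.density s Γ (σ, τ) = 0 := by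
    intro σ hσ τ hτ
    have h1 : HasMDer (fun t : ℝ => Γ (σ, t))
        ((boxDeriv Γ (σ, τ) : _ →L[ℝ] E).comp (ContinuousLinearMap.inr ℝ _ _))
        (Icc 0 (2 * Real.pi)) τ :=
      (hasMDer_boxDeriv hΓ.smooth (z := (σ, τ)) ⟨hσ.1, hτ⟩).comp_hasFDerivWithinAt
        (H := fun t => (σ, t)) (hasFDerivAt_prodMk_right σ τ).hasFDerivWithinAt
        fun t ht => ⟨hσ.1, ht⟩
    have h2 : HasMDer (fun _ : ℝ => x₀) (0 : ℝ →L[ℝ] E) (Icc 0 (2 * Real.pi)) τ :=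
      hasMFDerivWithinAt_const _ _ _
    have h3 := h1.unique (h2.congr (fun t ht => hΓ.boundary σ hσ t ht) (hΓ.boundary σ hσ τ hτ))
      (uniqueDiffOn_Icc Real.two_pi_pos τ hτ)
    refine (B.inFrame _).map_coord_zero 0 ?_
    have h4 := DFunLike.congr_fun h3 1
    simpa [coordVec] using h4
  obtain ⟨σ, τ⟩ := z
  obtain ⟨σ', τ'⟩ := z'
  rcases mem_openCube_or_mem_cubeBoundary hz.1 with hσ | hσ
  swap
  · rw [hb σ hσ τ hz.2, map_zero, zero_apply]
  rcases mem_openCube_or_mem_cubeBoundary hz'.1 with hσ' | hσ'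
  swap
  · rw [hb σ' hσ' τ' hz'.2, map_zero]
  by_cases hne : σ = σ'
  swap
  · exact hcomm σ hσ σ' hσ' hne τ hz.2 τ' hz'.2
  subst hne
  -- With `1 ≤ n` the cube has no isolated points, so the punctured limit below determines the
  -- value.
  have : Nonempty (Fin n) := ⟨⟨0, hn⟩⟩
  have hc : ContinuousAt (fun σ₁ => bracketL G (B.density s Γ (σ₁, τ)) (B.density s Γ (σ, τ')))
      σ := by
    have h1 : ContinuousOn (fun σ₁ => B.density s Γ (σ₁, τ)) (openCube n) :=
      (B.continuousOn_density h.continuous h.proj hΓ.smooth).comp (by fun_prop)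
        fun σ hσ => ⟨openCube_subset_cube n hσ, hz.2⟩
    have h2 := h1.continuousAt ((isOpen_openCube n).mem_nhds hσ)
    exact ((bracketL G).continuous.continuousAt.comp h2).clm_apply continuousAt_const
  have h1 : Tendsto (fun σ₁ => bracketL G (B.density s Γ (σ₁, τ)) (B.density s Γ (σ, τ')))
      (𝓝[≠] σ) (𝓝 0) := by
    refine tendsto_const_nhds.congr' ?_
    filter_upwards [nhdsWithin_le_nhds ((isOpen_openCube n).mem_nhds hσ), self_mem_nhdsWithin]
      with σ₁ h₁ h₂
    exact (hcomm σ₁ h₁ σ hσ h₂ τ hz.2 τ' hz'.2).symm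
  exact tendsto_nhds_unique (hc.tendsto.mono_left nhdsWithin_le_nhds) h1

end Contraction

/-! ### Jacobians of box diffeomorphisms, and r-flatness from commuting densities. -/

section Determinant

variable {F : Type*} [NormedAddCommGroup F] [NormedSpace ℝ F] {n : ℕ}

/-- The coordinate directions form a basis. -/
def coordBasis (n : ℕ) : Module.Basis (Fin (n + 1)) ℝ ((Fin n → ℝ) × ℝ) :=
  Module.Basis.ofEquivFun ((LinearEquiv.prodComm ℝ (Fin n → ℝ) ℝ).trans
    (Fin.consLinearEquiv ℝ fun _ : Fin (n + 1) => ℝ))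

theorem coordBasis_apply (i : Fin (n + 1)) : coordBasis n i = coordVec n i := by
  rw [coordBasis, Module.Basis.coe_ofEquivFun, LinearEquiv.symm_apply_eq]
  ext j
  refine Fin.cases ?_ (fun i => ?_) i <;> refine Fin.cases ?_ (fun j => ?_) j <;>
    simp [coordVec, Fin.consLinearEquiv, Fin.consEquiv, Pi.single_apply]

/-- Forms of top degree are multiples of the determinant form of the basis, which `L` scales by its
determinant. -/
theorem alternating_comp_basis {V : Type*} [AddCommGroup V] [Module ℝ V] {k : ℕ}
    (e : Module.Basis (Fin k) ℝ V) (f : V [⋀^Fin k]→ₗ[ℝ] F) (L : V →ₗ[ℝ] V) :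
    f (fun i => L (e i)) = LinearMap.det L • f e := by
  have h1 : f = (LinearMap.toSpanSingleton ℝ F (f e)).compAlternatingMap e.det := by
    refine Module.Basis.ext_alternating e fun v hv => ?_
    set τ : Equiv.Perm (Fin k) := Equiv.ofBijective v (Finite.injective_iff_bijective.1 hv)
    have h2 : (fun i => e (v i)) = (fun i => e i) ∘ τ := rfl
    rw [h2, AlternatingMap.map_perm, AlternatingMap.map_perm]
    congr 1
    simp [e.det_self]
  have h3 : e.det (fun i => L (e i)) = LinearMap.det L := by
    have := e.det_comp L e
    rwa [e.det_self, mul_one] at this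
  conv_lhs => rw [h1]
  simp only [LinearMap.compAlternatingMap_apply, LinearMap.toSpanSingleton_apply, h3]

theorem IsBoxDiffeo.det_ne_zero {h : (Fin n → ℝ) × ℝ → (Fin n → ℝ) × ℝ} (hh : IsBoxDiffeo n h)
    {z : (Fin n → ℝ) × ℝ} (hz : z ∈ box n) : (fderivWithin ℝ h (box n) z).det ≠ 0 := by
  obtain ⟨k, hk, hks, hkl, -⟩ := hh.inverse
  have h1 := ((hh.smooth z hz).differentiableWithinAt (by simp)).hasFDerivWithinAt
  have h2 := ((hks _ (hh.mapsTo hz)).differentiableWithinAt (by simp)).hasFDerivWithinAt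
  have h3 := (h2.comp z h1 hh.mapsTo).congr (f₁ := id) (fun w hw => (hkl hw).symm) (hkl hz).symm
  have h4 := (uniqueDiffOn_box n z hz).eq h3 (hasFDerivAt_id z).hasFDerivWithinAt
  set K := fderivWithin ℝ k (box n) (h z)
  set L := fderivWithin ℝ h (box n) z
  have h5 : LinearMap.det ((K : _ →ₗ[ℝ] (Fin n → ℝ) × ℝ) ∘ₗ (L : _ →ₗ[ℝ] (Fin n → ℝ) × ℝ)) = 1 :=
    (congrArg ContinuousLinearMap.det h4).trans LinearMap.det_id
  rw [LinearMap.det_comp] at h5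
  exact right_ne_zero_of_mul (h5.trans_ne one_ne_zero)

theorem IsReparametrization.isBoxDiffeo {h : (Fin n → ℝ) × ℝ → (Fin n → ℝ) × ℝ}
    (hh : IsReparametrization n h) : IsBoxDiffeo n h := by
  obtain ⟨H, -, hH, -, hH1⟩ := hh
  have h1 := hH 1 ⟨zero_le_one, le_rfl⟩
  obtain ⟨k, hk, hks, hkl, hkr⟩ := h1.inverse
  refine ⟨fun z hz => hH1 hz ▸ h1.mapsTo hz, h1.smooth.congr fun z hz => (hH1 hz).symm,
    ⟨k, hk, hks, fun z hz => ?_, fun z hz => ?_⟩, fun z hz => (hH1 hz.1).symm.trans (h1.boundary hz)⟩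
  · rw [← hH1 hz]
    exact hkl hz
  · rw [← hH1 (hk hz)]
    exact hkr hz

/-- Along the isotopy the Jacobian at `z` is continuous, equals `1` at the start, and never
vanishes. -/
theorem IsReparametrization.det_pos {h : (Fin n → ℝ) × ℝ → (Fin n → ℝ) × ℝ}
    (hh : IsReparametrization n h) {z : (Fin n → ℝ) × ℝ} (hz : z ∈ box n) :
    0 < (fderivWithin ℝ h (box n) z).det := by
  obtain ⟨H, hHs, hH, hH0, hH1⟩ := hh
  set S : Set (ℝ × ((Fin n → ℝ) × ℝ)) := Icc 0 1 ×ˢ box n with hS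
  set K : ℝ × ((Fin n → ℝ) × ℝ) → (Fin n → ℝ) × ℝ := fun w => H w.1 w.2 with hK
  have hSu : UniqueDiffOn ℝ S := (uniqueDiffOn_Icc zero_lt_one).prod (uniqueDiffOn_box n)
  have hcont : ContinuousOn (fun s => fderivWithin ℝ K S (s, z)) (Icc 0 1) :=
    (hHs.continuousOn_fderivWithin hSu (by simp)).comp (by fun_prop) fun s hs => ⟨hs, hz⟩
  have heq : ∀ s ∈ Icc (0 : ℝ) 1, fderivWithin ℝ (H s) (box n) z =
      (fderivWithin ℝ K S (s, z)).comp (ContinuousLinearMap.inr ℝ _ _) := fun s hs => by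
    have h1 := ((hHs (s, z) ⟨hs, hz⟩).differentiableWithinAt (by simp)).hasFDerivWithinAt
    have h2 := h1.comp z (hasFDerivAt_prodMk_right s z).hasFDerivWithinAt
      (t := S) (s := box n) fun w hw => ⟨hs, hw⟩
    exact h2.fderivWithin (uniqueDiffOn_box n z hz)
  have hd : ContinuousOn (fun s => (fderivWithin ℝ (H s) (box n) z).det) (Icc 0 1) := by
    refine ContinuousLinearMap.continuous_det.comp_continuousOn ?_
    exact (hcont.clm_comp continuousOn_const).congr heq
  have h0 : (fderivWithin ℝ (H 0) (box n) z).det = 1 := by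
    rw [fderivWithin_congr hH0 (hH0 hz), fderivWithin_id (uniqueDiffOn_box n z hz)]
    simp [ContinuousLinearMap.det]
  have h1 : fderivWithin ℝ (H 1) (box n) z = fderivWithin ℝ h (box n) z :=
    fderivWithin_congr hH1 (hH1 hz)
  rw [← h1]
  by_contra! hneg
  obtain ⟨s, hs, hs0⟩ := intermediate_value_Icc' zero_le_one hd
    (⟨hneg, by rw [h0]; exact zero_le_one⟩ : (0 : ℝ) ∈ Icc _ _)
  exact (hH s hs).det_ne_zero hz hs0

end Determinant

section Reparametrization

variable {E : Type*} [NormedAddCommGroup E] [NormedSpace ℝ E]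
  {EG : Type*} [NormedAddCommGroup EG] [NormedSpace ℝ EG] [CompleteSpace EG]
  {EP : Type*} [NormedAddCommGroup EP] [NormedSpace ℝ EP]
  {M : Type*} [TopologicalSpace M] [ChartedSpace E M] [IsManifold 𝓘(ℝ, E) ∞ M]
  {G : Type*} [TopologicalSpace G] [ChartedSpace EG G] [Group G] [LieGroup 𝓘(ℝ, EG) ∞ G]
  {P : Type*} [TopologicalSpace P] [ChartedSpace EP P] [IsManifold 𝓘(ℝ, EP) ∞ P] [T2Space P]
  {π : PrincipalBundle E EG EP M G P} {n : ℕ}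
  {A : PrincipalConnection π} {B : AdjointForm π (n + 1)} {x₀ : M} {p₀ : P}
  {γ : ((Fin n → ℝ) → M) → (Fin n → ℝ) → ℝ → M} {s : M → P}

theorem IsLoopOfNLoops.comp {Γ : (Fin n → ℝ) × ℝ → M} (hΓ : IsLoopOfNLoops (E := E) x₀ Γ)
    {h : (Fin n → ℝ) × ℝ → (Fin n → ℝ) × ℝ} (hh : IsBoxDiffeo n h) :
    IsLoopOfNLoops (E := E) x₀ (fun z => Γ (h z)) where
  smooth := hΓ.smooth.comp hh.smooth.contMDiffOn hh.mapsTo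
  boundary σ hσ τ hτ := by
    rw [hh.boundary ⟨⟨hσ.1, hτ⟩, Or.inl hσ⟩]
    exact hΓ.boundary σ hσ τ hτ
  closed σ hσ := by
    rw [hh.boundary ⟨⟨hσ, right_mem_Icc.2 Real.two_pi_pos.le⟩, Or.inr (Or.inr rfl)⟩,
      hh.boundary ⟨⟨hσ, left_mem_Icc.2 Real.two_pi_pos.le⟩, Or.inr (Or.inl rfl)⟩]
    exact hΓ.closed σ hσ

theorem AdjointForm.density_comp_det (B : AdjointForm π (n + 1)) (s : M → P)
    {Γ : (Fin n → ℝ) × ℝ → M} (hΓ : ContMDiffOn 𝓘(ℝ, (Fin n → ℝ) × ℝ) 𝓘(ℝ, E) ∞ Γ (box n))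
    {H : (Fin n → ℝ) × ℝ → (Fin n → ℝ) × ℝ} {H' : (Fin n → ℝ) × ℝ →L[ℝ] (Fin n → ℝ) × ℝ}
    {z : (Fin n → ℝ) × ℝ} (hz : z ∈ box n) (hm : MapsTo H (box n) (box n))
    (hH : HasFDerivWithinAt H H' (box n) z) :
    B.density s (fun z => Γ (H z)) z = H'.det • B.density s Γ (H z) := by
  rw [B.density_comp s hΓ hz hm hH]
  have h1 := alternating_comp_basis (coordBasis n)
    ((B.inFrame (s (Γ (H z)))).compContinuousLinearMap
      (boxDeriv Γ (H z) : _ →L[ℝ] E)).toAlternatingMap (H' : _ →ₗ[ℝ] _)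
  have h2 : (coordBasis n : Fin (n + 1) → (Fin n → ℝ) × ℝ) = coordVec n := funext coordBasis_apply
  rw [h2] at h1
  exact h1

theorem bracketL_integral_integral_eq_zero {Y : Type*} [MeasurableSpace Y] {μ : Measure Y}
    {f g : Y → EG} (hf : Integrable f μ) (hg : Integrable g μ) {S : Set Y} (hS : ∀ᵐ y ∂μ, y ∈ S)
    (h : ∀ y ∈ S, ∀ y' ∈ S, bracketL G (f y) (g y') = 0) :
    bracketL G (∫ y, f y ∂μ) (∫ y, g y ∂μ) = 0 := by
  rw [← ContinuousLinearMap.integral_comp_comm _ hg]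
  refine integral_eq_zero_of_ae (hS.mono fun y' hy' => ?_)
  have h1 := ContinuousLinearMap.integral_comp_comm ((bracketL (EG := EG) G).flip (g y')) hf
  simp only [ContinuousLinearMap.flip_apply] at h1
  change bracketL G (∫ y, f y ∂μ) (g y') = 0
  rw [← h1]
  exact integral_eq_zero_of_ae (hS.mono fun y hy => h y hy y' hy')

/-- If the values of the density along any loop of `n`-loops commute, then the connection on the
loop space is flat up to reparametrization. -/
theorem IsFlatFrame.isRFlat (h : IsFlatFrame A x₀ p₀ s) (hγ : IsPathChoice (E := E) x₀ γ)
    (hcomm : ∀ Γ : (Fin n → ℝ) × ℝ → M, IsLoopOfNLoops (E := E) x₀ Γ → ∀ z ∈ box n, ∀ z' ∈ box n,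
      bracketL G (B.density s Γ z) (B.density s Γ z') = 0) :
    IsRFlat A B x₀ p₀ γ := by
  intro Γ hΓ k hk
  have hkb := hk.isBoxDiffeo
  have hΓk := hΓ.comp hkb
  have hd : ∀ z ∈ box n, B.density s (fun z => Γ (k z)) z =
      (fderivWithin ℝ k (box n) z).det • B.density s Γ (k z) := fun z hz =>
    B.density_comp_det s hΓ.smooth hz hkb.mapsTo
      ((hkb.smooth z hz).differentiableWithinAt (by simp)).hasFDerivWithinAt
  have hc1 := B.continuousOn_density h.continuous h.proj hΓ.smooth
  have hc2 := B.continuousOn_density h.continuous h.proj hΓk.smooth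
  have hi : ∀ {f : (Fin n → ℝ) × ℝ → EG}, ContinuousOn f (box n) → ∀ t ∈ Icc 0 (2 * Real.pi),
      IntegrableOn (fun σ => f (σ, t)) (cube n) := fun hf t ht =>
    (hf.comp (f := fun σ => (σ, t)) (by fun_prop) fun σ hσ => ⟨hσ, ht⟩).integrableOn_compact
      (isCompact_cube n)
  have hmem : ∀ᵐ σ ∂(volume.restrict (cube n)), σ ∈ cube n :=
    ae_restrict_mem (isCompact_cube n).measurableSet
  -- Change of variables carries the absolute value of the Jacobian, the density the Jacobian
  -- itself; positivity makes them agree.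
  have hint : ∫ z in box n, B.density s (fun z => Γ (k z)) z = ∫ z in box n, B.density s Γ z := by
    have himg : k '' box n = box n := by
      refine subset_antisymm hkb.mapsTo.image_subset fun z hz => ?_
      obtain ⟨k', hk', -, -, hr⟩ := hkb.inverse
      exact ⟨k' z, hk' hz, hr hz⟩
    have hinj : InjOn k (box n) := by
      obtain ⟨k', -, -, hl, -⟩ := hkb.inverse
      exact hl.injOn
    have : (volume : Measure ((Fin n → ℝ) × ℝ)).IsAddHaarMeasure :=
      (inferInstance : (volume.prod volume : Measure ((Fin n → ℝ) × ℝ)).IsAddHaarMeasure)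
    have h1 := integral_image_eq_integral_abs_det_fderiv_smul (volume) (f := k)
      (isCompact_box n).measurableSet (fun z hz =>
        ((hkb.smooth z hz).differentiableWithinAt (by simp)).hasFDerivWithinAt) hinj
      (B.density s Γ)
    rw [himg] at h1
    rw [h1]
    refine setIntegral_congr_fun (isCompact_box n).measurableSet fun z hz => ?_
    rw [hd z hz, abs_of_pos (hk.det_pos hz)]
  obtain ⟨U, hU⟩ := exists_isTransport G Real.two_pi_pos.le (continuousOn_integral_cube hc1)
  obtain ⟨V, hV⟩ := exists_isTransport G Real.two_pi_pos.le (continuousOn_integral_cube hc2)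
  rw [h.hol_eq hγ hΓ hU, h.hol_eq hγ hΓk hV]
  -- Values of the reparametrized density are multiples of values of the original one, so the two
  -- coefficients commute with themselves and with each other.
  refine hV.eq_of_integral_eq Real.two_pi_pos.le (continuousOn_integral_cube hc2)
    (continuousOn_integral_cube hc1) (fun t ht t' ht' => ?_) (fun t ht t' ht' => ?_)
    (fun t ht t' ht' => ?_) ?_ hU
  · refine bracketL_integral_integral_eq_zero (hi hc2 t ht) (hi hc2 t' ht') hmem
      fun σ hσ σ' hσ' => hcomm _ hΓk _ ⟨hσ, ht⟩ _ ⟨hσ', ht'⟩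
  · refine bracketL_integral_integral_eq_zero (hi hc2 t ht) (hi hc1 t' ht') hmem
      fun σ hσ σ' hσ' => ?_
    rw [hd _ ⟨hσ, ht⟩, map_smul, smul_apply,
      hcomm _ hΓ _ (hkb.mapsTo ⟨hσ, ht⟩) _ ⟨hσ', ht'⟩, smul_zero]
  · refine bracketL_integral_integral_eq_zero (hi hc1 t ht) (hi hc1 t' ht') hmem
      fun σ hσ σ' hσ' => hcomm _ hΓ _ ⟨hσ, ht⟩ _ ⟨hσ', ht'⟩
  · rw [integral_integral_cube hc1, integral_integral_cube hc2, hint]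

end Reparametrization

/-! ### Möbius maps of the interval and the reparametrizations they generate. -/

section Moebius

/-- The Möbius transformation of `[0, 2π]` fixing the end points, with derivative `a` at `0`. -/
def moebius (a τ : ℝ) : ℝ := 2 * Real.pi * a * τ / (2 * Real.pi + (a - 1) * τ)

/-- The function `τ (2π - τ)` composed with a Möbius transformation. -/
def hump (a τ : ℝ) : ℝ :=
  4 * Real.pi ^ 2 * a * (τ * (2 * Real.pi - τ)) / (2 * Real.pi + (a - 1) * τ) ^ 2

/-- The derivative of `hump a`. -/
def humpDeriv (a τ : ℝ) : ℝ :=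
  8 * Real.pi ^ 3 * a * (2 * Real.pi - (a + 1) * τ) / (2 * Real.pi + (a - 1) * τ) ^ 3

variable {a τ : ℝ}

theorem moebius_den_pos (ha : 0 < a) (hτ : τ ∈ Icc 0 (2 * Real.pi)) :
    0 < 2 * Real.pi + (a - 1) * τ := by
  have h := Real.pi_pos
  rcases hτ.1.eq_or_lt with h0 | h0
  · rw [← h0]
    linarith
  · nlinarith [mul_pos ha h0, hτ.2]

theorem moebius_mem (ha : 0 < a) (hτ : τ ∈ Icc 0 (2 * Real.pi)) :
    moebius a τ ∈ Icc 0 (2 * Real.pi) := by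
  have h := moebius_den_pos ha hτ
  have hp := Real.pi_pos
  refine ⟨div_nonneg (by have := hτ.1; positivity) h.le, ?_⟩
  rw [moebius, div_le_iff₀ h]
  nlinarith [hτ.1, hτ.2]

theorem moebius_zero (a : ℝ) : moebius a 0 = 0 := by simp [moebius]

theorem moebius_two_pi (ha : 0 < a) : moebius a (2 * Real.pi) = 2 * Real.pi := by
  have hp := Real.pi_pos
  have h : 2 * Real.pi + (a - 1) * (2 * Real.pi) = 2 * Real.pi * a := by ring
  rw [moebius, h]
  field_simp

theorem moebius_one (τ : ℝ) : moebius 1 τ = τ := by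
  have hp := Real.pi_pos
  rw [moebius, sub_self, zero_mul, add_zero]
  field_simp

theorem moebius_inv_moebius (ha : 0 < a) (hτ : τ ∈ Icc 0 (2 * Real.pi)) :
    moebius a⁻¹ (moebius a τ) = τ := by
  have h := (moebius_den_pos ha hτ).ne'
  have hp := Real.pi_pos
  have h2 : 2 * Real.pi + (a⁻¹ - 1) * moebius a τ =
      (2 * Real.pi) ^ 2 / (2 * Real.pi + (a - 1) * τ) := by
    rw [moebius]
    generalize hd : 2 * Real.pi + (a - 1) * τ = d at h
    field_simp
    rw [← hd]
    ring
  rw [moebius, h2, moebius]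
  generalize 2 * Real.pi + (a - 1) * τ = d at h
  field_simp

theorem hump_one_moebius (a τ : ℝ) : hump 1 (moebius a τ) = hump a τ := by
  have hp := Real.pi_pos
  by_cases h : 2 * Real.pi + (a - 1) * τ = 0
  · simp [hump, moebius, h]
  · rw [hump, hump, moebius, sub_self, zero_mul, add_zero]
    generalize hd : 2 * Real.pi + (a - 1) * τ = d at h
    field_simp
    rw [← hd]
    ring

theorem hump_zero (a : ℝ) : hump a 0 = 0 := by simp [hump]

theorem hump_two_pi (a : ℝ) : hump a (2 * Real.pi) = 0 := by simp [hump]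

theorem hasDerivAt_hump (ha : 0 < a) (hτ : τ ∈ Icc 0 (2 * Real.pi)) :
    HasDerivAt (hump a) (humpDeriv a τ) τ := by
  have h := (moebius_den_pos ha hτ).ne'
  have h1 : HasDerivAt (fun τ => 4 * Real.pi ^ 2 * a * (τ * (2 * Real.pi - τ)))
      (4 * Real.pi ^ 2 * a * (1 * (2 * Real.pi - τ) + τ * (-1))) τ :=
    ((hasDerivAt_id τ).mul ((hasDerivAt_id τ).const_sub _)).const_mul _
  have h2 : HasDerivAt (fun τ => (2 * Real.pi + (a - 1) * τ) ^ 2)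
      (2 * (2 * Real.pi + (a - 1) * τ) * (a - 1)) τ := by
    refine ((((hasDerivAt_id τ).const_mul (a - 1)).const_add (2 * Real.pi)).pow 2).congr_deriv ?_
    simp
  refine (h1.div h2 (pow_ne_zero 2 h)).congr_deriv ?_
  rw [humpDeriv]
  generalize hd : 2 * Real.pi + (a - 1) * τ = d at h
  field_simp
  rw [← hd]
  ring

theorem continuousOn_humpDeriv (ha : 0 < a) : ContinuousOn (humpDeriv a) (Icc 0 (2 * Real.pi)) :=
  ContinuousOn.div (by fun_prop) (by fun_prop) fun _ hτ =>
    pow_ne_zero 3 (moebius_den_pos ha hτ).ne'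

theorem continuousOn_hump (ha : 0 < a) : ContinuousOn (hump a) (Icc 0 (2 * Real.pi)) :=
  fun _ hτ => (hasDerivAt_hump ha hτ).continuousAt.continuousWithinAt

/-- The area swept out by the pair `(hump 1, hump a)` does not vanish. -/
theorem integral_hump_mul_humpDeriv_neg (ha : 1 < a) :
    ∫ τ in (0 : ℝ)..(2 * Real.pi), hump 1 τ * humpDeriv a τ < 0 := by
  have ha0 : 0 < a := zero_lt_one.trans ha
  have hp := Real.pi_pos
  -- The integrand `hump 1 * humpDeriv a` is the exact derivative of `hump 1 * hump a / 2` minus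
  -- `w`. Here `-w` is half the Wronskian of the two humps, and it has one sign because their ratio
  -- is strictly monotone for `a > 1`.
  set w : ℝ → ℝ := fun τ => 4 * Real.pi ^ 2 * a * (a - 1) * (τ * (2 * Real.pi - τ)) ^ 2 /
    (2 * Real.pi + (a - 1) * τ) ^ 3 with hw
  have hwc : ContinuousOn w (Icc 0 (2 * Real.pi)) :=
    ContinuousOn.div (by fun_prop) (by fun_prop) fun _ hτ =>
      pow_ne_zero 3 (moebius_den_pos ha0 hτ).ne'
  have hcc : ContinuousOn (fun τ => hump 1 τ * humpDeriv a τ) (Icc 0 (2 * Real.pi)) :=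
    (continuousOn_hump one_pos).mul (continuousOn_humpDeriv ha0)
  have hI : ∀ {f : ℝ → ℝ}, ContinuousOn f (Icc 0 (2 * Real.pi)) →
      IntervalIntegrable f volume 0 (2 * Real.pi) := fun hf =>
    ContinuousOn.intervalIntegrable (by rwa [uIcc_of_le Real.two_pi_pos.le])
  have hpos : 0 < ∫ τ in (0 : ℝ)..(2 * Real.pi), w τ := by
    refine intervalIntegral.intervalIntegral_pos_of_pos_on (hI hwc) (fun τ hτ => ?_)
      Real.two_pi_pos
    have h1 := moebius_den_pos ha0 ⟨hτ.1.le, hτ.2.le⟩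
    have h2 : 0 < τ * (2 * Real.pi - τ) := mul_pos hτ.1 (sub_pos.2 hτ.2)
    have h3 : 0 < a - 1 := sub_pos.2 ha
    positivity
  have hder : ∀ τ ∈ Icc 0 (2 * Real.pi), HasDerivAt (fun τ => hump 1 τ * hump a τ / 2)
      (hump 1 τ * humpDeriv a τ + w τ) τ := by
    intro τ hτ
    have h := (moebius_den_pos ha0 hτ).ne'
    refine (((hasDerivAt_hump one_pos hτ).mul (hasDerivAt_hump ha0 hτ)).div_const 2).congr_deriv ?_
    rw [hw, hump, hump, humpDeriv, humpDeriv, sub_self, zero_mul, add_zero]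
    generalize hd : 2 * Real.pi + (a - 1) * τ = d at h
    simp only [hd]
    field_simp
    rw [← hd]
    ring
  have hFTC := intervalIntegral.integral_eq_sub_of_hasDerivAt_of_le Real.two_pi_pos.le
    (fun τ hτ => (hder τ hτ).continuousAt.continuousWithinAt)
    (fun τ hτ => hder τ ⟨hτ.1.le, hτ.2.le⟩) (hI (hcc.add hwc))
  rw [intervalIntegral.integral_add (hI hcc) (hI hwc)] at hFTC
  simp only [hump_zero, hump_two_pi] at hFTC
  linarith

end Moebius

section Shear

variable {n : ℕ}

/-- The reparametrization of the box by Möbius transformations in the last variable. -/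
def moebiusShear (χ : (Fin n → ℝ) → ℝ) (u : ℝ) (z : (Fin n → ℝ) × ℝ) : (Fin n → ℝ) × ℝ :=
  (z.1, moebius (Real.exp (u * χ z.1)) z.2)

variable {χ : (Fin n → ℝ) → ℝ}

theorem contDiffOn_moebiusShear (hχ : ContDiff ℝ ∞ χ) :
    ContDiffOn ℝ ∞ (fun w : ℝ × ((Fin n → ℝ) × ℝ) => moebiusShear χ w.1 w.2)
      (univ ×ˢ box n) := by
  have h1 : ContDiff ℝ ∞ (fun w : ℝ × ((Fin n → ℝ) × ℝ) => Real.exp (w.1 * χ w.2.1)) := by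
    have : ContDiff ℝ ∞ (fun w : ℝ × ((Fin n → ℝ) × ℝ) => χ w.2.1) :=
      hχ.comp (contDiff_fst.comp contDiff_snd)
    fun_prop
  refine (contDiff_fst.comp contDiff_snd).contDiffOn.prodMk (ContDiffOn.div ?_ ?_ fun w hw => ?_)
  · exact ContDiff.contDiffOn (by fun_prop)
  · exact ContDiff.contDiffOn (by fun_prop)
  · exact (moebius_den_pos (Real.exp_pos _) hw.2.2).ne'

/-- The exponential keeps the Möbius parameter positive and makes `-u` the inverse of `u`; the
vanishing of `χ` gives the identity on the lateral boundary. -/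
theorem isBoxDiffeo_moebiusShear (hχ : ContDiff ℝ ∞ χ) (hχ0 : ∀ σ ∈ cubeBoundary n, χ σ = 0)
    (u : ℝ) : IsBoxDiffeo n (moebiusShear χ u) := by
  have hm : ∀ u, MapsTo (moebiusShear χ u) (box n) (box n) := fun u z hz =>
    ⟨hz.1, moebius_mem (Real.exp_pos _) hz.2⟩
  have hs : ∀ u, ContDiffOn ℝ ∞ (moebiusShear χ u) (box n) := fun u =>
    (contDiffOn_moebiusShear hχ).comp (contDiff_const.prodMk contDiff_id).contDiffOn
      fun z hz => ⟨mem_univ _, hz⟩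
  have hinv : ∀ u, ∀ z ∈ box n, moebiusShear χ (-u) (moebiusShear χ u z) = z := fun u z hz => by
    refine Prod.ext rfl ?_
    have := moebius_inv_moebius (Real.exp_pos (u * χ z.1)) hz.2
    rw [← Real.exp_neg, ← neg_mul] at this
    exact this
  refine ⟨hm u, hs u, ⟨moebiusShear χ (-u), hm _, hs _, hinv u, fun z hz => ?_⟩, ?_⟩
  · have := hinv (-u) z hz
    rwa [neg_neg] at this
  · rintro ⟨σ, τ⟩ ⟨-, h | h | h⟩
    · refine Prod.ext rfl ?_
      change moebius (Real.exp (u * χ σ)) τ = τ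
      rw [hχ0 σ h, mul_zero, Real.exp_zero, moebius_one]
    · refine Prod.ext rfl ?_
      change τ = 0 at h
      change moebius (Real.exp (u * χ σ)) τ = τ
      rw [h, moebius_zero]
    · refine Prod.ext rfl ?_
      change τ = _ at h
      change moebius (Real.exp (u * χ σ)) τ = τ
      rw [h, moebius_two_pi (Real.exp_pos _)]

theorem isReparametrization_moebiusShear (hχ : ContDiff ℝ ∞ χ)
    (hχ0 : ∀ σ ∈ cubeBoundary n, χ σ = 0) : IsReparametrization n (moebiusShear χ 1) := by
  refine ⟨moebiusShear χ, (contDiffOn_moebiusShear hχ).mono (prod_mono (subset_univ _) subset_rfl),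
    fun u _ => isBoxDiffeo_moebiusShear hχ hχ0 u, fun z _ => ?_, fun z _ => rfl⟩
  refine Prod.ext rfl ?_
  change moebius (Real.exp (0 * χ z.1)) z.2 = z.2
  rw [zero_mul, Real.exp_zero, moebius_one]

end Shear

/-! ### The quadratic term of the expansion for a pair of humps. -/

section HumpIntegrals

variable {F : Type*} [NormedAddCommGroup F] [NormedSpace ℝ F] [CompleteSpace F]

/-- The symmetric part of the integrand is exact and integrates to zero since the humps vanish at
both ends; what survives is the area enclosed by the curve of humps times the antisymmetrization of
`Q`. -/
theorem integral_quadratic_hump {a : ℝ} (ha : 0 < a) (Q : F →L[ℝ] F →L[ℝ] F) (X Y : F) {f : ℝ → F}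
    (hf : ∀ t ∈ Icc 0 (2 * Real.pi), f t = humpDeriv 1 t • X + humpDeriv a t • Y) :
    ∫ t in (0 : ℝ)..(2 * Real.pi), Q (∫ s in (0 : ℝ)..t, f s) (f t) =
      (∫ t in (0 : ℝ)..(2 * Real.pi), hump 1 t * humpDeriv a t) • (Q X Y - Q Y X) := by
  have hp := Real.two_pi_pos
  have hI : ∀ {F : Type _} [NormedAddCommGroup F] [NormedSpace ℝ F] {f : ℝ → F} {t : ℝ},
      ContinuousOn f (Icc 0 (2 * Real.pi)) → t ∈ Icc 0 (2 * Real.pi) →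
      IntervalIntegrable f volume 0 t := fun hf ht =>
    ContinuousOn.intervalIntegrable (by
      rw [uIcc_of_le ht.1]; exact hf.mono (Icc_subset_Icc_right ht.2))
  have c1 := continuousOn_hump one_pos
  have ca := continuousOn_hump ha
  have d1 := continuousOn_humpDeriv one_pos
  have da := continuousOn_humpDeriv ha
  have hfc : ContinuousOn (fun t => humpDeriv 1 t • X + humpDeriv a t • Y)
      (Icc 0 (2 * Real.pi)) := (d1.smul continuousOn_const).add (da.smul continuousOn_const)
  have hint : ∀ t ∈ Icc 0 (2 * Real.pi),
      ∫ s in (0 : ℝ)..t, f s = hump 1 t • X + hump a t • Y := by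
    intro t ht
    rw [intervalIntegral.integral_congr (g := fun t => humpDeriv 1 t • X + humpDeriv a t • Y)
      fun s hs => hf s ?_]
    · rw [intervalIntegral.integral_eq_sub_of_hasDerivAt (f := fun t => hump 1 t • X + hump a t • Y)
        (fun s hs => ?_) (hI hfc ht)]
      · simp [hump_zero]
      · rw [uIcc_of_le ht.1] at hs
        have hs' : s ∈ Icc 0 (2 * Real.pi) := ⟨hs.1, hs.2.trans ht.2⟩
        exact ((hasDerivAt_hump one_pos hs').smul_const X).add
          ((hasDerivAt_hump ha hs').smul_const Y)
    · rw [uIcc_of_le ht.1] at hs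
      exact ⟨hs.1, hs.2.trans ht.2⟩
  set H : ℝ → F := fun t => (hump 1 t * humpDeriv 1 t) • Q X X +
    (humpDeriv 1 t * hump a t + hump 1 t * humpDeriv a t) • Q Y X +
    (hump a t * humpDeriv a t) • Q Y Y with hH
  have hHc : ContinuousOn H (Icc 0 (2 * Real.pi)) :=
    (((c1.mul d1).smul continuousOn_const).add
      (((d1.mul ca).add (c1.mul da)).smul continuousOn_const)).add
      ((ca.mul da).smul continuousOn_const)
  have hH0 : ∫ t in (0 : ℝ)..(2 * Real.pi), H t = 0 := by
    rw [intervalIntegral.integral_eq_sub_of_hasDerivAt (f := fun t => (hump 1 t * hump 1 t / 2) • Q X X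
        + (hump 1 t * hump a t) • Q Y X + (hump a t * hump a t / 2) • Q Y Y)
        (fun t ht => ?_) (hI hHc ⟨hp.le, le_rfl⟩)]
    · simp [hump_zero, hump_two_pi]
    · rw [uIcc_of_le hp.le] at ht
      have e1 := hasDerivAt_hump one_pos ht
      have ea := hasDerivAt_hump ha ht
      refine (((((e1.mul e1).div_const 2).smul_const (Q X X)).add
        ((e1.mul ea).smul_const (Q Y X))).add
        (((ea.mul ea).div_const 2).smul_const (Q Y Y))).congr_deriv ?_
      simp only [hH]
      congr 3 <;> ring
  rw [intervalIntegral.integral_congr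
    (g := fun t => H t + (hump 1 t * humpDeriv a t) • (Q X Y - Q Y X)) fun t ht => ?_]
  · have h := intervalIntegral.integral_add (hI hHc ⟨hp.le, le_rfl⟩)
      (hI (f := fun t => (hump 1 t * humpDeriv a t) • (Q X Y - Q Y X))
        ((c1.mul da).smul continuousOn_const) ⟨hp.le, le_rfl⟩)
    refine h.trans ?_
    rw [hH0, zero_add, intervalIntegral.integral_smul_const]
  · rw [uIcc_of_le hp.le] at ht
    simp only [hint t ht, hf t ht, hH, map_add, map_smul, add_apply, smul_apply]
    module

theorem integral_hump_mul_humpDeriv_one :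
    ∫ t in (0 : ℝ)..(2 * Real.pi), hump 1 t * humpDeriv 1 t = 0 := by
  have hp := Real.two_pi_pos
  rw [intervalIntegral.integral_eq_sub_of_hasDerivAt (f := fun t => hump 1 t * hump 1 t / 2)
    (fun t ht => ?_) (ContinuousOn.intervalIntegrable ?_)]
  · simp [hump_zero, hump_two_pi]
  · rw [uIcc_of_le hp.le]
    exact (continuousOn_hump one_pos).mul (continuousOn_humpDeriv one_pos)
  · rw [uIcc_of_le hp.le] at ht
    have e1 := hasDerivAt_hump one_pos ht
    refine ((e1.mul e1).div_const 2).congr_deriv ?_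
    ring

end HumpIntegrals

/-! ### Coefficients of the out-and-back loops. -/

section LoopMean

variable {F : Type*} [NormedAddCommGroup F] [NormedSpace ℝ F] [CompleteSpace F] {n : ℕ}

/-- The density, divided by `ε`, of the deformed loop `humpLoop Γ φ χ ε`, where `D` is the density
of `Γ`. -/
def humpDensity (D : (Fin n → ℝ) × ℝ → F) (φ χ : (Fin n → ℝ) → ℝ) (ε τ : ℝ) (σ : Fin n → ℝ) : F :=
  (φ σ * humpDeriv (Real.exp (χ σ)) τ / (1 + (ε * (φ σ * hump (Real.exp (χ σ)) τ)) ^ 2)) •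
    D (σ, Real.pi + Real.arctan (ε * (φ σ * hump (Real.exp (χ σ)) τ)))

theorem pi_add_arctan_mem (x : ℝ) : Real.pi + Real.arctan x ∈ Icc 0 (2 * Real.pi) := by
  have h1 := Real.neg_pi_div_two_lt_arctan x
  have h2 := Real.arctan_lt_pi_div_two x
  have h3 := Real.pi_pos
  constructor <;> linarith

variable {D : (Fin n → ℝ) × ℝ → F} {φ χ : (Fin n → ℝ) → ℝ}

/-- The time is clamped to `[0, 2π]` because only there are the Möbius denominators known to be
positive. -/
theorem continuous_integral_humpDensity (hD : ContinuousOn D (box n)) (hφ : Continuous φ)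
    (hχ : Continuous χ) : Continuous (Function.uncurry fun ε τ : ℝ =>
      ∫ σ in cube n, humpDensity D φ χ ε (max 0 (min (2 * Real.pi) τ)) σ) := by
  have h1 : Continuous (fun z => D (boxClamp n z)) :=
    hD.comp_continuous (continuous_boxClamp n) boxClamp_mem
  have hden : ∀ p : (ℝ × ℝ) × (Fin n → ℝ),
      2 * Real.pi + (Real.exp (χ p.2) - 1) * max 0 (min (2 * Real.pi) p.1.2) ≠ 0 := fun p =>
    (moebius_den_pos (Real.exp_pos _) (clamp_mem _)).ne'
  have h2 : Continuous fun p : (ℝ × ℝ) × (Fin n → ℝ) =>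
      hump (Real.exp (χ p.2)) (max 0 (min (2 * Real.pi) p.1.2)) :=
    Continuous.div (by fun_prop) (by fun_prop) fun p => pow_ne_zero 2 (hden p)
  have h3 : Continuous fun p : (ℝ × ℝ) × (Fin n → ℝ) =>
      humpDeriv (Real.exp (χ p.2)) (max 0 (min (2 * Real.pi) p.1.2)) :=
    Continuous.div (by fun_prop) (by fun_prop) fun p => pow_ne_zero 3 (hden p)
  have h4 : Continuous fun p : (ℝ × ℝ) × (Fin n → ℝ) =>
      humpDensity (fun z => D (boxClamp n z)) φ χ p.1.1 (max 0 (min (2 * Real.pi) p.1.2)) p.2 := by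
    unfold humpDensity
    refine Continuous.smul (Continuous.div (by fun_prop) (by fun_prop) fun p => by positivity) ?_
    refine h1.comp (continuous_snd.prodMk (continuous_const.add (Real.continuous_arctan.comp ?_)))
    fun_prop
  have h5 := continuous_parametric_integral_of_continuous (μ := volume)
    (f := fun (p : ℝ × ℝ) σ => humpDensity (fun z => D (boxClamp n z)) φ χ p.1
      (max 0 (min (2 * Real.pi) p.2)) σ) h4 (isCompact_cube n)
  refine h5.congr fun p => setIntegral_congr_fun (isCompact_cube n).measurableSet fun σ hσ => ?_
  simp only [humpDensity]
  rw [boxClamp_eq (⟨hσ, pi_add_arctan_mem _⟩ : (σ, _) ∈ box n)]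

theorem continuousOn_humpDensity (hD : ContinuousOn D (box n)) (hφ : Continuous φ)
    (hχ : Continuous χ) (ε : ℝ) :
    ContinuousOn (fun z : (Fin n → ℝ) × ℝ => humpDensity D φ χ ε z.2 z.1) (box n) := by
  have hden : ∀ p ∈ box n, 2 * Real.pi + (Real.exp (χ p.1) - 1) * p.2 ≠ 0 := fun p hp =>
    (moebius_den_pos (Real.exp_pos _) hp.2).ne'
  have h2 : ContinuousOn (fun p : (Fin n → ℝ) × ℝ => hump (Real.exp (χ p.1)) p.2) (box n) :=
    ContinuousOn.div (by fun_prop) (by fun_prop) fun p hp => pow_ne_zero 2 (hden p hp)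
  have h3 : ContinuousOn (fun p : (Fin n → ℝ) × ℝ => humpDeriv (Real.exp (χ p.1)) p.2) (box n) :=
    ContinuousOn.div (by fun_prop) (by fun_prop) fun p hp => pow_ne_zero 3 (hden p hp)
  unfold humpDensity
  refine ContinuousOn.smul (ContinuousOn.div (by fun_prop) (by fun_prop) fun p _ => by positivity) ?_
  refine hD.comp (continuousOn_fst.prodMk (continuousOn_const.add
    (Real.continuous_arctan.comp_continuousOn ?_))) fun p hp => ⟨hp.1, pi_add_arctan_mem _⟩
  fun_prop

/-- At fixed `σ` the loop goes out and back along one path. Substituting `y = hump a τ` turns the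
time integral into one from `0` to `0`. -/
theorem integral_integral_humpDensity (hD : ContinuousOn D (box n)) (hφ : Continuous φ)
    (hχ : Continuous χ) (ε : ℝ) :
    ∫ τ in (0 : ℝ)..(2 * Real.pi), ∫ σ in cube n, humpDensity D φ χ ε τ σ = 0 := by
  have hp := Real.two_pi_pos
  have hc := continuousOn_humpDensity hD hφ hχ ε
  rw [integral_integral_cube (f := fun z => humpDensity D φ χ ε z.2 z.1) hc]
  refine (setIntegral_prod _ (hc.integrableOn_compact (isCompact_box n))).trans ?_
  refine setIntegral_eq_zero_of_forall_eq_zero fun σ hσ => ?_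
  rw [integral_Icc_eq_integral_Ioc, ← intervalIntegral.integral_of_le hp.le]
  set a := Real.exp (χ σ) with ha
  have ha0 : 0 < a := Real.exp_pos _
  set f : ℝ → F := fun y => (φ σ / (1 + (ε * (φ σ * y)) ^ 2)) •
    D (σ, Real.pi + Real.arctan (ε * (φ σ * y))) with hf
  have hfc : Continuous f := by
    refine Continuous.smul (Continuous.div (by fun_prop) (by fun_prop) fun y => by positivity) ?_
    exact hD.comp_continuous (by fun_prop) fun y => ⟨hσ, pi_add_arctan_mem _⟩
  have h1 := intervalIntegral.integral_deriv_smul_comp (a := 0) (b := 2 * Real.pi) (f := hump a)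
    (f' := humpDeriv a) (g := f) (fun τ hτ => hasDerivAt_hump ha0 (by rwa [uIcc_of_le hp.le] at hτ))
    (by rw [uIcc_of_le hp.le]; exact continuousOn_humpDeriv ha0) hfc
  rw [hump_zero, hump_two_pi, intervalIntegral.integral_same] at h1
  refine Eq.trans ?_ h1
  refine intervalIntegral.integral_congr fun τ _ => ?_
  simp only [humpDensity, hf, Function.comp, smul_smul, ← ha]
  congr 1
  ring

theorem integral_humpDensity_zero (hD : ContinuousOn D (box n)) {φ₁ φ₂ : (Fin n → ℝ) → ℝ} {c : ℝ}
    (hφ₁ : Continuous φ₁) (hφ₂ : Continuous φ₂) (h₁ : ∀ σ, φ₁ σ ≠ 0 → χ σ = 0)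
    (h₂ : ∀ σ, φ₂ σ ≠ 0 → χ σ = c) (τ : ℝ) :
    ∫ σ in cube n, humpDensity D (fun σ => φ₁ σ + φ₂ σ) χ 0 τ σ =
      humpDeriv 1 τ • (∫ σ in cube n, φ₁ σ • D (σ, Real.pi)) +
        humpDeriv (Real.exp c) τ • ∫ σ in cube n, φ₂ σ • D (σ, Real.pi) := by
  have hπ : Real.pi ∈ Icc 0 (2 * Real.pi) := by
    have := pi_add_arctan_mem 0
    simpa using this
  have hDc : ContinuousOn (fun σ => D (σ, Real.pi)) (cube n) :=
    hD.comp (f := fun σ => (σ, Real.pi)) (by fun_prop) fun σ hσ => ⟨hσ, hπ⟩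
  have hi : ∀ φ : (Fin n → ℝ) → ℝ, Continuous φ →
      IntegrableOn (fun σ => φ σ • D (σ, Real.pi)) (cube n) := fun φ hφ =>
    (hφ.continuousOn.smul hDc).integrableOn_compact (isCompact_cube n)
  rw [← integral_smul, ← integral_smul]
  refine Eq.trans ?_ (integral_add ((hi _ hφ₁).smul _) ((hi _ hφ₂).smul _))
  refine integral_congr_ae (Eventually.of_forall fun σ => ?_)
  have e1 : φ₁ σ * humpDeriv (Real.exp (χ σ)) τ = humpDeriv 1 τ * φ₁ σ := by
    by_cases h : φ₁ σ = 0
    · simp [h]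
    · rw [h₁ σ h, Real.exp_zero, mul_comm]
  have e2 : φ₂ σ * humpDeriv (Real.exp (χ σ)) τ = humpDeriv (Real.exp c) τ * φ₂ σ := by
    by_cases h : φ₂ σ = 0
    · simp [h]
    · rw [h₂ σ h, mul_comm]
  simp only [humpDensity, zero_mul, Real.arctan_zero, add_zero, ne_eq, OfNat.ofNat_ne_zero,
    not_false_eq_true, zero_pow, div_one, add_mul, e1, e2, add_smul, mul_smul]

end LoopMean

/-! ### r-flatness forces densities at time `π` to commute. -/

section HumpLoops

variable {E : Type*} [NormedAddCommGroup E] [NormedSpace ℝ E]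
  {EG : Type*} [NormedAddCommGroup EG] [NormedSpace ℝ EG] [CompleteSpace EG]
  {EP : Type*} [NormedAddCommGroup EP] [NormedSpace ℝ EP]
  {M : Type*} [TopologicalSpace M] [ChartedSpace E M] [IsManifold 𝓘(ℝ, E) ∞ M]
  {G : Type*} [TopologicalSpace G] [ChartedSpace EG G] [Group G] [LieGroup 𝓘(ℝ, EG) ∞ G]
  [T2Space G]
  {P : Type*} [TopologicalSpace P] [ChartedSpace EP P] [IsManifold 𝓘(ℝ, EP) ∞ P] [T2Space P]
  {π : PrincipalBundle E EG EP M G P} {n : ℕ}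
  {A : PrincipalConnection π} {B : AdjointForm π (n + 1)} {x₀ : M} {p₀ : P}
  {γ : ((Fin n → ℝ) → M) → (Fin n → ℝ) → ℝ → M} {s : M → P}
  {Γ : (Fin n → ℝ) × ℝ → M} {φ χ : (Fin n → ℝ) → ℝ}

/-- The loop of `n`-loops that moves along `Γ` from the time `π` and back, with speeds depending
on the point of the cube. -/
def humpLoop (Γ : (Fin n → ℝ) × ℝ → M) (φ χ : (Fin n → ℝ) → ℝ) (ε : ℝ) (z : (Fin n → ℝ) × ℝ) : M :=
  Γ (z.1, Real.pi + Real.arctan (ε * (φ z.1 * hump (Real.exp (χ z.1)) z.2)))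

theorem humpLoop_comp_moebiusShear (Γ : (Fin n → ℝ) × ℝ → M) (φ χ : (Fin n → ℝ) → ℝ) (ε : ℝ) :
    (fun z => humpLoop Γ φ (fun _ => 0) ε (moebiusShear χ 1 z)) = humpLoop Γ φ χ ε := by
  funext z
  simp only [humpLoop, moebiusShear, Real.exp_zero, hump_one_moebius, one_mul]

theorem contDiffOn_pi_add_arctan_hump (hφ : ContDiff ℝ ∞ φ) (hχ : ContDiff ℝ ∞ χ) (ε : ℝ) :
    ContDiffOn ℝ ∞ (fun z : (Fin n → ℝ) × ℝ =>
      Real.pi + Real.arctan (ε * (φ z.1 * hump (Real.exp (χ z.1)) z.2))) (box n) := by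
  have h1 : ContDiff ℝ ∞ (fun z : (Fin n → ℝ) × ℝ => φ z.1) := hφ.comp contDiff_fst
  have h2 : ContDiff ℝ ∞ (fun z : (Fin n → ℝ) × ℝ => χ z.1) := hχ.comp contDiff_fst
  have h3 : ContDiffOn ℝ ∞ (fun z : (Fin n → ℝ) × ℝ => hump (Real.exp (χ z.1)) z.2) (box n) :=
    ContDiffOn.div (ContDiff.contDiffOn (by fun_prop)) (ContDiff.contDiffOn (by fun_prop))
      fun z hz => pow_ne_zero 2 (moebius_den_pos (Real.exp_pos _) hz.2).ne'
  exact contDiffOn_const.add (Real.contDiff_arctan.comp_contDiffOn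
    (contDiffOn_const.mul (h1.contDiffOn.mul h3)))

theorem IsLoopOfNLoops.humpLoop (hΓ : IsLoopOfNLoops (E := E) x₀ Γ) (hφ : ContDiff ℝ ∞ φ)
    (hχ : ContDiff ℝ ∞ χ) (ε : ℝ) : IsLoopOfNLoops (E := E) x₀ (humpLoop Γ φ χ ε) where
  smooth := hΓ.smooth.comp
    (contDiff_fst.contDiffOn.prodMk (contDiffOn_pi_add_arctan_hump hφ hχ ε)).contMDiffOn
    fun _ hz => ⟨hz.1, pi_add_arctan_mem _⟩
  boundary σ hσ _ _ := hΓ.boundary σ hσ _ (pi_add_arctan_mem _)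
  closed σ _ := by
    simp only [LoopSpaceConnection.humpLoop, hump_zero, hump_two_pi]

theorem AdjointForm.density_humpLoop (B : AdjointForm π (n + 1)) (s : M → P)
    (hΓ : ContMDiffOn 𝓘(ℝ, (Fin n → ℝ) × ℝ) 𝓘(ℝ, E) ∞ Γ (box n)) (hφ : ContDiff ℝ ∞ φ)
    (hχ : ContDiff ℝ ∞ χ) (ε : ℝ) {σ : Fin n → ℝ} {τ : ℝ} (hσ : σ ∈ cube n)
    (hτ : τ ∈ Icc 0 (2 * Real.pi)) :
    B.density s (humpLoop Γ φ χ ε) (σ, τ) = ε • humpDensity (B.density s Γ) φ χ ε τ σ := by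
  have hz : (σ, τ) ∈ box n := ⟨hσ, hτ⟩
  set g : (Fin n → ℝ) × ℝ → ℝ := fun z =>
    Real.pi + Real.arctan (ε * (φ z.1 * hump (Real.exp (χ z.1)) z.2)) with hg
  have h1 : HasFDerivWithinAt g (fderivWithin ℝ g (box n) (σ, τ)) (box n) (σ, τ) :=
    ((contDiffOn_pi_add_arctan_hump hφ hχ ε _ hz).differentiableWithinAt
      (by simp)).hasFDerivWithinAt
  have h2 : HasDerivWithinAt (fun t => g (σ, t)) (fderivWithin ℝ g (box n) (σ, τ) (0, 1))
      (Icc 0 (2 * Real.pi)) τ := by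
    have := h1.comp_hasDerivWithinAt (s := Icc 0 (2 * Real.pi)) (f := fun t => (σ, t))
      (f' := ((0 : Fin n → ℝ), (1 : ℝ))) τ
      ((hasDerivWithinAt_const _ _ _).prodMk (hasDerivWithinAt_id _ _)) fun t ht => ⟨hσ, ht⟩
    exact this
  have h3 : HasDerivWithinAt (fun t => g (σ, t))
      (1 / (1 + (ε * (φ σ * hump (Real.exp (χ σ)) τ)) ^ 2) *
        (ε * (φ σ * humpDeriv (Real.exp (χ σ)) τ))) (Icc 0 (2 * Real.pi)) τ :=
    (((((hasDerivAt_hump (Real.exp_pos (χ σ)) hτ).const_mul (φ σ)).const_mul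
      ε).arctan).const_add Real.pi).hasDerivWithinAt
  have h4 := (uniqueDiffOn_Icc Real.two_pi_pos τ hτ).eq_deriv _ h2 h3
  refine (B.density_comp_shear s hΓ hz (fun _ _ => pi_add_arctan_mem _) h1).trans ?_
  rw [h4, humpDensity, smul_smul]
  congr 1
  ring

theorem IsFlatFrame.hol_humpLoop_eq (h : IsFlatFrame A x₀ p₀ s) (hγ : IsPathChoice (E := E) x₀ γ)
    (hΓ : IsLoopOfNLoops (E := E) x₀ Γ) (hφ : ContDiff ℝ ∞ φ) (hχ : ContDiff ℝ ∞ χ) {ε : ℝ}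
    {U : ℝ → G} (hU : IsTransport (2 * Real.pi) (fun τ => ε • ∫ σ in cube n,
      humpDensity (B.density s Γ) φ χ ε (max 0 (min (2 * Real.pi) τ)) σ) U) :
    hol A B p₀ γ (humpLoop Γ φ χ ε) = U (2 * Real.pi) := by
  refine h.hol_eq hγ (hΓ.humpLoop hφ hχ ε) (hU.congr fun τ hτ => ?_)
  beta_reduce
  rw [clamp_eq hτ, ← integral_smul]
  exact setIntegral_congr_fun (isCompact_cube n).measurableSet fun σ hσ =>
    (B.density_humpLoop s hΓ.smooth hφ hχ ε hσ hτ).symm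

/-- Let the loop with `χ = 0` be compared with its Möbius reparametrization. In the limit `ε → 0`
the coefficients are combinations of `X` and `Y` with humps as primitives: equal humps, of area
zero, for the first loop, and humps with parameters `1` and `e`, of nonzero area, for the second. -/
theorem IsFlatFrame.bracket_integral_eq_zero (h : IsFlatFrame A x₀ p₀ s)
    (hγ : IsPathChoice (E := E) x₀ γ) (hr : IsRFlat A B x₀ p₀ γ)
    (hΓ : IsLoopOfNLoops (E := E) x₀ Γ) {φ₁ φ₂ : (Fin n → ℝ) → ℝ} (hφ₁ : ContDiff ℝ ∞ φ₁)
    (hφ₂ : ContDiff ℝ ∞ φ₂) (hχ : ContDiff ℝ ∞ χ) (hχ0 : ∀ σ ∈ cubeBoundary n, χ σ = 0)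
    (h₁ : ∀ σ, φ₁ σ ≠ 0 → χ σ = 0) (h₂ : ∀ σ, φ₂ σ ≠ 0 → χ σ = 1) :
    bracketL G (∫ σ in cube n, φ₁ σ • B.density s Γ (σ, Real.pi))
      (∫ σ in cube n, φ₂ σ • B.density s Γ (σ, Real.pi)) = 0 := by
  set D := B.density s Γ with hD
  have hDc : ContinuousOn D (box n) := B.continuousOn_density h.continuous h.proj hΓ.smooth
  set φ : (Fin n → ℝ) → ℝ := fun σ => φ₁ σ + φ₂ σ with hφ
  have hφs : ContDiff ℝ ∞ φ := hφ₁.add hφ₂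
  set X := ∫ σ in cube n, φ₁ σ • D (σ, Real.pi)
  set Y := ∫ σ in cube n, φ₂ σ • D (σ, Real.pi)
  have hmean : ∀ χ : (Fin n → ℝ) → ℝ, Continuous χ → ∀ ε : ℝ,
      ∫ τ in (0 : ℝ)..(2 * Real.pi), ∫ σ in cube n,
        humpDensity D φ χ ε (max 0 (min (2 * Real.pi) τ)) σ = 0 := fun χ hχ ε => by
    rw [← integral_integral_humpDensity hDc hφs.continuous hχ ε]
    refine intervalIntegral.integral_congr fun τ hτ => ?_
    rw [uIcc_of_le Real.two_pi_pos.le] at hτ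
    simp only [clamp_eq hτ]
  have hol : ∀ ε > 0, ∀ U V : ℝ → G,
      IsTransport (2 * Real.pi) (fun τ => ε • ∫ σ in cube n,
        humpDensity D φ (fun _ => 0) ε (max 0 (min (2 * Real.pi) τ)) σ) U →
      IsTransport (2 * Real.pi) (fun τ => ε • ∫ σ in cube n,
        humpDensity D φ χ ε (max 0 (min (2 * Real.pi) τ)) σ) V →
      U (2 * Real.pi) = V (2 * Real.pi) := fun ε _ U V hU hV => by
    have e1 := h.hol_humpLoop_eq hγ hΓ hφs contDiff_const hU
    have e2 := h.hol_humpLoop_eq hγ hΓ hφs hχ hV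
    have e3 := hr _ (hΓ.humpLoop (χ := fun _ => 0) hφs contDiff_const ε) _ (isReparametrization_moebiusShear hχ hχ0)
    rw [humpLoop_comp_moebiusShear] at e3
    exact e1.symm.trans (e3.symm.trans e2)
  have key := integral_lieQ_eq_of_transport_eq (G := G) Real.two_pi_pos.le
    (α := fun ε τ => ∫ σ in cube n,
      humpDensity D φ (fun _ => 0) ε (max 0 (min (2 * Real.pi) τ)) σ)
    (β := fun ε τ => ∫ σ in cube n, humpDensity D φ χ ε (max 0 (min (2 * Real.pi) τ)) σ)
    (continuous_integral_humpDensity hDc hφs.continuous (continuous_const (y := (0 : ℝ))))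
    (continuous_integral_humpDensity hDc hφs.continuous hχ.continuous)
    (fun ε => by rw [hmean _ continuous_const, hmean _ hχ.continuous])
    hol
  rw [integral_quadratic_hump (Real.exp_pos 0) (lieQ G) X Y fun t ht => by
      rw [clamp_eq ht]
      exact integral_humpDensity_zero hDc hφ₁.continuous hφ₂.continuous (fun _ _ => rfl)
        (fun _ _ => rfl) t,
    integral_quadratic_hump (Real.exp_pos 1) (lieQ G) X Y fun t ht => by
      rw [clamp_eq ht]
      exact integral_humpDensity_zero hDc hφ₁.continuous hφ₂.continuous h₁ h₂ t,
    Real.exp_zero, integral_hump_mul_humpDeriv_one, zero_smul, eq_comm, smul_eq_zero] at key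
  -- The area for parameter `e` is negative, so the antisymmetrization of `lieQ` at `(X, Y)`
  -- vanishes; up to sign this is the bracket.
  have hQ := key.resolve_left
    (integral_hump_mul_humpDeriv_neg (Real.one_lt_exp_iff.2 one_pos)).ne
  rw [sub_eq_zero] at hQ
  simp [bracketL, hQ]

theorem IsFlatFrame.bracket_density_pi_eq_zero (h : IsFlatFrame A x₀ p₀ s)
    (hγ : IsPathChoice (E := E) x₀ γ) (hr : IsRFlat A B x₀ p₀ γ)
    (hΓ : IsLoopOfNLoops (E := E) x₀ Γ) {σ₁ σ₂ : Fin n → ℝ}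
    (hσ₁ : σ₁ ∈ openCube n) (hσ₂ : σ₂ ∈ openCube n) (hne : σ₁ ≠ σ₂) :
    bracketL G (B.density s Γ (σ₁, Real.pi)) (B.density s Γ (σ₂, Real.pi)) = 0 := by
  have hπ : Real.pi ∈ Icc 0 (2 * Real.pi) := by
    have := pi_add_arctan_mem 0
    simpa using this
  have hDc : ContinuousOn (fun σ => B.density s Γ (σ, Real.pi)) (cube n) :=
    (B.continuousOn_density h.continuous h.proj hΓ.smooth).comp (f := fun σ => (σ, Real.pi))
      (by fun_prop) fun σ hσ => ⟨hσ, hπ⟩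
  -- The delay `χ` is `1` near `σ₂` and vanishes near `σ₁` and on the boundary. Bumps `φ₁` off its
  -- support and `φ₂` where it equals `1` satisfy the hypotheses of `bracket_integral_eq_zero`;
  -- localizing `φ₂` and then `φ₁` gives the pointwise statement.
  obtain ⟨χ, hχs, hχ, hχ1⟩ : ∃ χ : (Fin n → ℝ) → ℝ, ContDiff ℝ ∞ χ ∧
      tsupport χ ⊆ openCube n ∩ {σ₁}ᶜ ∧ ∀ᶠ σ in 𝓝 σ₂, χ σ = 1 := by
    have ho : IsOpen (openCube n ∩ {σ₁}ᶜ) := (isOpen_openCube n).inter isOpen_compl_singleton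
    obtain ⟨r, hr, hrU⟩ := Metric.nhds_basis_closedBall.mem_iff.1 (ho.mem_nhds ⟨hσ₂, hne.symm⟩)
    let f : ContDiffBump σ₂ := ⟨r / 2, r, half_pos hr, half_lt_self hr⟩
    exact ⟨f, f.contDiff, f.tsupport_eq.subset.trans hrU,
      f.eventuallyEq_one⟩
  obtain ⟨V, hV, hVo, hV2⟩ := eventually_nhds_iff.1 hχ1
  have hU₁ : IsOpen (openCube n ∩ (tsupport χ)ᶜ) :=
    (isOpen_openCube n).inter (isClosed_tsupport χ).isOpen_compl
  have hU₂ : IsOpen (openCube n ∩ V) := (isOpen_openCube n).inter hVo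
  have step : ∀ φ₁ : (Fin n → ℝ) → ℝ, ContDiff ℝ ∞ φ₁ → tsupport φ₁ ⊆ openCube n ∩ (tsupport χ)ᶜ →
      bracketL G (∫ σ in cube n, φ₁ σ • B.density s Γ (σ, Real.pi))
        (B.density s Γ (σ₂, Real.pi)) = 0 := fun φ₁ hφ₁ hs₁ =>
    eq_zero_of_forall_integral_smul_eq_zero hDc hU₂
      (inter_subset_left.trans (openCube_subset_cube n)) _
      (fun φ₂ hφ₂ _ hs₂ => h.bracket_integral_eq_zero hγ hr hΓ hφ₁ hφ₂ hχs
        (fun σ hσ => image_eq_zero_of_notMem_tsupport fun h =>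
          notMem_openCube_of_mem_cubeBoundary hσ (hχ h).1)
        (fun σ hσ => image_eq_zero_of_notMem_tsupport (hs₁ (subset_tsupport _ hσ)).2)
        fun σ hσ => hV _ (hs₂ (subset_tsupport _ hσ)).2) ⟨hσ₂, hV2⟩
  exact eq_zero_of_forall_integral_smul_eq_zero hDc hU₁
    (inter_subset_left.trans (openCube_subset_cube n))
    ((bracketL (EG := EG) G).flip (B.density s Γ (σ₂, Real.pi)))
    (fun φ₁ hφ₁ _ hs₁ => step φ₁ hφ₁ hs₁) ⟨hσ₁, fun h => (hχ h).2 rfl⟩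

end HumpLoops

/-! ### Prescribing the velocity of a loop, and the conclusion. -/

section Perturbation

variable {E : Type*} [NormedAddCommGroup E] [NormedSpace ℝ E]
  {EG : Type*} [NormedAddCommGroup EG] [NormedSpace ℝ EG] [CompleteSpace EG]
  {EP : Type*} [NormedAddCommGroup EP] [NormedSpace ℝ EP]
  {M : Type*} [TopologicalSpace M] [ChartedSpace E M] [IsManifold 𝓘(ℝ, E) ∞ M]
  {G : Type*} [TopologicalSpace G] [ChartedSpace EG G] [Group G] [LieGroup 𝓘(ℝ, EG) ∞ G]
  [T2Space G]
  {P : Type*} [TopologicalSpace P] [ChartedSpace EP P] [IsManifold 𝓘(ℝ, EP) ∞ P] [T2Space P]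
  {π : PrincipalBundle E EG EP M G P} {n : ℕ}
  {A : PrincipalConnection π} {B : AdjointForm π (n + 1)} {x₀ : M} {p₀ : P}
  {γ : ((Fin n → ℝ) → M) → (Fin n → ℝ) → ℝ → M} {s : M → P}

/-- The interior of the box. -/
def openBox (n : ℕ) : Set ((Fin n → ℝ) × ℝ) := openCube n ×ˢ Ioo 0 (2 * Real.pi)

theorem isOpen_openBox (n : ℕ) : IsOpen (openBox n) := (isOpen_openCube n).prod isOpen_Ioo

theorem openBox_subset_box (n : ℕ) : openBox n ⊆ box n :=
  prod_mono (openCube_subset_cube n) Ioo_subset_Icc_self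

theorem box_mem_nhds {z : (Fin n → ℝ) × ℝ} (hz : z ∈ openBox n) : box n ∈ 𝓝 z :=
  mem_of_superset ((isOpen_openBox n).mem_nhds hz) (openBox_subset_box n)

/-- A loop of `n`-loops can be modified near an interior point, changing its value at that point
not at all, and its derivative there by a prescribed vector in the direction of the loop
parameter. -/
theorem IsLoopOfNLoops.exists_perturbation {Γ : (Fin n → ℝ) × ℝ → M}
    (hΓ : IsLoopOfNLoops (E := E) x₀ Γ) {z₀ : (Fin n → ℝ) × ℝ} (hz₀ : z₀ ∈ openBox n)
    {D : (Fin n → ℝ) × ℝ →L[ℝ] E} (hD : HasMDer Γ D (box n) z₀) (v : E)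
    {U : Set ((Fin n → ℝ) × ℝ)} (hU : U ∈ 𝓝 z₀) :
    ∃ Γ' : (Fin n → ℝ) × ℝ → M, IsLoopOfNLoops (E := E) x₀ Γ' ∧ (∀ z ∉ U, Γ' z = Γ z) ∧
      Γ' z₀ = Γ z₀ ∧
      HasMDer Γ' (D + (ContinuousLinearMap.snd ℝ (Fin n → ℝ) ℝ).smulRight v) (box n) z₀ := by
  set φ := extChartAt 𝓘(ℝ, E) (Γ z₀) with hφ
  have hΓz : ∀ z ∈ openBox n, ContMDiffAt 𝓘(ℝ, (Fin n → ℝ) × ℝ) 𝓘(ℝ, E) ∞ Γ z := fun z hz =>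
    hΓ.smooth.contMDiffAt (box_mem_nhds hz)
  have hφΓ : ∀ z ∈ openBox n, Γ z ∈ φ.source → ContDiffAt ℝ ∞ (fun z => φ (Γ z)) z :=
    fun z hz hz' => ((contMDiffAt_extChartAt' (by rwa [hφ, extChartAt_source] at hz')).comp z
      (hΓz z hz)).contDiffAt
  have hφ0 : φ (Γ z₀) ∈ φ.target := mem_extChartAt_target _
  have hev : ∀ᶠ q : ((Fin n → ℝ) × ℝ) × ℝ in 𝓝 z₀ ×ˢ 𝓝 (0 : ℝ),
      φ (Γ q.1) + q.2 • v ∈ φ.target := by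
    rw [← nhds_prod_eq]
    have hc : ContinuousAt (fun q : ((Fin n → ℝ) × ℝ) × ℝ => φ (Γ q.1) + q.2 • v) (z₀, 0) := by
      refine ContinuousAt.add (ContinuousAt.comp (f := Prod.fst) (g := fun z => φ (Γ z))
        (hφΓ z₀ hz₀ (mem_extChartAt_source _)).continuousAt continuousAt_fst) (by fun_prop)
    refine hc.eventually_mem ((isOpen_extChartAt_target _).mem_nhds ?_)
    change φ (Γ z₀) + (0 : ℝ) • v ∈ φ.target
    rwa [zero_smul, add_zero]
  obtain ⟨p, hp, q, hq, hpq⟩ := eventually_prod_iff.1 hev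
  obtain ⟨δ, hδ, hδq⟩ := Metric.eventually_nhds_iff.1 hq
  have hsrc : ∀ᶠ z in 𝓝 z₀, Γ z ∈ φ.source :=
    (hΓz z₀ hz₀).continuousAt.eventually_mem (extChartAt_source_mem_nhds _)
  have htime : ∀ᶠ z : (Fin n → ℝ) × ℝ in 𝓝 z₀, |z.2 - z₀.2| < δ := by
    have hc : ContinuousAt (fun z : (Fin n → ℝ) × ℝ => |z.2 - z₀.2|) z₀ := by fun_prop
    exact hc.eventually_lt_const (by simpa using hδ)
  have hbox : ∀ᶠ z in 𝓝 z₀, z ∈ openBox n := (isOpen_openBox n).mem_nhds hz₀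
  have hU' : ∀ᶠ z in 𝓝 z₀, z ∈ U := hU
  obtain ⟨O, hO, hOo, hzO⟩ := eventually_nhds_iff.1
    (hsrc.and (htime.and (hp.and (hbox.and hU'))))
  obtain ⟨β, hβO, -, hβs, hβI, hβ1⟩ := exists_contDiff_tsupport_subset (n := ⊤) (hOo.mem_nhds hzO)
  have hβs : ContDiff ℝ ∞ β := hβs
  -- In a chart at `Γ z₀` the loop is moved by `c z • v`. The factor `z.2 - z₀.2` keeps the value at
  -- `z₀` and makes the derivative of `c` there the projection to the time; the cutoff `β` and the
  -- choice of `O` keep the result in the chart.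
  set c : (Fin n → ℝ) × ℝ → ℝ := fun z => β z * (z.2 - z₀.2) with hc
  have hcs : ContDiff ℝ ∞ c := hβs.mul (contDiff_snd.sub contDiff_const)
  have htar : ∀ z ∈ O, φ (Γ z) + c z • v ∈ φ.target := fun z hz => by
    obtain ⟨-, h2, h3, -⟩ := hO z hz
    refine hpq h3 (hδq ?_)
    have := hβI ⟨z, rfl⟩
    rw [dist_zero_right, Real.norm_eq_abs, abs_mul, abs_of_nonneg this.1]
    exact (mul_le_of_le_one_left (abs_nonneg _) this.2).trans_lt h2
  set F : (Fin n → ℝ) × ℝ → M := fun z => φ.symm (φ (Γ z) + c z • v) with hF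
  have hFO : ∀ z ∈ O, ContMDiffAt 𝓘(ℝ, (Fin n → ℝ) × ℝ) 𝓘(ℝ, E) ∞ F z := fun z hz => by
    obtain ⟨h1, -, -, h4, -⟩ := hO z hz
    have h5 : ContDiffAt ℝ ∞ (fun z => φ (Γ z) + c z • v) z :=
      (hφΓ z h4 h1).add (hcs.contDiffAt.smul contDiffAt_const)
    exact ((contMDiffOn_extChartAt_symm (Γ z₀)).contMDiffAt
      ((isOpen_extChartAt_target _).mem_nhds (htar z hz))).comp z h5.contMDiffAt
  classical
  set Γ' : (Fin n → ℝ) × ℝ → M := O.piecewise F Γ with hΓ'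
  have hΓ'O : ∀ z ∈ O, Γ' z = F z := fun z hz => piecewise_eq_of_mem _ _ _ hz
  have hΓ'β : ∀ z, β z = 0 → Γ' z = Γ z := fun z hz => by
    by_cases h : z ∈ O
    · rw [hΓ'O z h]
      simp only [hF, hc, hz, zero_mul, zero_smul, add_zero]
      exact φ.left_inv (hO z h).1
    · exact piecewise_eq_of_notMem _ _ _ h
  have hΓ'c : ∀ z ∉ O, Γ' z = Γ z := fun z hz => piecewise_eq_of_notMem _ _ _ hz
  have hbd : ∀ z ∉ openBox n, Γ' z = Γ z := fun z hz => hΓ'c z fun h => hz (hO z h).2.2.2.1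
  have hsm : ContMDiffOn 𝓘(ℝ, (Fin n → ℝ) × ℝ) 𝓘(ℝ, E) ∞ Γ' (box n) := by
    intro z hz
    by_cases h : z ∈ tsupport β
    · refine ((hFO z (hβO h)).congr_of_eventuallyEq ?_).contMDiffWithinAt
      filter_upwards [hOo.mem_nhds (hβO h)] with w hw using hΓ'O w hw
    · refine (hΓ.smooth z hz).congr_of_eventuallyEq ?_ (hΓ'β z (image_eq_zero_of_notMem_tsupport h))
      refine nhdsWithin_le_nhds ?_
      filter_upwards [(isClosed_tsupport β).isOpen_compl.mem_nhds h] with w hw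
        using hΓ'β w (image_eq_zero_of_notMem_tsupport hw)
  have hc0 : c z₀ = 0 := by simp [hc]
  have hF0 : F z₀ = Γ z₀ := by
    simp only [hF, hc0, zero_smul, add_zero]
    exact φ.left_inv (mem_extChartAt_source _)
  refine ⟨Γ', ⟨hsm, fun σ hσ τ hτ => ?_, fun σ hσ => ?_⟩, fun z hz => ?_, ?_, ?_⟩
  · rw [hbd _ fun h => notMem_openCube_of_mem_cubeBoundary hσ h.1]
    exact hΓ.boundary σ hσ τ hτ
  · rw [hbd _ fun h => h.2.2.ne rfl, hbd _ fun h => h.2.1.ne rfl]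
    exact hΓ.closed σ hσ
  · exact hΓ'c z fun h => hz (hO z h).2.2.2.2
  · rw [hΓ'O z₀ hzO, hF0]
  · have hself : (mder φ (Γ z₀) : E →L[ℝ] E) = .id ℝ E :=
      mfderiv_extChartAt_self (I := 𝓘(ℝ, E)) (x := Γ z₀)
    have hd1 : MDifferentiableAt 𝓘(ℝ, E) 𝓘(ℝ, E) φ (Γ z₀) :=
      (contMDiffAt_extChartAt (n := ∞)).mdifferentiableAt (by simp)
    have hd2 : MDifferentiableAt 𝓘(ℝ, E) 𝓘(ℝ, E) φ.symm (φ (Γ z₀)) :=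
      ((contMDiffOn_extChartAt_symm (n := ∞) (Γ z₀)).contMDiffAt
        ((isOpen_extChartAt_target _).mem_nhds hφ0)).mdifferentiableAt (by simp)
    have hsymm : (mder φ.symm (φ (Γ z₀)) : E →L[ℝ] E) = .id ℝ E := by
      have h1 := mder_comp (f := φ) (g := φ.symm) hd2 hd1 rfl
      rw [hself, ContinuousLinearMap.comp_id] at h1
      rw [← h1]
      have h2 : (φ.symm ∘ φ) =ᶠ[𝓝 (Γ z₀)] id := by
        filter_upwards [extChartAt_source_mem_nhds (I := 𝓘(ℝ, E)) (Γ z₀)] with y hy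
          using φ.left_inv hy
      exact (h2.mfderiv_eq).trans mfderiv_id
    have h3 : HasFDerivWithinAt (fun z => φ (Γ z)) D (box n) z₀ := by
      have := hD.comp_map hd1
      rw [hself, ContinuousLinearMap.id_comp] at this
      exact this.hasFDerivWithinAt
    have h4 : HasFDerivWithinAt c (ContinuousLinearMap.snd ℝ (Fin n → ℝ) ℝ) (box n) z₀ := by
      have h5 := ((hβs.differentiable (by simp)) z₀).hasFDerivAt.mul
        ((hasFDerivAt_snd (𝕜 := ℝ) (p := z₀)).sub_const z₀.2)
      refine (h5.congr_fderiv ?_).hasFDerivWithinAt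
      rw [hβ1]
      simp
    have h6 := h3.add (h4.smul_const v)
    have h7 : HasMDer (fun z => φ (Γ z) + c z • v)
      (D + (ContinuousLinearMap.snd ℝ (Fin n → ℝ) ℝ).smulRight v) (box n) z₀ :=
      h6.hasMFDerivWithinAt
    have hp : φ (Γ z₀) + c z₀ • v = φ (Γ z₀) := by rw [hc0, zero_smul, add_zero]
    have h8 := h7.comp_map (F := φ.symm) (by rw [hp]; exact hd2)
    rw [hp, hsymm, ContinuousLinearMap.id_comp] at h8
    refine h8.congr_of_eventuallyEq (nhdsWithin_le_nhds ?_) (hΓ'O z₀ hzO)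
    filter_upwards [hOo.mem_nhds hzO] with w hw using hΓ'O w hw

theorem IsNLoop.isLoopOfNLoops {N : (Fin n → ℝ) → M} (hN : IsNLoop (E := E) x₀ N) :
    IsLoopOfNLoops (E := E) x₀ (fun z : (Fin n → ℝ) × ℝ => N z.1) where
  smooth := hN.smooth.comp contDiff_fst.contMDiff.contMDiffOn fun _ hz => hz.1
  boundary σ hσ _ _ := hN.boundary σ hσ
  closed _ _ := rfl

theorem IsNLoop.hasMDer_fst {N : (Fin n → ℝ) → M} (hN : IsNLoop (E := E) x₀ N)
    {z : (Fin n → ℝ) × ℝ} (hz : z ∈ box n) :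
    HasMDer (fun z : (Fin n → ℝ) × ℝ => N z.1)
      ((cubeDeriv N z.1 : _ →L[ℝ] E).comp (ContinuousLinearMap.fst ℝ (Fin n → ℝ) ℝ)) (box n) z := by
  have h1 : HasMDer N (cubeDeriv N z.1 : _ →L[ℝ] E) (cube n) z.1 :=
    ((hN.smooth z.1 hz.1).mdifferentiableWithinAt (by simp)).hasMFDerivWithinAt
  exact h1.comp_hasFDerivWithinAt (H := Prod.fst) hasFDerivAt_fst.hasFDerivWithinAt
    fun _ hz => hz.1

theorem comp_fst_add_smulRight_coordVec (L : (Fin n → ℝ) →L[ℝ] E) (v : E) :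
    (fun j => (L.comp (ContinuousLinearMap.fst ℝ (Fin n → ℝ) ℝ) +
      (ContinuousLinearMap.snd ℝ (Fin n → ℝ) ℝ).smulRight v) (coordVec n j)) =
      Fin.cons v fun i => L (Pi.single i 1) := by
  ext j
  refine Fin.cases ?_ (fun i => ?_) j <;> simp [coordVec]

theorem IsFlatFrame.density_eq_contraction (h : IsFlatFrame A x₀ p₀ s)
    (hγ : IsPathChoice (E := E) x₀ γ) {N : (Fin n → ℝ) → M} (hN : IsNLoop (E := E) x₀ N)
    (T : ∀ σ, TangentSpace 𝓘(ℝ, E) (N σ)) {Γ : (Fin n → ℝ) × ℝ → M} {z : (Fin n → ℝ) × ℝ}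
    (hz : z ∈ box n) (hΓz : Γ z = N z.1)
    (hΓ : HasMDer Γ (((cubeDeriv N z.1 : _ →L[ℝ] E).comp (ContinuousLinearMap.fst ℝ _ _)) +
      (ContinuousLinearMap.snd ℝ (Fin n → ℝ) ℝ).smulRight (T z.1 : E)) (box n) z) :
    B.density s Γ z = contraction A B p₀ γ N T z.1 := by
  have h1 : (boxDeriv Γ z : _ →L[ℝ] E) = _ :=
    HasMFDerivWithinAt.mfderivWithin hΓ (uniqueDiffOn_box n z hz).uniqueMDiffWithinAt
  rw [h.contraction_eq hγ hN T hz.1, AdjointForm.density, h1, hΓz]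
  exact congrArg (B.inFrame (s (N z.1))) 
    (comp_fst_add_smulRight_coordVec (E := E) _ (T z.1))

/-- The loop resting at `N` is perturbed in disjoint neighbourhoods of `(σ₁, π)` and `(σ₂, π)` to
have velocities `T σ₁` and `T σ₂` there. Its density at these points is then the contraction, and
densities at time `π` commute. -/
theorem IsFlatFrame.bracket_contraction_eq_zero (h : IsFlatFrame A x₀ p₀ s)
    (hγ : IsPathChoice (E := E) x₀ γ) (hr : IsRFlat A B x₀ p₀ γ) {N : (Fin n → ℝ) → M}
    (hN : IsNLoop (E := E) x₀ N) {T : ∀ σ, TangentSpace 𝓘(ℝ, E) (N σ)} (hT : IsDeformation N T)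
    {σ₁ σ₂ : Fin n → ℝ} (hσ₁ : σ₁ ∈ cube n) (hσ₂ : σ₂ ∈ cube n) :
    bracketL G (contraction A B p₀ γ N T σ₁) (contraction A B p₀ γ N T σ₂) = 0 := by
  have hb : ∀ σ ∈ cubeBoundary n, contraction A B p₀ γ N T σ = 0 := fun σ hσ => by
    rw [h.contraction_eq hγ hN T hσ.1]
    refine (B.inFrame _).map_coord_zero 0 ?_
    exact hT.boundary σ hσ
  rcases mem_openCube_or_mem_cubeBoundary hσ₁ with h₁ | h₁
  swap
  · rw [hb σ₁ h₁, map_zero, zero_apply]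
  rcases mem_openCube_or_mem_cubeBoundary hσ₂ with h₂ | h₂
  swap
  · rw [hb σ₂ h₂, map_zero]
  by_cases hne : σ₁ = σ₂
  · rw [hne, bracketL_self]
  have hp := Real.pi_pos
  have hπ : Real.pi ∈ Ioo 0 (2 * Real.pi) := ⟨hp, by linarith⟩
  have hz₁ : (σ₁, Real.pi) ∈ openBox n := ⟨h₁, hπ⟩
  have hz₂ : (σ₂, Real.pi) ∈ openBox n := ⟨h₂, hπ⟩
  obtain ⟨V₁, V₂, hV₁, hV₂, hm₁, hm₂, hd⟩ := t2_separation
    (fun e => hne (congrArg Prod.fst e) : (σ₁, Real.pi) ≠ (σ₂, Real.pi))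
  obtain ⟨Γ₁, hΓ₁, hout₁, hval₁, hder₁⟩ := hN.isLoopOfNLoops.exists_perturbation hz₁
    (hN.hasMDer_fst (openBox_subset_box n hz₁)) (T σ₁ : E) (hV₁.mem_nhds hm₁)
  have hagree₁ : ∀ z ∈ V₂, Γ₁ z = N z.1 := fun z hz => hout₁ z (disjoint_right.1 hd hz)
  have hder₁₂ : HasMDer Γ₁ ((cubeDeriv N σ₂ : _ →L[ℝ] E).comp
      (ContinuousLinearMap.fst ℝ (Fin n → ℝ) ℝ)) (box n) (σ₂, Real.pi) := by
    refine (hN.hasMDer_fst (openBox_subset_box n hz₂)).congr_of_eventuallyEq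
      (nhdsWithin_le_nhds ?_) (hagree₁ _ hm₂)
    filter_upwards [hV₂.mem_nhds hm₂] with z hz using hagree₁ z hz
  -- The second perturbation acts on the first, which is still the resting loop near `(σ₂, π)`;
  -- disjointness preserves the velocity already prescribed at `(σ₁, π)`.
  obtain ⟨Γ₂, hΓ₂, hout₂, hval₂, hder₂⟩ := hΓ₁.exists_perturbation hz₂ hder₁₂ (T σ₂ : E)
    (hV₂.mem_nhds hm₂)
  have hagree₂ : ∀ z ∈ V₁, Γ₂ z = Γ₁ z := fun z hz => hout₂ z (disjoint_left.1 hd hz)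
  have hder₂₁ := hder₁.congr_of_eventuallyEq (g := Γ₂) (nhdsWithin_le_nhds (by
    filter_upwards [hV₁.mem_nhds hm₁] with z hz using hagree₂ z hz)) (hagree₂ _ hm₁)
  rw [← h.density_eq_contraction (B := B) hγ hN T (z := (σ₁, Real.pi)) (openBox_subset_box n hz₁)
      ((hagree₂ _ hm₁).trans hval₁) hder₂₁,
    ← h.density_eq_contraction (B := B) hγ hN T (z := (σ₂, Real.pi)) (openBox_subset_box n hz₂)
      (hval₂.trans (hagree₁ _ hm₂)) hder₂]
  exact h.bracket_density_pi_eq_zero hγ hr hΓ₂ h₁ h₂ hne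

/-- A connection on the loop space that is flat up to reparametrization satisfies the commutation
condition. -/
theorem IsFlatFrame.bracket_contraction_integral_eq_zero (h : IsFlatFrame A x₀ p₀ s)
    (hγ : IsPathChoice (E := E) x₀ γ) (hr : IsRFlat A B x₀ p₀ γ) {N : (Fin n → ℝ) → M}
    (hN : IsNLoop (E := E) x₀ N) {T : ∀ σ, TangentSpace 𝓘(ℝ, E) (N σ)} (hT : IsDeformation N T)
    {σ : Fin n → ℝ} (hσ : σ ∈ cube n) :
    bracket G (contraction A B p₀ γ N T σ) (∫ σ' in cube n, contraction A B p₀ γ N T σ') = 0 := by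
  rw [bracket_eq, ← ContinuousLinearMap.integral_comp_comm _
    ((h.continuousOn_contraction hγ hN hT).integrableOn_compact (isCompact_cube n))]
  exact setIntegral_eq_zero_of_forall_eq_zero fun σ' hσ' =>
    h.bracket_contraction_eq_zero hγ hr hN hT hσ hσ'

end Perturbation

end LoopSpaceConnection

theorem mainTheorem5
    {E : Type*} [NormedAddCommGroup E] [NormedSpace ℝ E] [FiniteDimensional ℝ E]
    {EG : Type*} [NormedAddCommGroup EG] [NormedSpace ℝ EG] [FiniteDimensional ℝ EG]
    {EP : Type*} [NormedAddCommGroup EP] [NormedSpace ℝ EP] [FiniteDimensional ℝ EP]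
    {M : Type*} [TopologicalSpace M] [ChartedSpace E M] [IsManifold 𝓘(ℝ, E) ∞ M]
    [T2Space M] [SecondCountableTopology M] [SimplyConnectedSpace M]
    {G : Type*} [TopologicalSpace G] [ChartedSpace EG G] [Group G] [LieGroup 𝓘(ℝ, EG) ∞ G]
    [T2Space G] [SecondCountableTopology G] [ConnectedSpace G]
    {P : Type*} [TopologicalSpace P] [ChartedSpace EP P] [IsManifold 𝓘(ℝ, EP) ∞ P]
    [T2Space P] [SecondCountableTopology P]
    (π : LoopSpaceConnection.PrincipalBundle E EG EP M G P)
    (A : LoopSpaceConnection.PrincipalConnection π) (hA : A.IsFlat)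
    (n : ℕ) (hn : 1 ≤ n) (B : LoopSpaceConnection.AdjointForm π (n + 1))
    (x₀ : M) (p₀ : P) (hp₀ : π.proj p₀ = x₀)
    (γ : ((Fin n → ℝ) → M) → (Fin n → ℝ) → ℝ → M)
    (hγ : LoopSpaceConnection.IsPathChoice (E := E) x₀ γ) :
    LoopSpaceConnection.IsRFlat A B x₀ p₀ γ ↔
      ∀ N : (Fin n → ℝ) → M, LoopSpaceConnection.IsNLoop (E := E) x₀ N →
        ∀ T : (∀ σ : Fin n → ℝ, TangentSpace 𝓘(ℝ, E) (N σ)),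
          LoopSpaceConnection.IsDeformation N T →
            ∀ σ ∈ LoopSpaceConnection.cube n,
              LoopSpaceConnection.bracket G
                (LoopSpaceConnection.contraction A B p₀ γ N T σ)
                (∫ σ' in LoopSpaceConnection.cube n,
                  LoopSpaceConnection.contraction A B p₀ γ N T σ') = 0 := by
  have : CompleteSpace EG := FiniteDimensional.complete ℝ EG
  obtain ⟨s, hs₀, hs, hsA⟩ := A.exists_horizontal_section hA hp₀
  have h : LoopSpaceConnection.IsFlatFrame A x₀ p₀ s := ⟨hs₀, hs, hsA⟩
  refine ⟨fun hr N hN T hT σ hσ => h.bracket_contraction_integral_eq_zero hγ hr hN hT hσ,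
    fun hC => h.isRFlat hγ fun Γ hΓ z hz z' hz' => h.bracket_density_eq_zero_box hn hΓ
      (fun σ₁ h₁ σ₂ h₂ h₁₂ τ₁ hτ₁ τ₂ hτ₂ =>
        h.bracket_density_eq_zero hγ hC hΓ h₁ h₂ h₁₂ hτ₁ hτ₂) hz hz'⟩
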